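/- Let $n\ge 1$ and let $(M,\omega)$ be an $n$-plectic manifold: $M$ is a (finite dimensional) smooth manifold and $\omega\in\Omega^{n+1}(M)$ is a closed form such that $T_mM\to\Lambda^nT_m^*M$, $v\mapsto i_v\omega_m$, is injective for every $m\in M$. Multivector fields are smooth sections of $\Lambda^\bullet TM$, with $i_{v_1\wedge\dots\wedge v_r}=i_{v_r}\cdots i_{v_1}$, with $L_X\alpha=d\,i_X\alpha-(-1)^{r}i_Xd\alpha$ for $X$ of tensor degree $r$, and with the Schouten bracket $[\cdot,\cdot]$ (the graded antisymmetric extension of the Lie bracket with $[X,Y\wedge Z]=[X,Y]\wedge Z+(-1)^{(|X|-1)|Y|}Y\wedge[X,Z]$). For a form $f$, a multivector field $X$ with $i_X\omega=-df$ is called an associated semi-Hamiltonian multivector field, and a multivector field $Y$ with $i_Y\omega=-f$ an associated Hamiltonian multivector field; $f$ is Hamiltonian if it has both, and $H(M)$ is the vector space of Hamiltonian forms. It is graded by $\deg f=n-r$ for $f$ of tensor degree $r$. Put $e(f)=(-1)^{\deg f}$, $e(f,g)=(-1)^{\deg f\deg g}$, let $e(s;f_1,f_2,f_3)$ be the Koszul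 sign of a permutation $s$, defined by $f_1\otimes f_2\otimes f_3=e(s;f_1,f_2,f_3)\,f_{s_1}\otimes f_{s_2}\otimes f_{s_3}$, and let $Sh(p,q)$ be the set of permutations $s$ of $\{1,\dots,p+q\}$ with $s_1<\dots<s_p$ and $s_{p+1}<\dots<s_{p+q}$. Define $D_1f=-df$ and, for homogeneous $f_i\in H(M)$ with associated semi-Hamiltonian multivector fields $X_i$, $$D_2(f_1,f_2)=e(f_1)L_{X_1}f_2+e(f_1,f_2)e(f_2)L_{X_2}f_1,$$ $$D_3(f_1,f_2,f_3)=-\tfrac12\sum_{s\in Sh(2,1)}e(s;f_1,f_2,f_3)\,e(f_{s_1})e(f_{s_2})\,i_{X_{D_2}(f_{s_1},f_{s_2})}f_{s_3},$$ where $X_{D_2}(f_i,f_j)$ denotes any semi-Hamiltonian multivector field associated to $D_2(f_i,f_j)$; both are extended multilinearly to $H(M)$. Then $D_2(f_1,f_2)$ is a well defined Hamiltonian form, one choice of $X_{D_2}(f_1,f_2)$ being $-2e(f_1)[X_2,X_1]$, and $D_3$ is a well defined (that is, independent of the choice of the fields $X_{D_2}$) trilinear operator $H(M)\times H(M)\times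 H(M)\to H(M)$, which is graded symmetric, i.e. $D_3(f_1,f_2,f_3)=e(s;f_1,f_2,f_3)D_3(f_{s_1},f_{s_2},f_{s_3})$ for every permutation $s$ and homogeneous $f_i$, and homogeneous of degree $-1$. For all homogeneous $f_1,f_2,f_3\in H(M)$ the strong homotopy Jacobi equation in dimension three holds: $$D_1D_3(f_1,f_2,f_3)+\sum_{s\in Sh(1,2)}e(s;f_1,f_2,f_3)D_3(D_1f_{s_1},f_{s_2},f_{s_3})+\sum_{s\in Sh(2,1)}e(s;f_1,f_2,f_3)D_2(D_2(f_{s_1},f_{s_2}),f_{s_3})=0.$$ If $Y_1,Y_2,Y_3$ are associated Hamiltonian and $X_1,X_2,X_3$ associated semi-Hamiltonian multivector fields of $f_1,f_2,f_3$, and the $X_{D_2}(f_i,f_j)$ are any semi-Hamiltonian multivector fields associated to $D_2(f_i,f_j)$, then $$-\tfrac12\sum_{s\in Sh(2,1)}e(s;f_1,f_2,f_3)\,e(f_{s_1})e(f_{s_2})\,Y_{s_3}\wedge X_{D_2}(f_{s_1},f_{s_2})$$ is a Hamiltonian multivector field associated to $D_3(f_1,f_2,f_3)$, and $$\sum_{s\in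 Sh(1,2)}e(s;f_1,f_2,f_3)\,e(f_{s_2})\,[[X_{s_3},X_{s_2}],Y_{s_1}]+\tfrac12\sum_{s\in Sh(2,1)}e(s;f_1,f_2,f_3)\,X_{s_3}\wedge X_{D_2}(f_{s_1},f_{s_2})$$ is a semi-Hamiltonian multivector field associated to $D_3(f_1,f_2,f_3)$. -/

import Mathlib

open scoped Manifold

namespace NPlectic

noncomputable section

section Fibre

variable (V : Type*) [AddCommGroup V] [Module ℝ V] [TopologicalSpace V]

/-- The fibre `⨁ₖ Λᵏ V*` of differential forms of arbitrary (also mixed) tensor degree: a family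
of alternating `k`-linear forms, `k = 0, 1, 2, …` (for `k > dim V` they all vanish). -/
abbrev Alt : Type _ := ∀ k : ℕ, V [⋀^Fin k]→L[ℝ] ℝ

variable {V}

/-- Insertion of a vector in the first slot: `(v₁, …, vₖ) ↦ α (v, v₁, …, vₖ)`. -/
def insertFirst {k : ℕ} (v : V) (α : V [⋀^Fin (k + 1)]→L[ℝ] ℝ) : V [⋀^Fin k]→L[ℝ] ℝ :=
  { α.toAlternatingMap.curryLeft v with
    cont := α.cont.comp (Continuous.matrixVecCons continuous_const continuous_id) }

theorem insertFirst_apply {k : ℕ} (v : V) (α : V [⋀^Fin (k + 1)]→L[ℝ] ℝ) (w : Fin k → V) :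
    insertFirst v α w = α (Matrix.vecCons v w) := rfl

/-- The contraction `i_v` along a vector, acting on forms of all degrees (it kills `0`-forms), as
a linear map in `v`. -/
def contractVec [IsTopologicalAddGroup V] [ContinuousConstSMul ℝ V] :
    V →ₗ[ℝ] Module.End ℝ (Alt V) where
  toFun v :=
    { toFun := fun α k => insertFirst v (α (k + 1))
      map_add' := fun α β => by funext k; ext w; simp [insertFirst_apply]
      map_smul' := fun c α => by funext k; ext w; simp [insertFirst_apply] }
  map_add' v v' := by
    ext α k w
    change (α (k + 1)) (Matrix.vecCons (v + v') w)
      = (α (k + 1)) (Matrix.vecCons v w) + (α (k + 1)) (Matrix.vecCons v' w)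
    exact (α (k + 1)).toAlternatingMap.map_vecCons_add w v v'
  map_smul' c v := by
    ext α k w
    change (α (k + 1)) (Matrix.vecCons (c • v) w) = c • (α (k + 1)) (Matrix.vecCons v w)
    exact (α (k + 1)).toAlternatingMap.map_vecCons_smul w c v

theorem contractVec_contractVec [IsTopologicalAddGroup V] [ContinuousConstSMul ℝ V] (v : V) :
    contractVec v * contractVec v = 0 := by
  ext α k w
  change (α (k + 1 + 1)) (Matrix.vecCons v (Matrix.vecCons v w)) = 0
  exact (α (k + 1 + 1)).toAlternatingMap.map_eq_zero_of_eq _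
    (i := 0) (j := 1) (by simp) (by simp)

/-- Contraction along multivectors: the algebra homomorphism into the opposite of the endomorphism
algebra, so `i_{X ∧ Y} = i_Y ∘ i_X` and `i_{v₁ ∧ … ∧ vᵣ} = i_{vᵣ} ∘ … ∘ i_{v₁}`. -/
def contractAlg [IsTopologicalAddGroup V] [ContinuousConstSMul ℝ V] :
    ExteriorAlgebra ℝ V →ₐ[ℝ] (Module.End ℝ (Alt V))ᵐᵒᵖ :=
  ExteriorAlgebra.lift ℝ
    ⟨(MulOpposite.opLinearEquiv ℝ).toLinearMap ∘ₗ contractVec, fun v => by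
      simp [← MulOpposite.op_mul, contractVec_contractVec]⟩

/-- The contraction `i_X α` of a form `α` along a multivector `X`. -/
def contractPt [IsTopologicalAddGroup V] [ContinuousConstSMul ℝ V]
    (X : ExteriorAlgebra ℝ V) (α : Alt V) : Alt V :=
  (contractAlg X).unop α

theorem contractPt_add_left [IsTopologicalAddGroup V] [ContinuousConstSMul ℝ V] (X Y : ExteriorAlgebra ℝ V) (α : Alt V) :
    contractPt (X + Y) α = contractPt X α + contractPt Y α := by
  simp [contractPt]

theorem contractPt_smul_left [IsTopologicalAddGroup V] [ContinuousConstSMul ℝ V] (c : ℝ) (X : ExteriorAlgebra ℝ V)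
    (α : Alt V) : contractPt (c • X) α = c • contractPt X α := by
  simp [contractPt]

end Fibre

section Manifold

variable (E : Type*) [NormedAddCommGroup E] [NormedSpace ℝ E]
variable (M : Type*) [TopologicalSpace M] [ChartedSpace E M]

/-- (Not necessarily smooth, not necessarily homogeneous) differential forms on `M`. -/
abbrev FormField : Type _ := ∀ x : M, Alt (TangentSpace 𝓘(ℝ, E) x)

/-- (Not necessarily smooth, not necessarily homogeneous) multivector fields on `M`, sections of
the exterior algebra bundle of `TM`. The pointwise product is the wedge product. -/
abbrev MVField : Type _ := ∀ x : M, ExteriorAlgebra ℝ (TangentSpace 𝓘(ℝ, E) x)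

variable {E M}

/-- The differential at `p` of the chart around `x₀`, with `T E` identified with `E`. -/
def chartDeriv (x₀ p : M) : TangentSpace 𝓘(ℝ, E) p →L[ℝ] E :=
  mfderiv 𝓘(ℝ, E) 𝓘(ℝ, E) (chartAt E x₀) p

/-- The differential at `y` of the inverse of the chart around `x₀`. -/
def chartSymmDeriv (x₀ : M) (y : E) : E →L[ℝ] TangentSpace 𝓘(ℝ, E) ((chartAt E x₀).symm y) :=
  mfderiv 𝓘(ℝ, E) 𝓘(ℝ, E) (chartAt E x₀).symm y

/-- The degree `k` part of a form in the chart around `x₀`: its pullback along the inverse of the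
chart. Only its values on the target of the chart matter. -/
def formInChart (x₀ : M) (α : FormField E M) (k : ℕ) (y : E) : E [⋀^Fin k]→L[ℝ] ℝ :=
  (α ((chartAt E x₀).symm y) k).compContinuousLinearMap (chartSymmDeriv x₀ y)

/-- Smoothness of a form: it is smooth in charts. -/
def SmoothForm (α : FormField E M) : Prop :=
  ∀ (x₀ : M) (k : ℕ), ContDiffOn ℝ (⊤ : ℕ∞) (formInChart x₀ α k) (chartAt E x₀).target

/-- A multivector field in the chart around `x₀`: its pushforward along the chart. Only its values
on the target of the chart matter. -/
def mvInChart (x₀ : M) (X : MVField E M) (y : E) : ExteriorAlgebra ℝ E :=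
  ExteriorAlgebra.map (chartDeriv x₀ ((chartAt E x₀).symm y)).toLinearMap
    (X ((chartAt E x₀).symm y))

/-- The exterior derivative, computed at `x` in the chart around `x`. -/
def extD (α : FormField E M) : FormField E M
  | _, 0 => 0
  | x, k + 1 =>
    (extDeriv (formInChart x α k) (chartAt E x x)).compContinuousLinearMap (chartDeriv x x)

/-- The contraction `i_X α`. -/
def contract (X : MVField E M) (α : FormField E M) : FormField E M :=
  fun x => contractPt (X x) (α x)

/-- The Lie derivative along a multivector field, `L_X α = d i_X α - (-1)ʳ i_X d α` for `X` of
tensor degree `r`; the grade involution of the exterior algebra is multiplication by `(-1)ʳ` in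
degree `r`. -/
def lieD (X : MVField E M) (α : FormField E M) : FormField E M :=
  extD (contract X α) - contract (fun x => CliffordAlgebra.involute (X x)) (extD α)

/-- `f` is homogeneous of symmetric degree `a`, i.e. only its part of tensor degree `k` with
`n - k = a` may be nonzero. -/
def HasDeg (n : ℕ) (a : ℤ) (f : FormField E M) : Prop :=
  ∀ (x : M) (k : ℕ), (n : ℤ) - k ≠ a → f x k = 0

/-- The homogeneous component of tensor degree `k`. -/
def component (k : ℕ) (f : FormField E M) : FormField E M := fun x => Pi.single k (f x k)

/-- `(M, ω)` is an `n`-plectic manifold. -/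
structure IsNPlectic (n : ℕ) (ω : FormField E M) : Prop where
  one_le : 1 ≤ n
  smooth : SmoothForm ω
  degree : ∀ (x : M) (k : ℕ), k ≠ n + 1 → ω x k = 0
  closed : extD ω = 0
  nondegenerate : ∀ x : M, Function.Injective
    fun v : TangentSpace 𝓘(ℝ, E) x => contractPt (ExteriorAlgebra.ι ℝ v) (ω x)

theorem formInChart_add (x₀ : M) (α β : FormField E M) (k : ℕ) :
    formInChart x₀ (α + β) k = formInChart x₀ α k + formInChart x₀ β k := by
  funext y; ext v; rfl

theorem formInChart_smul (x₀ : M) (c : ℝ) (α : FormField E M) (k : ℕ) :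
    formInChart x₀ (c • α) k = c • formInChart x₀ α k := by
  funext y; ext v; rfl

theorem SmoothForm.differentiableAt {α : FormField E M} (h : SmoothForm α) (x : M) (k : ℕ) :
    DifferentiableAt ℝ (formInChart x α k) (chartAt E x x) :=
  ((h x k).differentiableOn (by simp)).differentiableAt
    ((chartAt E x).open_target.mem_nhds (mem_chart_target E x))

theorem extD_add {α β : FormField E M} (hα : SmoothForm α) (hβ : SmoothForm β) :
    extD (α + β) = extD α + extD β := by
  funext x k
  cases k with
  | zero => simp [extD]
  | succ k =>
    ext v
    simp [extD, formInChart_add, extDeriv_add (hα.differentiableAt x k) (hβ.differentiableAt x k)]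

theorem extD_smul (c : ℝ) (α : FormField E M) : extD (c • α) = c • extD α := by
  funext x k
  cases k with
  | zero => simp [extD]
  | succ k =>
    ext v
    simp [extD, formInChart_smul, extDeriv_smul]

theorem SmoothForm.add {α β : FormField E M} (hα : SmoothForm α) (hβ : SmoothForm β) :
    SmoothForm (α + β) := fun x₀ k => by
  rw [formInChart_add]; exact (hα x₀ k).add (hβ x₀ k)

theorem SmoothForm.smul (c : ℝ) {α : FormField E M} (hα : SmoothForm α) :
    SmoothForm (c • α) := fun x₀ k => by
  rw [formInChart_smul]; exact (hα x₀ k).const_smul c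

theorem smoothForm_zero : SmoothForm (0 : FormField E M) := fun x₀ k => by
  have h : formInChart x₀ (0 : FormField E M) k = fun _ => 0 := by funext y; ext v; rfl
  rw [h]; exact contDiffOn_const

variable [FiniteDimensional ℝ E]

variable (E) in
/-- The basis `e_{i₁} ∧ … ∧ e_{iᵣ}`, `i₁ < … < iᵣ`, of the exterior algebra of the model space. -/
def extBasis : Module.Basis (Finset (Fin (Module.finrank ℝ E))) ℝ (ExteriorAlgebra ℝ E) :=
  (Module.finBasis ℝ E).ExteriorAlgebra

/-- Smoothness of a multivector field: its coefficients in charts are smooth. -/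
def SmoothMV (X : MVField E M) : Prop :=
  ∀ (x₀ : M) (S : Finset (Fin (Module.finrank ℝ E))),
    ContDiffOn ℝ (⊤ : ℕ∞) (fun y => (extBasis E).repr (mvInChart x₀ X y) S) (chartAt E x₀).target

/-- The coefficientwise partial derivative `∂ᵢ Z` of a multivector field on the model space. -/
def partialMV (Z : E → ExteriorAlgebra ℝ E) (y : E) (i : Fin (Module.finrank ℝ E)) :
    ExteriorAlgebra ℝ E :=
  ∑ S, (fderiv ℝ (fun z => (extBasis E).repr (Z z) S) y (Module.finBasis ℝ E i)) • extBasis E S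

/-- The Schouten bracket on the model space,
`[Z, W] = ∑ᵢ (Z ⌊ dxⁱ) ∧ ∂ᵢW - ∂ᵢZ ∧ (dxⁱ ⌋ W)`, where `dxⁱ ⌋` and `⌊ dxⁱ` are the left and the
right interior products with the `i`-th coordinate form. On vector fields it is the Lie bracket, it
satisfies `[Z, U ∧ W] = [Z, U] ∧ W + (-1)^((|Z| - 1)|U|) U ∧ [Z, W]`, and
`[Z, W] = -(-1)^((|Z| - 1)(|W| - 1)) [W, Z]`. -/
def schoutenModel (Z W : E → ExteriorAlgebra ℝ E) (y : E) : ExteriorAlgebra ℝ E :=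
  ∑ i, (CliffordAlgebra.contractRight (Z y) ((Module.finBasis ℝ E).coord i) * partialMV W y i
    - partialMV Z y i * CliffordAlgebra.contractLeft ((Module.finBasis ℝ E).coord i) (W y))

/-- The Schouten bracket of multivector fields on `M`, computed at `x` in the chart around `x`. -/
def schouten (X Y : MVField E M) : MVField E M := fun x =>
  ExteriorAlgebra.map (ContinuousLinearMap.inverse (chartDeriv x x)).toLinearMap
    (schoutenModel (mvInChart x X) (mvInChart x Y) (chartAt E x x))

/-- `X` is a semi-Hamiltonian multivector field associated to `f`: `i_X ω = -df`. -/
def IsSemiHam (ω : FormField E M) (X : MVField E M) (f : FormField E M) : Prop :=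
  SmoothMV X ∧ contract X ω = -extD f

/-- `Y` is a Hamiltonian multivector field associated to `f`: `i_Y ω = -f`. -/
def IsHam (ω : FormField E M) (Y : MVField E M) (f : FormField E M) : Prop :=
  SmoothMV Y ∧ contract Y ω = -f

theorem SmoothMV.add {X Y : MVField E M} (hX : SmoothMV X) (hY : SmoothMV Y) :
    SmoothMV (X + Y) := fun x₀ S => by
  simpa [mvInChart] using (hX x₀ S).add (hY x₀ S)

theorem SmoothMV.smul (c : ℝ) {X : MVField E M} (hX : SmoothMV X) :
    SmoothMV (c • X) := fun x₀ S => by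
  simpa [mvInChart] using (hX x₀ S).const_smul c

theorem IsSemiHam.add {ω f g : FormField E M} {X Y : MVField E M} (hf : SmoothForm f)
    (hg : SmoothForm g) (hX : IsSemiHam ω X f) (hY : IsSemiHam ω Y g) :
    IsSemiHam ω (X + Y) (f + g) := by
  refine ⟨hX.1.add hY.1, ?_⟩
  rw [extD_add hf hg, neg_add, ← hX.2, ← hY.2]
  funext x
  exact contractPt_add_left _ _ _

theorem IsSemiHam.smul (c : ℝ) {ω f : FormField E M} {X : MVField E M} (hX : IsSemiHam ω X f) :
    IsSemiHam ω (c • X) (c • f) := by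
  refine ⟨hX.1.smul c, ?_⟩
  rw [extD_smul, show -(c • extD f) = c • -extD f from (smul_neg c (extD f)).symm, ← hX.2]
  funext x
  exact contractPt_smul_left _ _ _

theorem IsHam.add {ω f g : FormField E M} {X Y : MVField E M} (hX : IsHam ω X f)
    (hY : IsHam ω Y g) : IsHam ω (X + Y) (f + g) := by
  refine ⟨hX.1.add hY.1, ?_⟩
  rw [neg_add, ← hX.2, ← hY.2]
  funext x
  exact contractPt_add_left _ _ _

theorem IsHam.smul (c : ℝ) {ω f : FormField E M} {X : MVField E M} (hX : IsHam ω X f) :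
    IsHam ω (c • X) (c • f) := by
  refine ⟨hX.1.smul c, ?_⟩
  rw [show -(c • f) = c • -f from (smul_neg c f).symm, ← hX.2]
  funext x
  exact contractPt_smul_left _ _ _

theorem smoothMV_zero : SmoothMV (0 : MVField E M) := fun x₀ S => by
  simpa [mvInChart] using contDiffOn_const

/-- The space `H(M)` of Hamiltonian forms: smooth forms with an associated semi-Hamiltonian and an
associated Hamiltonian multivector field. -/
def hamForms (ω : FormField E M) : Submodule ℝ (FormField E M) where
  carrier := {f | SmoothForm f ∧ (∃ X, IsSemiHam ω X f) ∧ ∃ Y, IsHam ω Y f}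
  add_mem' := by
    rintro f g ⟨hf, ⟨X, hX⟩, Y, hY⟩ ⟨hg, ⟨X', hX'⟩, Y', hY'⟩
    exact ⟨hf.add hg, ⟨_, hX.add hf hg hX'⟩, _, hY.add hY'⟩
  zero_mem' := by
    have h0 : contract (0 : MVField E M) ω = 0 := by
      funext x; simpa [contract] using contractPt_smul_left (0 : ℝ) 0 (ω x)
    have hd : extD (0 : FormField E M) = 0 := by simpa using extD_smul (0 : ℝ) (0 : FormField E M)
    exact ⟨smoothForm_zero, ⟨0, smoothMV_zero, by rw [h0, hd, neg_zero]⟩,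
      0, smoothMV_zero, by rw [h0, neg_zero]⟩
  smul_mem' := by
    rintro c f ⟨hf, ⟨X, hX⟩, Y, hY⟩
    exact ⟨hf.smul c, ⟨_, hX.smul c⟩, _, hY.smul c⟩

/-- `(-1)ᵃ`. With `a = deg f` this is `e(f)`, with `a = deg f * deg g` it is `e(f, g)`. -/
def sgn (a : ℤ) : ℝ := (a.negOnePow : ℤ)

/-- The Koszul sign `e(s; v₁, …, vₘ)` of a permutation `s` and vectors of degrees `a₁, …, aₘ`,
defined by `v₁ ⊗ … ⊗ vₘ = e(s; v₁, …, vₘ) v_{s₁} ⊗ … ⊗ v_{sₘ}`: one factor `(-1)^(a_{sᵢ} a_{sⱼ})`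
for every inversion of `s`. -/
def koszul {m : ℕ} (s : Equiv.Perm (Fin m)) (a : Fin m → ℤ) : ℝ :=
  ∏ i, ∏ j, if i < j ∧ s j < s i then sgn (a (s i) * a (s j)) else 1

/-- The set `Sh(p, q)` of shuffles of `p + q` elements. -/
def shuffles (p q : ℕ) : Finset (Equiv.Perm (Fin (p + q))) :=
  {s | ∀ i j : Fin (p + q), i < j → ((j : ℕ) < p ∨ p ≤ (i : ℕ)) → s i < s j}

open Classical in
/-- A choice of a semi-Hamiltonian multivector field associated to `f`. -/
def someSemiHam (ω f : FormField E M) : MVField E M :=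
  if h : ∃ X, IsSemiHam ω X f then h.choose else 0

/-- The differential `D₁ f = -df`. -/
def D₁ (f : FormField E M) : FormField E M := -extD f

/-- The formula for the bracket `D₂(f₁, f₂)` of forms `f₁`, `f₂` of degrees `a₁`, `a₂`, in terms of
associated semi-Hamiltonian multivector fields `X₁`, `X₂`. -/
def D₂formula (a₁ a₂ : ℤ) (X₁ X₂ : MVField E M) (f₁ f₂ : FormField E M) : FormField E M :=
  sgn a₁ • lieD X₁ f₂ + (sgn (a₁ * a₂) * sgn a₂) • lieD X₂ f₁

/-- The bracket `D₂`: defined on homogeneous forms by the formula above and extended bilinearly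
through the decomposition into homogeneous components. -/
def D₂ (n : ℕ) (ω f₁ f₂ : FormField E M) : FormField E M :=
  ∑ k ∈ Finset.range (Module.finrank ℝ E + 1), ∑ l ∈ Finset.range (Module.finrank ℝ E + 1),
    D₂formula (n - k) (n - l) (someSemiHam ω (component k f₁)) (someSemiHam ω (component l f₂))
      (component k f₁) (component l f₂)

/-- The formula for the bracket `D₃(f₁, f₂, f₃)` of forms `fᵢ` of degrees `aᵢ`, in terms of
semi-Hamiltonian multivector fields `Z i j` associated to the forms `D₂(fᵢ, fⱼ)`. -/
def D₃formula (a : Fin 3 → ℤ) (Z : Fin 3 → Fin 3 → MVField E M) (f : Fin 3 → FormField E M) :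
    FormField E M :=
  (-(1 / 2) : ℝ) • ∑ s ∈ shuffles 2 1,
    (koszul s a * sgn (a (s 0)) * sgn (a (s 1))) • contract (Z (s 0) (s 1)) (f (s 2))

/-- The bracket `D₃`: defined on homogeneous forms by the formula above and extended trilinearly
through the decomposition into homogeneous components. -/
def D₃ (n : ℕ) (ω : FormField E M) (f : Fin 3 → FormField E M) : FormField E M :=
  ∑ k : Fin 3 → Fin (Module.finrank ℝ E + 1),
    D₃formula (fun i => n - (k i : ℕ))
      (fun i j => someSemiHam ω (D₂ n ω (component (k i) (f i)) (component (k j) (f j))))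
      (fun i => component (k i) (f i))

end Manifold

end

end NPlectic

open NPlectic

/-! Two facts carry the proof. The first is the Cartan formula `i_[X,Y] = (-1)^((r-1)s) L_X i_Y -
i_Y L_X` for fields of parities `r` and `s`. On the model space, write `d = ∑ dxⁱ ∧ ∂ᵢ` and move
`dxⁱ ∧` past a contraction; the commutator is the contraction along `X ⌊ dxⁱ`
(`wedgeCov_contractPt`), and the coordinate expression of the bracket appears
(`contractPt_schoutenModel`). Contraction is faithful, so the formula determines the bracket from
`d` and contractions. These commute with pullbacks, hence the bracket does not depend on coordinates
(`schoutenModel_natural`) and the formula passes to `M` (`contract_schouten`).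

The second is that a field `K` with `i_K ω = 0` annihilates every contraction of `ω`, because
multivectors commute up to the grade involution and `ω` is homogeneous. A Hamiltonian form and its
differential are contractions of `ω`, so contracting them along an associated field does not depend
on the choice of that field (`contract_congr`), and the field may be taken homogeneous. Moreover
`i_X dg = ± i_Y df` for fields `X`, `Y` of `f`, `g`, as both are double contractions of `ω`
(`IsSemiHam.contract_extD_comm`).

Consequently `D₂(f, g)` equals `-2 i_X dg` up to exact terms (`D₂formula_eq`), and `[Y, X]` is a
multiple of a field of it, since `i_[Y,X] ω = ± L_Y df`. `D₃` is a combination of forms `i_Z h` with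
`Z` a field of `D₂(f, g)`. If `i_W ω = -h`, then `i_(W ∧ Z) ω = -i_Z h`, which gives Hamiltonian
fields; `d i_Z h = L_Z h ± i_Z dh` gives the semi-Hamiltonian ones.

For the Jacobi equation, all terms are expanded into forms of the types `d i d i f`, `d i i d f` and
`i d i d f`. The first type cancels identically, and the second consists of a single form up to
sign. What remains is a multiple of one relation, obtained by computing `i_Z df₃`, with `Z` a field
of `D₂(f₁, f₂)`, once by the symmetry above (`triple_extD`) and once by the Cartan formula
(`triple_extD_eq_cartan`). -/

namespace NPlectic

noncomputable section

open scoped Manifold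

set_option linter.unusedSectionVars false

/-! ### Graded commutativity, signs and interior products in the exterior algebra. -/

section SuperAlgebra

variable {V W : Type*} [AddCommGroup V] [Module ℝ V] [AddCommGroup W] [Module ℝ W]

theorem map_involute (A : V →ₗ[ℝ] W) (x : ExteriorAlgebra ℝ V) :
    ExteriorAlgebra.map A (CliffordAlgebra.involute x)
      = CliffordAlgebra.involute (ExteriorAlgebra.map A x) := by
  induction x using ExteriorAlgebra.induction with
  | algebraMap r => simp
  | ι v =>
    rw [show CliffordAlgebra.involute (ExteriorAlgebra.ι ℝ v) = -ExteriorAlgebra.ι ℝ v from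
      CliffordAlgebra.involute_ι v, map_neg, ExteriorAlgebra.map_apply_ι]
    exact (CliffordAlgebra.involute_ι _).symm
  | mul a b ha hb => simp [ha, hb]
  | add a b ha hb => simp [ha, hb]

theorem ι_mul_eq_involute_mul_ι (v : V) (x : ExteriorAlgebra ℝ V) :
    ExteriorAlgebra.ι ℝ v * x = CliffordAlgebra.involute x * ExteriorAlgebra.ι ℝ v := by
  induction x using ExteriorAlgebra.induction with
  | algebraMap r => simp [Algebra.commutes]
  | ι w =>
    rw [show CliffordAlgebra.involute (ExteriorAlgebra.ι ℝ w) = -ExteriorAlgebra.ι ℝ w from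
      CliffordAlgebra.involute_ι w, neg_mul]
    exact eq_neg_of_add_eq_zero_left (ExteriorAlgebra.ι_add_mul_swap v w)
  | mul a b ha hb => rw [← mul_assoc, ha, mul_assoc, hb, map_mul, mul_assoc]
  | add a b ha hb => rw [mul_add, ha, hb, map_add, add_mul]

/-- Even elements of the exterior algebra are central. -/
theorem mul_comm_of_involute_eq {x : ExteriorAlgebra ℝ V} (hx : CliffordAlgebra.involute x = x)
    (y : ExteriorAlgebra ℝ V) : y * x = x * y := by
  induction y using ExteriorAlgebra.induction with
  | algebraMap r => exact Algebra.commutes r x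
  | ι v => rw [ι_mul_eq_involute_mul_ι, hx]
  | mul a b ha hb => rw [mul_assoc, hb, ← mul_assoc, ha, mul_assoc]
  | add a b ha hb => rw [add_mul, ha, hb, mul_add]

/-- Odd elements of the exterior algebra commute with all others up to the grade involution. -/
theorem mul_comm_of_involute_eq_neg {x : ExteriorAlgebra ℝ V}
    (hx : CliffordAlgebra.involute x = -x) (y : ExteriorAlgebra ℝ V) :
    y * x = x * CliffordAlgebra.involute y := by
  induction y using ExteriorAlgebra.induction with
  | algebraMap r => simp [Algebra.commutes]
  | ι v =>
    rw [ι_mul_eq_involute_mul_ι, hx, show CliffordAlgebra.involute (ExteriorAlgebra.ι ℝ v)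
      = -ExteriorAlgebra.ι ℝ v from CliffordAlgebra.involute_ι v, neg_mul, mul_neg]
  | mul a b ha hb => rw [mul_assoc, hb, ← mul_assoc, ha, mul_assoc, map_mul]
  | add a b ha hb => rw [add_mul, ha, hb, map_add, mul_add]

theorem sgn_of_even {a : ℤ} (h : Even a) : sgn a = 1 := by simp [sgn, Int.negOnePow_even a h]

theorem sgn_of_odd {a : ℤ} (h : Odd a) : sgn a = -1 := by simp [sgn, Int.negOnePow_odd a h]

theorem sgn_add (a b : ℤ) : sgn (a + b) = sgn a * sgn b := by simp [sgn, Int.negOnePow_add]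

theorem sgn_sub (a b : ℤ) : sgn (a - b) = sgn a * sgn b := by simp [sgn, Int.negOnePow_sub]

theorem sgn_zero : sgn 0 = 1 := by simp [sgn]

theorem sgn_one : sgn 1 = -1 := by simp [sgn]

theorem sgn_mul_self (a : ℤ) : sgn a * sgn a = 1 := by
  rcases Int.even_or_odd a with h | h <;> simp [sgn_of_even, sgn_of_odd, h]

/-- Only parities matter for the sign, so homogeneity is replaced by an eigenvalue condition for the
grade involution, which the even and odd parts of a mixed field also satisfy. -/
theorem mul_eq_sgn_smul_mul {x y : ExteriorAlgebra ℝ V} {r s : ℤ}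
    (hx : CliffordAlgebra.involute x = sgn r • x) (hy : CliffordAlgebra.involute y = sgn s • y) :
    y * x = sgn (r * s) • (x * y) := by
  rcases Int.even_or_odd r with hr | hr
  · rw [sgn_of_even hr, one_smul] at hx
    rw [sgn_of_even (hr.mul_right s), one_smul, mul_comm_of_involute_eq hx]
  · rw [sgn_of_odd hr, neg_one_smul] at hx
    rw [mul_comm_of_involute_eq_neg hx, hy, mul_smul_comm]
    rcases Int.even_or_odd s with hs | hs
    · rw [sgn_of_even hs, sgn_of_even (hs.mul_left r)]
    · rw [sgn_of_odd hs, sgn_of_odd (hr.mul hs)]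

/-- The one-vector rule is iterated by splitting vectors off the left of `x`; each vector passed
contributes a sign, which the grade involution collects. -/
theorem contractLeft_mul (d : Module.Dual ℝ V) (x y : ExteriorAlgebra ℝ V) :
    CliffordAlgebra.contractLeft d (x * y) = CliffordAlgebra.contractLeft d x * y
      + CliffordAlgebra.involute x * CliffordAlgebra.contractLeft d y := by
  induction x using CliffordAlgebra.left_induction generalizing y with
  | algebraMap r =>
    rw [CliffordAlgebra.contractLeft_algebraMap_mul, CliffordAlgebra.contractLeft_algebraMap]
    simp
  | add a b ha hb => simp only [add_mul, map_add, ha, hb]; abel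
  | ι_mul x v hx =>
    rw [mul_assoc, CliffordAlgebra.contractLeft_ι_mul, hx, CliffordAlgebra.contractLeft_ι_mul,
      map_mul, CliffordAlgebra.involute_ι]
    simp only [sub_mul, mul_add, smul_mul_assoc, mul_assoc, neg_mul]
    abel

/-- In degree `k` the two interior products differ by `(-1)^(k-1)`, the parity of the result. This
turns the left product in `schoutenModel` into the right one that commutators produce. -/
theorem contractLeft_eq_involute_contractRight (d : Module.Dual ℝ V) (x : ExteriorAlgebra ℝ V) :
    CliffordAlgebra.contractLeft d x
      = CliffordAlgebra.involute (CliffordAlgebra.contractRight x d) := by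
  induction x using CliffordAlgebra.right_induction with
  | algebraMap r =>
    rw [CliffordAlgebra.contractLeft_algebraMap, CliffordAlgebra.contractRight_algebraMap, map_zero]
  | add a b ha hb => simp only [map_add, LinearMap.add_apply, ha, hb]
  | mul_ι v x hx =>
    rw [contractLeft_mul, hx, CliffordAlgebra.contractRight_mul_ι, CliffordAlgebra.contractLeft_ι,
      map_sub, map_mul, map_smul, CliffordAlgebra.involute_ι, mul_neg, sub_neg_eq_add,
      Algebra.smul_def, Algebra.commutes, add_comm]

theorem involute_contractRight (d : Module.Dual ℝ V) (x : ExteriorAlgebra ℝ V) :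
    CliffordAlgebra.involute (CliffordAlgebra.contractRight x d)
      = -CliffordAlgebra.contractRight (CliffordAlgebra.involute x) d := by
  induction x using CliffordAlgebra.right_induction with
  | algebraMap r =>
    rw [AlgHom.commutes, CliffordAlgebra.contractRight_algebraMap, map_zero, neg_zero]
  | add a b ha hb => simp only [map_add, LinearMap.add_apply, ha, hb, neg_add]
  | mul_ι v x hx =>
    rw [CliffordAlgebra.contractRight_mul_ι, map_sub, map_smul, map_mul, map_mul, hx,
      CliffordAlgebra.involute_ι]
    simp only [mul_neg, neg_mul, map_neg, LinearMap.neg_apply, neg_neg,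
      CliffordAlgebra.contractRight_mul_ι]

end SuperAlgebra

/-! ### Contraction and pullback of forms at a point. -/

section Contraction

variable {V W : Type*} [AddCommGroup V] [Module ℝ V] [TopologicalSpace V]
  [IsTopologicalAddGroup V] [ContinuousConstSMul ℝ V]
  [AddCommGroup W] [Module ℝ W] [TopologicalSpace W]
  [IsTopologicalAddGroup W] [ContinuousConstSMul ℝ W]

theorem contractPt_mul (X Y : ExteriorAlgebra ℝ V) (α : Alt V) :
    contractPt (X * Y) α = contractPt Y (contractPt X α) := by
  simp [contractPt]

theorem contractPt_algebraMap (r : ℝ) (α : Alt V) :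
    contractPt (algebraMap ℝ (ExteriorAlgebra ℝ V) r) α = r • α := by
  unfold contractPt
  rw [AlgHom.commutes]; rfl

theorem contractPt_ι (v : V) (α : Alt V) :
    contractPt (ExteriorAlgebra.ι ℝ v) α = contractVec v α := by
  simp [contractPt, contractAlg]

theorem contractVec_apply (v : V) (α : Alt V) (k : ℕ) :
    contractVec v α k = insertFirst v (α (k + 1)) := rfl

theorem contractPt_add (X : ExteriorAlgebra ℝ V) (α β : Alt V) :
    contractPt X (α + β) = contractPt X α + contractPt X β := map_add (contractAlg X).unop α β

theorem contractPt_smul (X : ExteriorAlgebra ℝ V) (c : ℝ) (α : Alt V) :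
    contractPt X (c • α) = c • contractPt X α := map_smul (contractAlg X).unop c α

theorem contractPt_neg (X : ExteriorAlgebra ℝ V) (α : Alt V) :
    contractPt X (-α) = -contractPt X α := map_neg (contractAlg X).unop α

theorem contractPt_zero (X : ExteriorAlgebra ℝ V) :
    contractPt X (0 : Alt V) = 0 := map_zero (contractAlg X).unop

theorem contractPt_sum {ι : Type*} (s : Finset ι) (X : ExteriorAlgebra ℝ V) (α : ι → Alt V) :
    contractPt X (∑ i ∈ s, α i) = ∑ i ∈ s, contractPt X (α i) := map_sum (contractAlg X).unop α s

/-- Contraction as a linear map in the multivector. -/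
def contractLin (α : Alt V) : ExteriorAlgebra ℝ V →ₗ[ℝ] Alt V where
  toFun X := contractPt X α
  map_add' X Y := contractPt_add_left X Y α
  map_smul' c X := contractPt_smul_left c X α

theorem contractPt_sum_left {ι : Type*} (s : Finset ι) (X : ι → ExteriorAlgebra ℝ V) (α : Alt V) :
    contractPt (∑ i ∈ s, X i) α = ∑ i ∈ s, contractPt (X i) α := map_sum (contractLin α) X s

theorem contractPt_neg_left (X : ExteriorAlgebra ℝ V) (α : Alt V) :
    contractPt (-X) α = -contractPt X α := map_neg (contractLin α) X

theorem contractPt_sub_left (X Y : ExteriorAlgebra ℝ V) (α : Alt V) :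
    contractPt (X - Y) α = contractPt X α - contractPt Y α := map_sub (contractLin α) X Y

theorem contractPt_zero_left (α : Alt V) :
    contractPt (0 : ExteriorAlgebra ℝ V) α = 0 := map_zero (contractLin α)

theorem contractPt_contractPt_comm {X Y : ExteriorAlgebra ℝ V} {r s : ℤ}
    (hX : CliffordAlgebra.involute X = sgn r • X) (hY : CliffordAlgebra.involute Y = sgn s • Y)
    (α : Alt V) :
    contractPt X (contractPt Y α) = sgn (r * s) • contractPt Y (contractPt X α) := by
  rw [← contractPt_mul, ← contractPt_mul, mul_eq_sgn_smul_mul hX hY, contractPt_smul_left]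

/-- The pullback of forms of all degrees along a linear map. -/
def pullAlt (A : V →L[ℝ] W) (α : Alt W) : Alt V := fun k => (α k).compContinuousLinearMap A

theorem pullAlt_add (A : V →L[ℝ] W) (α β : Alt W) :
    pullAlt A (α + β) = pullAlt A α + pullAlt A β := rfl

theorem pullAlt_smul (A : V →L[ℝ] W) (c : ℝ) (α : Alt W) :
    pullAlt A (c • α) = c • pullAlt A α := rfl

theorem pullAlt_sub (A : V →L[ℝ] W) (α β : Alt W) :
    pullAlt A (α - β) = pullAlt A α - pullAlt A β := rfl

theorem contractVec_pullAlt (A : V →L[ℝ] W) (v : V) (α : Alt W) :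
    contractVec v (pullAlt A α) = pullAlt A (contractVec (A v) α) := by
  funext k
  ext w
  change α (k + 1) (A ∘ Matrix.vecCons v w) = α (k + 1) (Matrix.vecCons (A v) (A ∘ w))
  congr 1
  funext i
  refine Fin.cases ?_ (fun i => ?_) i <;> simp

/-- Contraction is natural: `i_X (A^* α) = A^* (i_{A_* X} α)`. -/
theorem contractPt_pullAlt (A : V →L[ℝ] W) (X : ExteriorAlgebra ℝ V) (α : Alt W) :
    contractPt X (pullAlt A α)
      = pullAlt A (contractPt (ExteriorAlgebra.map A.toLinearMap X) α) := by
  induction X using ExteriorAlgebra.induction generalizing α with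
  | algebraMap r => rw [AlgHom.commutes, contractPt_algebraMap, contractPt_algebraMap, pullAlt_smul]
  | ι v => rw [ExteriorAlgebra.map_apply_ι, contractPt_ι, contractPt_ι, contractVec_pullAlt]; rfl
  | mul a b ha hb => rw [map_mul, contractPt_mul, contractPt_mul, ha, hb]
  | add a b ha hb =>
    rw [map_add, contractPt_add_left, contractPt_add_left, ha, hb, pullAlt_add]

/-- The function part of `i_X α` is the full pairing of `X` with `α`. Such pairings exhaust the dual
of the exterior algebra, which later gives faithfulness of contraction. -/
theorem contractPt_apply_zero (X : ExteriorAlgebra ℝ V) (α : Alt V) (w : Fin 0 → V) :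
    contractPt X α 0 w = ExteriorAlgebra.liftAlternating (R := ℝ) (M := V) (N := ℝ)
      (fun k => (α k).toAlternatingMap) X := by
  induction X using CliffordAlgebra.left_induction generalizing α with
  | algebraMap r =>
    rw [contractPt_algebraMap]
    refine Eq.trans ?_ (ExteriorAlgebra.liftAlternating_algebraMap _ r).symm
    rw [Subsingleton.elim w 0]; rfl
  | add a b ha hb =>
    rw [contractPt_add_left, map_add, ← ha, ← hb]; rfl
  | ι_mul x v hx =>
    refine Eq.trans ?_ (ExteriorAlgebra.liftAlternating_ι_mul _ v x).symm
    rw [contractPt_mul, hx]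
    refine congrArg (fun g => ExteriorAlgebra.liftAlternating (R := ℝ) (M := V) (N := ℝ) g x) ?_
    funext k
    have : contractPt (CliffordAlgebra.ι (0 : QuadraticForm ℝ V) v) α = contractVec v α :=
      contractPt_ι v α
    rw [this]; rfl

end Contraction

/-! ### Homogeneous parts of multivectors. -/

section Degree

variable {V W : Type*} [AddCommGroup V] [Module ℝ V] [AddCommGroup W] [Module ℝ W]

/-- The projection onto the part of integer degree `a` of the exterior algebra, which is zero for
negative `a`. -/
def degProj (a : ℤ) : ExteriorAlgebra ℝ V →ₗ[ℝ] ExteriorAlgebra ℝ V :=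
  if 0 ≤ a then GradedAlgebra.proj (fun i : ℕ => ⋀[ℝ]^i V) a.toNat else 0

theorem degProj_of_mem {i : ℕ} {x : ExteriorAlgebra ℝ V} (hx : x ∈ ⋀[ℝ]^i V) (a : ℤ) :
    degProj a x = if (i : ℤ) = a then x else 0 := by
  unfold degProj
  by_cases ha : 0 ≤ a
  · lift a to ℕ using ha
    simp only [Nat.cast_nonneg, if_true, Int.toNat_natCast, Nat.cast_inj, GradedAlgebra.proj_apply]
    by_cases h : i = a
    · subst h; rw [if_pos rfl]; exact DirectSum.decompose_of_mem_same _ hx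
    · rw [if_neg h]; exact DirectSum.decompose_of_mem_ne _ hx h
  · rw [if_neg ha, if_neg (by lia)]; rfl

theorem exteriorAlgebra_graded_induction {P : ExteriorAlgebra ℝ V → Prop}
    (mem : ∀ (i : ℕ) (x : ExteriorAlgebra ℝ V), x ∈ ⋀[ℝ]^i V → P x)
    (add : ∀ x y, P x → P y → P (x + y)) (x : ExteriorAlgebra ℝ V) : P x :=
  DirectSum.Decomposition.inductionOn (fun i : ℕ => ⋀[ℝ]^i V) (mem 0 0 (Submodule.zero_mem _))
    (fun m => mem _ m m.2) add x

theorem map_mem_exteriorPower (A : V →ₗ[ℝ] W) {i : ℕ} {x : ExteriorAlgebra ℝ V}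
    (hx : x ∈ ⋀[ℝ]^i V) : ExteriorAlgebra.map A x ∈ ⋀[ℝ]^i W := by
  induction hx using Submodule.pow_induction_on_right' with
  | algebraMap r =>
    rw [AlgHom.commutes]
    exact Submodule.mem_one.2 ⟨r, rfl⟩
  | add x y i hx hy h h' => rw [map_add]; exact add_mem h h'
  | mul_mem i x hx h m hm =>
    obtain ⟨v, rfl⟩ := hm
    rw [map_mul, ExteriorAlgebra.map_apply_ι]
    exact Submodule.mul_mem_mul h ⟨_, rfl⟩

theorem map_degProj (A : V →ₗ[ℝ] W) (a : ℤ) (x : ExteriorAlgebra ℝ V) :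
    ExteriorAlgebra.map A (degProj a x) = degProj a (ExteriorAlgebra.map A x) := by
  induction x using exteriorAlgebra_graded_induction with
  | mem i x hx =>
    rw [degProj_of_mem hx, degProj_of_mem (map_mem_exteriorPower A hx)]
    split_ifs <;> simp
  | add x y hx hy => simp only [map_add, hx, hy]

theorem involute_of_mem_exteriorPower {i : ℕ} {x : ExteriorAlgebra ℝ V} (hx : x ∈ ⋀[ℝ]^i V) :
    CliffordAlgebra.involute x = sgn i • x := by
  induction hx using Submodule.pow_induction_on_right' with
  | algebraMap r => simp [sgn_zero]
  | add x y i hx hy h h' => rw [map_add, h, h', smul_add]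
  | mul_mem i x hx h m hm =>
    obtain ⟨v, rfl⟩ := hm
    rw [map_mul, h, show CliffordAlgebra.involute (ExteriorAlgebra.ι ℝ v)
      = -ExteriorAlgebra.ι ℝ v from CliffordAlgebra.involute_ι v]
    simp [sgn_add, sgn_one]

theorem involute_degProj (a : ℤ) (x : ExteriorAlgebra ℝ V) :
    CliffordAlgebra.involute (degProj a x) = sgn a • degProj a x := by
  induction x using exteriorAlgebra_graded_induction with
  | mem i x hx =>
    rw [degProj_of_mem hx]
    split_ifs with h
    · rw [involute_of_mem_exteriorPower hx, h]
    · simp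
  | add x y hx hy => simp only [map_add, hx, hy, smul_add]

theorem degProj_degProj (a : ℤ) (x : ExteriorAlgebra ℝ V) :
    degProj a (degProj a x) = degProj a x := by
  induction x using exteriorAlgebra_graded_induction with
  | mem i x hx =>
    rw [degProj_of_mem hx]
    split_ifs with h
    · rw [degProj_of_mem hx, if_pos h]
    · simp
  | add x y hx hy => simp only [map_add, hx, hy]

variable [TopologicalSpace V] [IsTopologicalAddGroup V] [ContinuousConstSMul ℝ V]

/-- Splitting off the last vector of `x` lowers `i` by one and raises the relevant degree of the
result by one, so `k + i` stays fixed. -/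
theorem contractPt_eq_zero_of_mem {i : ℕ} {x : ExteriorAlgebra ℝ V} (hx : x ∈ ⋀[ℝ]^i V)
    {α : Alt V} {k : ℕ} (hα : α (k + i) = 0) : contractPt x α k = 0 := by
  induction hx using Submodule.pow_induction_on_right' generalizing k with
  | algebraMap r =>
    rw [contractPt_algebraMap, Pi.smul_apply, show α k = 0 from hα, smul_zero]
  | add x y i hx hy h h' => rw [contractPt_add_left, Pi.add_apply, h hα, h' hα, add_zero]
  | mul_mem i x hx h m hm =>
    obtain ⟨v, rfl⟩ := hm
    rw [contractPt_mul, contractPt_ι, contractVec_apply,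
      h (by rwa [show k + 1 + i = k + i.succ by lia])]
    rfl

/-- For a homogeneous form, the degree of a component of the contraction reveals which degree of the
multivector produced it. This is what allows associated fields to be replaced by homogeneous ones.
-/
theorem contractPt_degProj {m : ℤ} {α : Alt V} (hα : ∀ j : ℕ, (j : ℤ) ≠ m → α j = 0) (a : ℤ)
    (x : ExteriorAlgebra ℝ V) (k : ℕ) :
    contractPt (degProj a x) α k = if k + a = m then contractPt x α k else 0 := by
  induction x using exteriorAlgebra_graded_induction with
  | mem i x hx =>
    rw [degProj_of_mem hx]
    by_cases h : (i : ℤ) = a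
    · rw [if_pos h]
      split_ifs with h'
      · rfl
      · exact contractPt_eq_zero_of_mem hx (hα _ (by push_cast; lia))
    · rw [if_neg h, contractPt_zero_left]
      split_ifs with h'
      · exact (contractPt_eq_zero_of_mem hx (hα _ (by push_cast; lia))).symm
      · rfl
  | add x y hx hy =>
    rw [map_add, contractPt_add_left, contractPt_add_left, Pi.add_apply, hx, hy, Pi.add_apply]
    split_ifs <;> simp

/-- Contraction with a multivector of degree `a` lowers the degree by `a`. -/
theorem contractPt_eq_zero_of_degProj_eq {a : ℤ} {x : ExteriorAlgebra ℝ V} (hx : degProj a x = x)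
    {m : ℤ} {α : Alt V} (hα : ∀ j : ℕ, (j : ℤ) ≠ m → α j = 0) (k : ℕ) (hk : (k : ℤ) ≠ m - a) :
    contractPt x α k = 0 := by
  rw [← hx, contractPt_degProj hα, if_neg (by lia)]

end Degree

/-! ### Commuting wedge and contraction; faithfulness of contraction. -/

section Wedge

variable {E : Type*} [NormedAddCommGroup E] [NormedSpace ℝ E]

/-- Left wedge multiplication by a covector. -/
def wedgeCov (φ : E →L[ℝ] ℝ) (α : Alt E) : Alt E
  | 0 => 0
  | k + 1 => ContinuousAlternatingMap.alternatizeUncurryFin (φ.smulRight (α k))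

theorem wedgeCov_add (φ : E →L[ℝ] ℝ) (α β : Alt E) :
    wedgeCov φ (α + β) = wedgeCov φ α + wedgeCov φ β := by
  funext k
  cases k with
  | zero => simp [wedgeCov]
  | succ k =>
    ext v
    simp [wedgeCov, ContinuousAlternatingMap.alternatizeUncurryFin_apply, smul_add,
      Finset.sum_add_distrib]

theorem wedgeCov_smul (φ : E →L[ℝ] ℝ) (c : ℝ) (α : Alt E) :
    wedgeCov φ (c • α) = c • wedgeCov φ α := by
  funext k
  cases k with
  | zero => simp [wedgeCov]
  | succ k =>
    ext v
    simp only [wedgeCov, ContinuousAlternatingMap.alternatizeUncurryFin_apply, Pi.smul_apply,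
      ContinuousLinearMap.smulRight_apply, ContinuousAlternatingMap.smul_apply, smul_eq_mul,
      Finset.mul_sum]
    refine Finset.sum_congr rfl fun i _ => ?_
    rcases neg_one_pow_eq_or ℤ (i : ℕ) with h | h <;> rw [h] <;> simp <;> ring

/-- In the alternating sum for `φ ∧ α`, the term in which `φ` receives `v` is `φ v • α`; in the
others the index is shifted by one, whence the opposite sign. -/
theorem contractVec_wedgeCov (φ : E →L[ℝ] ℝ) (v : E) (α : Alt E) :
    contractVec v (wedgeCov φ α) + wedgeCov φ (contractVec v α) = φ v • α := by
  funext k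
  ext w
  cases k with
  | zero =>
    change ContinuousAlternatingMap.alternatizeUncurryFin (φ.smulRight (α 0)) (Matrix.vecCons v w)
      + 0 = φ v • α 0 w
    rw [ContinuousAlternatingMap.alternatizeUncurryFin_apply]
    have h : Fin.removeNth 0 (Matrix.vecCons v w) = w := Subsingleton.elim _ _
    simp [h]
  | succ k =>
    change ContinuousAlternatingMap.alternatizeUncurryFin (φ.smulRight (α (k + 1)))
      (Matrix.vecCons v w) + ContinuousAlternatingMap.alternatizeUncurryFin
        (φ.smulRight (insertFirst v (α (k + 1)))) w = φ v • α (k + 1) w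
    rw [ContinuousAlternatingMap.alternatizeUncurryFin_apply,
      ContinuousAlternatingMap.alternatizeUncurryFin_apply, Fin.sum_univ_succ]
    have h : ∀ i : Fin (k + 1), Fin.removeNth i.succ (Matrix.vecCons v w)
        = Matrix.vecCons v (Fin.removeNth i w) := by
      intro i
      funext j
      refine Fin.cases ?_ (fun j => ?_) j
      · simp [Fin.removeNth]
      · simp [Fin.removeNth, Fin.succ_succAbove_succ]
    have h0 : Fin.removeNth 0 (Matrix.vecCons v w) = w := by
      funext j; simp [Fin.removeNth]
    simp only [h, h0, ContinuousLinearMap.smulRight_apply, ContinuousAlternatingMap.smul_apply,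
      insertFirst_apply, Fin.val_succ, pow_succ, Matrix.cons_val_zero, Matrix.cons_val_succ]
    simp [add_assoc]

/-- Moving `φ ∧` past the vectors of `X` one at a time costs a sign and leaves a term pairing `φ`
with that vector; these terms add up to the right interior product. -/
theorem wedgeCov_contractPt (φ : E →L[ℝ] ℝ) (X : ExteriorAlgebra ℝ E) (α : Alt E) :
    wedgeCov φ (contractPt X α) = contractPt (CliffordAlgebra.involute X) (wedgeCov φ α)
      + contractPt (CliffordAlgebra.contractRight X (φ : E →ₗ[ℝ] ℝ)) α := by
  induction X using CliffordAlgebra.right_induction with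
  | algebraMap r =>
    rw [AlgHom.commutes, CliffordAlgebra.contractRight_algebraMap, contractPt_zero_left, add_zero]
    refine (congrArg _ (contractPt_algebraMap r α)).trans ?_
    rw [wedgeCov_smul]
    exact (contractPt_algebraMap r _).symm
  | add a b ha hb =>
    rw [contractPt_add_left, wedgeCov_add, ha, hb, map_add, map_add, LinearMap.add_apply,
      contractPt_add_left, contractPt_add_left]
    abel
  | mul_ι v x hx =>
    have hι : ∀ β : Alt E, contractPt (CliffordAlgebra.ι (0 : QuadraticForm ℝ E) v) β
      = contractVec v β := contractPt_ι v
    rw [contractPt_mul, hι, eq_sub_of_add_eq' (contractVec_wedgeCov φ v _), hx, map_mul,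
      CliffordAlgebra.involute_ι, CliffordAlgebra.contractRight_mul_ι, contractPt_sub_left,
      contractPt_smul_left, contractPt_mul, contractPt_mul, contractPt_neg_left, hι, hι, map_add]
    simp only [ContinuousLinearMap.coe_coe]
    abel

variable [FiniteDimensional ℝ E]

/-- Expanded in a basis, `g` is a polynomial in the coordinates of its arguments. -/
theorem continuous_multilinearMap {k : ℕ} (g : MultilinearMap ℝ (fun _ : Fin k => E) ℝ) :
    Continuous g := by
  let b := Module.finBasis ℝ E
  have h : ∀ v : Fin k → E, g v = ∑ r : Fin k → Fin (Module.finrank ℝ E),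
      (∏ i, b.repr (v i) (r i)) • g fun i => b (r i) := by
    intro v
    conv_lhs => rw [show v = fun i => ∑ j, b.repr (v i) j • b j from
      funext fun i => (b.sum_repr (v i)).symm]
    rw [g.map_sum]
    exact Finset.sum_congr rfl fun r _ => g.map_smul_univ _ _
  refine Continuous.congr ?_ fun v => (h v).symm
  refine continuous_finsetSum _ fun r _ => Continuous.mul (continuous_finsetProd _ fun i _ => ?_)
    continuous_const
  exact ((b.coord (r i)).continuous_of_finiteDimensional).comp (continuous_apply i)

/-- Contraction is faithful. -/
theorem eq_of_contractPt_apply_zero_eq {X Y : ExteriorAlgebra ℝ E}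
    (h : ∀ α : Alt E, contractPt X α 0 = contractPt Y α 0) : X = Y := by
  rw [← sub_eq_zero, ← Module.forall_dual_apply_eq_zero_iff ℝ]
  intro ℓ
  -- A functional on the exterior algebra is a family of alternating maps; in finite dimension these
  -- are continuous, so the functional is the pairing with a form.
  obtain ⟨g, rfl⟩ := (ExteriorAlgebra.liftAlternatingEquiv (R := ℝ) (M := E) (N := ℝ)).surjective ℓ
  let α : Alt E := fun k =>
    { g k with cont := continuous_multilinearMap (g k).toMultilinearMap }
  have hα := congrArg (fun β => β 0) (h α)
  simp only [contractPt_apply_zero] at hα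
  rw [map_sub, sub_eq_zero]
  exact hα

end Wedge

/-! ### Calculus on the model space and the Cartan formula. -/

section Model

variable {E : Type*} [NormedAddCommGroup E] [NormedSpace ℝ E]

/-- Insertion of a vector in the first slot as a continuous linear map. -/
def insertFirstCLM (k : ℕ) (v : E) : (E [⋀^Fin (k + 1)]→L[ℝ] ℝ) →L[ℝ] (E [⋀^Fin k]→L[ℝ] ℝ) :=
  (ContinuousLinearMap.apply ℝ (E [⋀^Fin k]→L[ℝ] ℝ) v).comp
    (ContinuousAlternatingMap.curryLeftLI (𝕜 := ℝ) (E := E) (F := ℝ)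
      (n := k)).toContinuousLinearMap

/-- Degreewise differentiability of a field of forms of all degrees. -/
def DiffAltAt (α : E → Alt E) (y : E) : Prop := ∀ k, DifferentiableAt ℝ (fun z => α z k) y

/-- Degreewise smoothness of a field of forms of all degrees. -/
def SmoothAltOn (α : E → Alt E) (U : Set E) : Prop :=
  ∀ k, ContDiffOn ℝ (⊤ : ℕ∞) (fun z => α z k) U

/-- The degreewise directional derivative of a field of forms of all degrees. -/
def diffAlt (α : E → Alt E) (y v : E) : Alt E := fun k => fderiv ℝ (fun z => α z k) y v

/-- The exterior derivative of a field of forms of all degrees on the model space. -/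
def modelD (α : E → Alt E) (y : E) : Alt E
  | 0 => 0
  | k + 1 => extDeriv (fun z => α z k) y

theorem SmoothAltOn.diffAltAt {α : E → Alt E} {U : Set E} (h : SmoothAltOn α U) (hU : IsOpen U)
    {y : E} (hy : y ∈ U) : DiffAltAt α y := fun k =>
  ((h k).differentiableOn (by simp)).differentiableAt (hU.mem_nhds hy)

/-- A constant multivector acts degreewise by continuous linear maps, so it commutes with
derivatives. -/
theorem contractPt_diff (X : ExteriorAlgebra ℝ E) {α : E → Alt E} {y : E} (hα : DiffAltAt α y) :
    DiffAltAt (fun z => contractPt X (α z)) y ∧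
      ∀ v, diffAlt (fun z => contractPt X (α z)) y v = contractPt X (diffAlt α y v) := by
  induction X using ExteriorAlgebra.induction generalizing α with
  | algebraMap r =>
    simp only [contractPt_algebraMap]
    refine ⟨fun k => (hα k).const_smul r, fun v => ?_⟩
    funext k
    change fderiv ℝ (fun z => r • α z k) y v = r • fderiv ℝ (fun z => α z k) y v
    rw [fderiv_fun_const_smul (hα k)]; rfl
  | ι w =>
    simp only [contractPt_ι]
    have h : ∀ k, HasFDerivAt (fun z => contractVec w (α z) k)
        ((insertFirstCLM k w).comp (fderiv ℝ (fun z => α z (k + 1)) y)) y := fun k =>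
      (insertFirstCLM k w).hasFDerivAt.comp y (hα (k + 1)).hasFDerivAt
    refine ⟨fun k => (h k).differentiableAt, fun v => ?_⟩
    funext k
    change fderiv ℝ (fun z => contractVec w (α z) k) y v = _
    rw [(h k).fderiv]; rfl
  | mul a b ha hb =>
    simp only [contractPt_mul]
    exact ⟨(hb (ha hα).1).1, fun v => by rw [(hb (ha hα).1).2, (ha hα).2]⟩
  | add a b ha hb =>
    simp only [contractPt_add_left]
    refine ⟨fun k => ((ha hα).1 k).add ((hb hα).1 k), fun v => ?_⟩
    rw [← (ha hα).2, ← (hb hα).2]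
    funext k
    change fderiv ℝ (fun z => contractPt a (α z) k + contractPt b (α z) k) y v = _
    rw [fderiv_fun_add ((ha hα).1 k) ((hb hα).1 k)]; rfl

theorem SmoothAltOn.contractPt_const (X : ExteriorAlgebra ℝ E) {α : E → Alt E} {U : Set E}
    (hα : SmoothAltOn α U) : SmoothAltOn (fun z => contractPt X (α z)) U := by
  induction X using ExteriorAlgebra.induction generalizing α with
  | algebraMap r =>
    simp only [contractPt_algebraMap]
    exact fun k => (hα k).const_smul r
  | ι w =>
    simp only [contractPt_ι]
    exact fun k => (insertFirstCLM k w).contDiff.comp_contDiffOn (hα (k + 1))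
  | mul a b ha hb =>
    simp only [contractPt_mul]
    exact hb (ha hα)
  | add a b ha hb =>
    simp only [contractPt_add_left]
    exact fun k => (ha hα k).add (hb hα k)

variable [FiniteDimensional ℝ E]

/-- Differentiability of the coefficients of a multivector field on the model space. -/
def DiffMVAt (Z : E → ExteriorAlgebra ℝ E) (y : E) : Prop :=
  ∀ S, DifferentiableAt ℝ (fun z => (extBasis E).repr (Z z) S) y

/-- Smoothness of the coefficients of a multivector field on the model space. -/
def SmoothMVOn (Z : E → ExteriorAlgebra ℝ E) (U : Set E) : Prop :=
  ∀ S, ContDiffOn ℝ (⊤ : ℕ∞) (fun z => (extBasis E).repr (Z z) S) U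

theorem SmoothMVOn.diffMVAt {Z : E → ExteriorAlgebra ℝ E} {U : Set E} (h : SmoothMVOn Z U)
    (hU : IsOpen U) {y : E} (hy : y ∈ U) : DiffMVAt Z y := fun S =>
  ((h S).differentiableOn (by simp)).differentiableAt (hU.mem_nhds hy)

theorem linearMap_apply_eq_sum {F : Type*} [AddCommGroup F] [Module ℝ F]
    (T : ExteriorAlgebra ℝ E →ₗ[ℝ] F) (x : ExteriorAlgebra ℝ E) :
    T x = ∑ S, (extBasis E).repr x S • T (extBasis E S) := by
  conv_lhs => rw [← (extBasis E).sum_repr x]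
  simp only [map_sum, map_smul]

theorem SmoothMVOn.functional {Z : E → ExteriorAlgebra ℝ E} {U : Set E} (h : SmoothMVOn Z U)
    (ℓ : ExteriorAlgebra ℝ E →ₗ[ℝ] ℝ) : ContDiffOn ℝ (⊤ : ℕ∞) (fun z => ℓ (Z z)) U := by
  rw [funext fun z => linearMap_apply_eq_sum ℓ (Z z)]
  exact ContDiffOn.sum fun S _ => (h S).smul contDiffOn_const

theorem SmoothMVOn.linearMap {Z : E → ExteriorAlgebra ℝ E} {U : Set E} (h : SmoothMVOn Z U)
    (T : ExteriorAlgebra ℝ E →ₗ[ℝ] ExteriorAlgebra ℝ E) : SmoothMVOn (fun z => T (Z z)) U :=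
  fun S => h.functional ((extBasis E).coord S ∘ₗ T)

theorem SmoothMVOn.mul {Z W : E → ExteriorAlgebra ℝ E} {U : Set E} (hZ : SmoothMVOn Z U)
    (hW : SmoothMVOn W U) : SmoothMVOn (fun z => Z z * W z) U := by
  intro S
  have h : ∀ z, (extBasis E).repr (Z z * W z) S = ∑ T, (extBasis E).repr (Z z) T
      * ((extBasis E).coord S ∘ₗ LinearMap.mulLeft ℝ (extBasis E T)) (W z) := fun z => by
    have := linearMap_apply_eq_sum ((extBasis E).coord S ∘ₗ LinearMap.mulRight ℝ (W z)) (Z z)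
    simpa using this
  simp only [h]
  exact ContDiffOn.sum fun T _ => (hZ T).mul (hW.functional _)

theorem SmoothMVOn.sub {Z W : E → ExteriorAlgebra ℝ E} {U : Set E} (hZ : SmoothMVOn Z U)
    (hW : SmoothMVOn W U) : SmoothMVOn (fun z => Z z - W z) U := by
  intro S
  simpa using (hZ S).sub (hW S)

theorem SmoothMVOn.sum {ι : Type*} (s : Finset ι) {Z : ι → E → ExteriorAlgebra ℝ E} {U : Set E}
    (hZ : ∀ i, SmoothMVOn (Z i) U) : SmoothMVOn (fun z => ∑ i ∈ s, Z i z) U := by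
  intro S
  simpa using ContDiffOn.sum fun i (_ : i ∈ s) => hZ i S

theorem repr_partialMV (Z : E → ExteriorAlgebra ℝ E) (y : E) (i : Fin (Module.finrank ℝ E))
    (S : Finset (Fin (Module.finrank ℝ E))) :
    (extBasis E).repr (partialMV Z y i) S
      = fderiv ℝ (fun z => (extBasis E).repr (Z z) S) y (Module.finBasis ℝ E i) := by
  rw [partialMV, (extBasis E).repr_sum_self]

theorem SmoothMVOn.partialMV {Z : E → ExteriorAlgebra ℝ E} {U : Set E} (h : SmoothMVOn Z U)
    (hU : IsOpen U) (i : Fin (Module.finrank ℝ E)) : SmoothMVOn (fun z => partialMV Z z i) U := by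
  intro S
  simp only [repr_partialMV]
  exact ((h S).fderiv_of_isOpen hU (by simp)).clm_apply contDiffOn_const

theorem SmoothMVOn.schoutenModel {Z W : E → ExteriorAlgebra ℝ E} {U : Set E} (hU : IsOpen U)
    (hZ : SmoothMVOn Z U) (hW : SmoothMVOn W U) : SmoothMVOn (schoutenModel Z W) U := by
  refine SmoothMVOn.sum _ fun i => SmoothMVOn.sub ?_ ?_
  · exact (hZ.linearMap (CliffordAlgebra.contractRight.flip
      ((Module.finBasis ℝ E).coord i))).mul (hW.partialMV hU i)
  · exact (hZ.partialMV hU i).mul (hW.linearMap (CliffordAlgebra.contractLeft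
      ((Module.finBasis ℝ E).coord i)))

/-- Although `partialMV` is defined in a fixed basis, it commutes with every constant linear map.
Applied to the grade involution this shows that partial derivatives preserve parity. -/
theorem partialMV_linearMap {Z : E → ExteriorAlgebra ℝ E} {y : E} (h : DiffMVAt Z y)
    (T : ExteriorAlgebra ℝ E →ₗ[ℝ] ExteriorAlgebra ℝ E) (i : Fin (Module.finrank ℝ E)) :
    partialMV (fun z => T (Z z)) y i = T (partialMV Z y i) := by
  apply (extBasis E).repr.injective
  ext S
  rw [repr_partialMV]
  have h1 : ∀ x, (extBasis E).repr (T x) S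
      = ∑ R, (extBasis E).repr x R * (extBasis E).repr (T (extBasis E R)) S := fun x => by
    have := linearMap_apply_eq_sum ((extBasis E).coord S ∘ₗ T) x
    simpa using this
  rw [funext fun z => h1 (Z z), h1]
  simp only [repr_partialMV]
  rw [fderiv_fun_sum fun R _ => (h R).mul_const _]
  simp only [FunLike.coe_sum, Finset.sum_apply]
  refine Finset.sum_congr rfl fun R _ => ?_
  rw [fderiv_mul_const (h R)]
  simp [mul_comm]

theorem partialMV_add {Z W : E → ExteriorAlgebra ℝ E} {y : E} (hZ : DiffMVAt Z y)
    (hW : DiffMVAt W y) (i : Fin (Module.finrank ℝ E)) :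
    partialMV (fun z => Z z + W z) y i = partialMV Z y i + partialMV W y i := by
  apply (extBasis E).repr.injective
  ext S
  rw [map_add, Finsupp.add_apply, repr_partialMV, repr_partialMV, repr_partialMV]
  simp only [map_add, Finsupp.add_apply]
  rw [fderiv_fun_add (hZ S) (hW S)]; rfl

theorem contractPt_eq_sum (X : ExteriorAlgebra ℝ E) (α : Alt E) :
    contractPt X α = ∑ S, (extBasis E).repr X S • contractPt (extBasis E S) α :=
  linearMap_apply_eq_sum (contractLin α) X

theorem SmoothAltOn.contractPt {Z : E → ExteriorAlgebra ℝ E} {α : E → Alt E} {U : Set E}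
    (hZ : SmoothMVOn Z U) (hα : SmoothAltOn α U) :
    SmoothAltOn (fun z => contractPt (Z z) (α z)) U := by
  intro k
  simp only [contractPt_eq_sum (Z _), Finset.sum_apply, Pi.smul_apply]
  exact ContDiffOn.sum fun S _ => (hZ S).smul (hα.contractPt_const _ k)

/-- The Leibniz rule for the contraction. -/
theorem contractPt_leibniz {Z : E → ExteriorAlgebra ℝ E} {α : E → Alt E} {y : E}
    (hZ : DiffMVAt Z y) (hα : DiffAltAt α y) :
    DiffAltAt (fun z => contractPt (Z z) (α z)) y ∧
      ∀ i, diffAlt (fun z => contractPt (Z z) (α z)) y (Module.finBasis ℝ E i)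
        = contractPt (partialMV Z y i) (α y)
          + contractPt (Z y) (diffAlt α y (Module.finBasis ℝ E i)) := by
  have hd : ∀ S k, DifferentiableAt ℝ
      (fun z => (extBasis E).repr (Z z) S • contractPt (extBasis E S) (α z) k) y := fun S k =>
    (hZ S).smul ((contractPt_diff (extBasis E S) hα).1 k)
  have he : ∀ k, (fun z => contractPt (Z z) (α z) k)
      = fun z => ∑ S, (extBasis E).repr (Z z) S • contractPt (extBasis E S) (α z) k := fun k => by
    funext z
    rw [contractPt_eq_sum (Z z), Finset.sum_apply]; rfl
  refine ⟨fun k => ?_, fun i => ?_⟩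
  · rw [he k]
    exact DifferentiableAt.fun_sum fun S _ => hd S k
  · funext k
    rw [contractPt_eq_sum (partialMV Z y i), contractPt_eq_sum (Z y)]
    unfold diffAlt
    rw [he k, fderiv_fun_sum fun S _ => hd S k]
    simp only [FunLike.coe_sum, Finset.sum_apply, Pi.add_apply, Pi.smul_apply,
      ← Finset.sum_add_distrib, repr_partialMV]
    refine Finset.sum_congr rfl fun S _ => ?_
    rw [fderiv_fun_smul (hZ S) ((contractPt_diff (extBasis E S) hα).1 k)]
    have := congrFun ((contractPt_diff (extBasis E S) hα).2 (Module.finBasis ℝ E i)) k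
    unfold diffAlt at this
    simp only [add_apply, smul_apply,
      ContinuousLinearMap.smulRight_apply, this]
    rw [add_comm]

/-- The coordinate functions of the chosen basis of the model space. -/
def coordForm (i : Fin (Module.finrank ℝ E)) : E →L[ℝ] ℝ :=
  LinearMap.toContinuousLinearMap ((Module.finBasis ℝ E).coord i)

/-- This is `d = ∑ dxⁱ ∧ ∂ᵢ`, the form in which `d` can be commuted with contractions term by term.
-/
theorem modelD_eq_sum (α : E → Alt E) (y : E) :
    modelD α y = ∑ i, wedgeCov (coordForm i) (diffAlt α y (Module.finBasis ℝ E i)) := by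
  funext k
  rw [Finset.sum_apply]
  cases k with
  | zero => simp [modelD, wedgeCov]
  | succ k =>
    have h : fderiv ℝ (fun z => α z k) y = ∑ i, (coordForm i).smulRight
        (fderiv ℝ (fun z => α z k) y (Module.finBasis ℝ E i)) := by
      ext1 v
      conv_lhs => rw [← (Module.finBasis ℝ E).sum_repr v, map_sum]
      simp only [FunLike.coe_sum, Finset.sum_apply, map_smul]
      rfl
    simp only [modelD, wedgeCov, extDeriv]
    conv_lhs => rw [h]
    simp only [← ContinuousAlternatingMap.alternatizeUncurryFinCLM_apply, map_sum]
    rfl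

/-- The Lie derivative along a multivector field on the model space. -/
def modelLie (Z : E → ExteriorAlgebra ℝ E) (α : E → Alt E) (y : E) : Alt E :=
  modelD (fun z => contractPt (Z z) (α z)) y
    - contractPt (CliffordAlgebra.involute (Z y)) (modelD α y)

/-- By the Leibniz rule `∂ᵢ` falls on `Z` or on `α`. In the second case, moving `dxⁱ ∧` past `i_Z`
gives a term that cancels against the `dα` term of the Lie derivative, and the interior product
remains. -/
theorem modelLie_eq_sum {Z : E → ExteriorAlgebra ℝ E} {α : E → Alt E} {y : E}
    (hZ : DiffMVAt Z y) (hα : DiffAltAt α y) :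
    modelLie Z α y = ∑ i, (wedgeCov (coordForm i) (contractPt (partialMV Z y i) (α y))
      + contractPt (CliffordAlgebra.contractRight (Z y) ((Module.finBasis ℝ E).coord i))
        (diffAlt α y (Module.finBasis ℝ E i))) := by
  rw [modelLie, modelD_eq_sum, modelD_eq_sum, contractPt_sum, ← Finset.sum_sub_distrib]
  refine Finset.sum_congr rfl fun i _ => ?_
  rw [(contractPt_leibniz hZ hα).2 i, wedgeCov_add, wedgeCov_contractPt (coordForm i) (Z y)]
  have : ((coordForm i : E →L[ℝ] ℝ) : E →ₗ[ℝ] ℝ) = (Module.finBasis ℝ E).coord i := rfl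
  rw [this]
  abel

/-- The Cartan formula `i_{[Z, W]} = (-1)^((r-1)s) L_Z i_W - i_W L_Z` on the model space. -/
theorem contractPt_schoutenModel {Z W : E → ExteriorAlgebra ℝ E} {α : E → Alt E} {y : E} {r s : ℤ}
    (hZ : DiffMVAt Z y) (hW : DiffMVAt W y) (hα : DiffAltAt α y)
    (hr : ∀ z, CliffordAlgebra.involute (Z z) = sgn r • Z z)
    (hs : ∀ z, CliffordAlgebra.involute (W z) = sgn s • W z) :
    contractPt (schoutenModel Z W y) (α y)
      = sgn ((r - 1) * s) • modelLie Z (fun z => contractPt (W z) (α z)) y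
        - contractPt (W y) (modelLie Z α y) := by
  have par : ∀ {Y : E → ExteriorAlgebra ℝ E} {t : ℤ}, DiffMVAt Y y →
      (∀ z, CliffordAlgebra.involute (Y z) = sgn t • Y z) → ∀ i,
      CliffordAlgebra.involute (partialMV Y y i) = sgn t • partialMV Y y i := by
    intro Y t hY ht i
    refine (partialMV_linearMap hY CliffordAlgebra.involute.toLinearMap i).symm.trans ?_
    refine Eq.trans ?_ (partialMV_linearMap hY (sgn t • LinearMap.id) i)
    congr 1
    funext z
    exact ht z
  have parR : ∀ i, CliffordAlgebra.involute (CliffordAlgebra.contractRight (Z y)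
      ((Module.finBasis ℝ E).coord i)) = sgn (r - 1) • CliffordAlgebra.contractRight (Z y)
      ((Module.finBasis ℝ E).coord i) := fun i => by
    rw [involute_contractRight, hr, map_smul, LinearMap.smul_apply, sgn_sub, sgn_one, mul_neg_one,
      neg_smul]
  rw [modelLie_eq_sum hZ (contractPt_leibniz hW hα).1, modelLie_eq_sum hZ hα, contractPt_sum,
    schoutenModel, contractPt_sum_left, Finset.smul_sum, ← Finset.sum_sub_distrib]
  refine Finset.sum_congr rfl fun i _ => ?_
  rw [(contractPt_leibniz hW hα).2 i, contractPt_sub_left, contractPt_mul, contractPt_mul,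
    contractLeft_eq_involute_contractRight, involute_contractRight, hs, map_smul,
    LinearMap.smul_apply, contractPt_neg_left, contractPt_smul_left]
  -- Moving `i_W` outermost makes the terms with `∂ᵢα` cancel. Moving `dxⁱ ∧` past `i_W` then
  -- cancels `i_W (dxⁱ ∧ i_(∂ᵢZ) α)` and leaves the contraction along `W ⌊ dxⁱ`, that is, the second
  -- half of the bracket.
  rw [contractPt_contractPt_comm (par hZ hr i) (hs y), wedgeCov_smul, wedgeCov_contractPt,
    contractPt_add, contractPt_add, contractPt_contractPt_comm (parR i) (par hW hs i),
    contractPt_contractPt_comm (parR i) (hs y), hs, contractPt_smul_left]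
  have e1 : sgn ((r - 1) * s) = sgn (r * s) * sgn s := by
    rw [sub_mul, one_mul, sgn_sub]
  have e2 := sgn_mul_self (r * s)
  have e3 := sgn_mul_self s
  have : ((coordForm i : E →L[ℝ] ℝ) : E →ₗ[ℝ] ℝ) = (Module.finBasis ℝ E).coord i := rfl
  rw [this, e1]
  rcases mul_self_eq_one_iff.1 e2 with h2 | h2 <;> rcases mul_self_eq_one_iff.1 e3 with h3 | h3 <;>
    rw [h2, h3] <;> module

end Model

/-! ### Coordinate independence of the Schouten bracket. -/

section Naturality

open scoped Topology

variable {E : Type*} [NormedAddCommGroup E] [NormedSpace ℝ E]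

theorem two_le_smooth : (1 + 1 : WithTop ℕ∞) ≤ ((⊤ : ℕ∞) : WithTop ℕ∞) :=
  WithTop.coe_le_coe.2 (le_top : (1 + 1 : ℕ∞) ≤ ⊤)

theorem modelD_congr {α β : E → Alt E} {y : E} (h : α =ᶠ[𝓝 y] β) : modelD α y = modelD β y := by
  funext k
  cases k with
  | zero => rfl
  | succ k => exact Filter.EventuallyEq.extDeriv_eq (h.mono fun z hz => congrFun hz k)

theorem DiffAltAt.pullAlt {τ : E → E} {α : E → Alt E} {y : E} (hα : DiffAltAt α (τ y))
    (hτ : ContDiffAt ℝ (⊤ : ℕ∞) τ y) :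
    DiffAltAt (fun z => pullAlt (fderiv ℝ τ z) (α (τ z))) y := fun k =>
  DifferentiableAt.continuousAlternatingMapCompContinuousLinearMap
    ((hα k).comp y (hτ.differentiableAt (by simp)))
    ((hτ.fderiv_right (m := 1) two_le_smooth).differentiableAt (by simp))

theorem modelD_pullAlt {τ : E → E} {α : E → Alt E} {y : E} (hα : DiffAltAt α (τ y))
    (hτ : ContDiffAt ℝ (⊤ : ℕ∞) τ y) :
    modelD (fun z => pullAlt (fderiv ℝ τ z) (α (τ z))) y
      = pullAlt (fderiv ℝ τ y) (modelD α (τ y)) := by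
  funext k
  cases k with
  | zero => rfl
  | succ k => exact extDeriv_pullback (hα k) hτ (by simpa [one_add_one_eq_two] using two_le_smooth)

variable [FiniteDimensional ℝ E]

theorem modelLie_congr (Z : E → ExteriorAlgebra ℝ E) {α β : E → Alt E} {y : E}
    (h : α =ᶠ[𝓝 y] β) : modelLie Z α y = modelLie Z β y := by
  unfold modelLie
  rw [modelD_congr h, modelD_congr (h.mono fun z hz =>
    show contractPt (Z z) (α z) = contractPt (Z z) (β z) by rw [hz])]

/-- Both ingredients of the Lie derivative commute with pullback when the fields are `τ`-related;
relatedness is needed near `y` because `d` differentiates the contraction. -/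
theorem modelLie_pullAlt {τ : E → E} {Z Z' : E → ExteriorAlgebra ℝ E} {α : E → Alt E} {y : E}
    (hτ : ContDiffAt ℝ (⊤ : ℕ∞) τ y) (hα : DiffAltAt α (τ y)) (hZ' : DiffMVAt Z' (τ y))
    (h : ∀ᶠ z in 𝓝 y, Z' (τ z) = ExteriorAlgebra.map (fderiv ℝ τ z).toLinearMap (Z z)) :
    modelLie Z (fun z => pullAlt (fderiv ℝ τ z) (α (τ z))) y
      = pullAlt (fderiv ℝ τ y) (modelLie Z' α (τ y)) := by
  unfold modelLie
  rw [modelD_pullAlt hα hτ, contractPt_pullAlt, map_involute, ← h.self_of_nhds, pullAlt_sub,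
    ← modelD_pullAlt (contractPt_leibniz hZ' hα).1 hτ]
  congr 1
  exact modelD_congr (h.mono fun z hz => by simp only [hz, contractPt_pullAlt])

/-- The right side of the Cartan formula is natural, so the left side is, and faithfulness of
contraction removes the test form. Constant test forms `β`, pulled back along `τ`, suffice. -/
theorem schoutenModel_natural_of_parity {τ : E → E} {Z W Z' W' : E → ExteriorAlgebra ℝ E} {y : E}
    {r s : ℤ} (hτ : ContDiffAt ℝ (⊤ : ℕ∞) τ y)
    (hZ : DiffMVAt Z y) (hW : DiffMVAt W y) (hZ' : DiffMVAt Z' (τ y)) (hW' : DiffMVAt W' (τ y))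
    (hZr : ∀ z, CliffordAlgebra.involute (Z z) = sgn r • Z z)
    (hWs : ∀ z, CliffordAlgebra.involute (W z) = sgn s • W z)
    (hZr' : ∀ z, CliffordAlgebra.involute (Z' z) = sgn r • Z' z)
    (hWs' : ∀ z, CliffordAlgebra.involute (W' z) = sgn s • W' z)
    (hZZ' : ∀ᶠ z in 𝓝 y, Z' (τ z) = ExteriorAlgebra.map (fderiv ℝ τ z).toLinearMap (Z z))
    (hWW' : ∀ᶠ z in 𝓝 y, W' (τ z) = ExteriorAlgebra.map (fderiv ℝ τ z).toLinearMap (W z)) :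
    schoutenModel Z' W' (τ y)
      = ExteriorAlgebra.map (fderiv ℝ τ y).toLinearMap (schoutenModel Z W y) := by
  refine eq_of_contractPt_apply_zero_eq fun β => ?_
  have hβ : DiffAltAt (fun _ : E => β) (τ y) := fun k => differentiableAt_const _
  have h1 := contractPt_schoutenModel hZ hW (hβ.pullAlt hτ) hZr hWs
  have h2 := contractPt_schoutenModel hZ' hW' hβ hZr' hWs'
  rw [modelLie_pullAlt hτ hβ hZ' hZZ', contractPt_pullAlt, contractPt_pullAlt,
    ← hWW'.self_of_nhds, modelLie_congr Z (hWW'.mono fun z hz =>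
      show contractPt (W z) (pullAlt (fderiv ℝ τ z) β) = pullAlt (fderiv ℝ τ z)
        ((fun w => contractPt (W' w) β) (τ z)) by
        rw [contractPt_pullAlt]; simp only [hz]),
    modelLie_pullAlt hτ (contractPt_leibniz hW' hβ).1 hZ' hZZ', ← pullAlt_smul, ← pullAlt_sub,
    ← h2] at h1
  ext w
  have h3 := congrArg (fun γ : Alt E => γ 0 w) h1
  change (contractPt (ExteriorAlgebra.map _ _) β 0) (fderiv ℝ τ y ∘ w)
    = (contractPt (schoutenModel Z' W' (τ y)) β 0) (fderiv ℝ τ y ∘ w) at h3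
  -- Pullback does nothing to forms of degree `0`, so `τ` need not be a local diffeomorphism here.
  rw [Subsingleton.elim (fderiv ℝ τ y ∘ w) w] at h3
  exact h3.symm

/-- The projection onto the even (`t` even) or odd (`t` odd) part of the exterior algebra. -/
def parityPart (t : ℤ) : ExteriorAlgebra ℝ E →ₗ[ℝ] ExteriorAlgebra ℝ E :=
  (1 / 2 : ℝ) • (LinearMap.id + sgn t • CliffordAlgebra.involute.toLinearMap)

theorem involute_parityPart (t : ℤ) (x : ExteriorAlgebra ℝ E) :
    CliffordAlgebra.involute (parityPart t x) = sgn t • parityPart t x := by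
  simp only [parityPart, LinearMap.smul_apply, LinearMap.add_apply, LinearMap.id_apply,
    AlgHom.toLinearMap_apply, map_smul, map_add, CliffordAlgebra.involute_involute]
  rcases mul_self_eq_one_iff.1 (sgn_mul_self t) with h | h <;> rw [h] <;> module

theorem parityPart_add_parityPart (x : ExteriorAlgebra ℝ E) :
    parityPart 0 x + parityPart 1 x = x := by
  simp only [parityPart, LinearMap.smul_apply, LinearMap.add_apply, LinearMap.id_apply,
    AlgHom.toLinearMap_apply, sgn_zero, sgn_one]
  module

theorem map_parityPart (A : E →ₗ[ℝ] E) (t : ℤ) (x : ExteriorAlgebra ℝ E) :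
    ExteriorAlgebra.map A (parityPart t x) = parityPart t (ExteriorAlgebra.map A x) := by
  simp only [parityPart, LinearMap.smul_apply, LinearMap.add_apply, LinearMap.id_apply,
    AlgHom.toLinearMap_apply, map_smul, map_add, map_involute]

theorem DiffMVAt.linearMap {Z : E → ExteriorAlgebra ℝ E} {y : E} (h : DiffMVAt Z y)
    (T : ExteriorAlgebra ℝ E →ₗ[ℝ] ExteriorAlgebra ℝ E) : DiffMVAt (fun z => T (Z z)) y := by
  intro S
  have h1 : ∀ z, (extBasis E).repr (T (Z z)) S
      = ∑ R, (extBasis E).repr (Z z) R • ((extBasis E).coord S ∘ₗ T) (extBasis E R) := fun z =>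
    linearMap_apply_eq_sum ((extBasis E).coord S ∘ₗ T) (Z z)
  rw [funext h1]
  exact DifferentiableAt.fun_sum fun R _ => (h R).smul_const _

theorem schoutenModel_add_left {Z Z' : E → ExteriorAlgebra ℝ E} {y : E} (hZ : DiffMVAt Z y)
    (hZ' : DiffMVAt Z' y) (W : E → ExteriorAlgebra ℝ E) :
    schoutenModel (fun z => Z z + Z' z) W y = schoutenModel Z W y + schoutenModel Z' W y := by
  simp only [schoutenModel, partialMV_add hZ hZ', map_add, LinearMap.add_apply, add_mul,
    ← Finset.sum_add_distrib]
  refine Finset.sum_congr rfl fun i _ => ?_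
  abel

theorem schoutenModel_add_right {W W' : E → ExteriorAlgebra ℝ E} {y : E} (hW : DiffMVAt W y)
    (hW' : DiffMVAt W' y) (Z : E → ExteriorAlgebra ℝ E) :
    schoutenModel Z (fun z => W z + W' z) y = schoutenModel Z W y + schoutenModel Z W' y := by
  simp only [schoutenModel, partialMV_add hW hW', map_add, mul_add,
    ← Finset.sum_add_distrib]
  refine Finset.sum_congr rfl fun i _ => ?_
  abel

theorem partialMV_smul {Z : E → ExteriorAlgebra ℝ E} {y : E} (hZ : DiffMVAt Z y) (c : ℝ)
    (i : Fin (Module.finrank ℝ E)) :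
    partialMV (fun z => c • Z z) y i = c • partialMV Z y i := by
  apply (extBasis E).repr.injective
  ext S
  rw [map_smul, Finsupp.smul_apply, repr_partialMV, repr_partialMV]
  simp only [map_smul, Finsupp.smul_apply]
  rw [fderiv_fun_const_smul (hZ S)]; rfl

theorem schoutenModel_smul_left {Z : E → ExteriorAlgebra ℝ E} {y : E} (hZ : DiffMVAt Z y) (c : ℝ)
    (W : E → ExteriorAlgebra ℝ E) :
    schoutenModel (fun z => c • Z z) W y = c • schoutenModel Z W y := by
  simp only [schoutenModel, partialMV_smul hZ, map_smul, LinearMap.smul_apply, smul_mul_assoc,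
    ← smul_sub, ← Finset.smul_sum]

/-- The Cartan formula needs arguments of definite parity; bilinearity reduces general fields to
that case. -/
theorem schoutenModel_eq_sum_parityPart {Z W : E → ExteriorAlgebra ℝ E} {y : E}
    (hZ : DiffMVAt Z y) (hW : DiffMVAt W y) :
    schoutenModel Z W y =
      (schoutenModel (fun z => parityPart 0 (Z z)) (fun z => parityPart 0 (W z)) y
        + schoutenModel (fun z => parityPart 0 (Z z)) (fun z => parityPart 1 (W z)) y)
      + (schoutenModel (fun z => parityPart 1 (Z z)) (fun z => parityPart 0 (W z)) y
        + schoutenModel (fun z => parityPart 1 (Z z)) (fun z => parityPart 1 (W z)) y) := by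
  rw [← schoutenModel_add_right (hW.linearMap _) (hW.linearMap _),
    ← schoutenModel_add_right (hW.linearMap _) (hW.linearMap _),
    ← schoutenModel_add_left (hZ.linearMap _) (hZ.linearMap _)]
  simp only [parityPart_add_parityPart]

/-- The Schouten bracket on the model space is natural under changes of coordinates. -/
theorem schoutenModel_natural {τ : E → E} {Z W Z' W' : E → ExteriorAlgebra ℝ E} {y : E}
    (hτ : ContDiffAt ℝ (⊤ : ℕ∞) τ y)
    (hZ : DiffMVAt Z y) (hW : DiffMVAt W y) (hZ' : DiffMVAt Z' (τ y)) (hW' : DiffMVAt W' (τ y))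
    (hZZ' : ∀ᶠ z in 𝓝 y, Z' (τ z) = ExteriorAlgebra.map (fderiv ℝ τ z).toLinearMap (Z z))
    (hWW' : ∀ᶠ z in 𝓝 y, W' (τ z) = ExteriorAlgebra.map (fderiv ℝ τ z).toLinearMap (W z)) :
    schoutenModel Z' W' (τ y)
      = ExteriorAlgebra.map (fderiv ℝ τ y).toLinearMap (schoutenModel Z W y) := by
  have key : ∀ s t : ℤ, schoutenModel (fun z => parityPart s (Z' z)) (fun z => parityPart t (W' z))
      (τ y) = ExteriorAlgebra.map (fderiv ℝ τ y).toLinearMap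
        (schoutenModel (fun z => parityPart s (Z z)) (fun z => parityPart t (W z)) y) := fun s t =>
    schoutenModel_natural_of_parity (r := s) (s := t) hτ (hZ.linearMap _) (hW.linearMap _)
      (hZ'.linearMap _) (hW'.linearMap _) (fun z => involute_parityPart s _)
      (fun z => involute_parityPart t _) (fun z => involute_parityPart s _)
      (fun z => involute_parityPart t _) (hZZ'.mono fun z hz => by rw [hz, map_parityPart])
      (hWW'.mono fun z hz => by rw [hz, map_parityPart])
  rw [schoutenModel_eq_sum_parityPart hZ' hW', schoutenModel_eq_sum_parityPart hZ hW, key, key, key,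
    key]
  simp only [map_add]

end Naturality

/-! ### Transfer of the calculus to the manifold. -/

section Charts

open scoped Topology

variable {E : Type*} [NormedAddCommGroup E] [NormedSpace ℝ E]
  {M : Type*} [TopologicalSpace M] [ChartedSpace E M]

/-- A form of all degrees in the chart around `x₀`. -/
def formAlt (x₀ : M) (α : FormField E M) (y : E) : Alt E := fun k => formInChart x₀ α k y

theorem formAlt_eq_pullAlt (x₀ : M) (α : FormField E M) (y : E) :
    formAlt x₀ α y = pullAlt (chartSymmDeriv x₀ y) (α ((chartAt E x₀).symm y)) := rfl

theorem formAlt_smul (x₀ : M) (c : ℝ) (α : FormField E M) (y : E) :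
    formAlt x₀ (c • α) y = c • formAlt x₀ α y := rfl

theorem formAlt_sub (x₀ : M) (α β : FormField E M) (y : E) :
    formAlt x₀ (α - β) y = formAlt x₀ α y - formAlt x₀ β y := rfl

theorem SmoothForm.diffAltAt {α : FormField E M} (hα : SmoothForm α) (x₀ : M) {y : E}
    (hy : y ∈ (chartAt E x₀).target) : DiffAltAt (formAlt x₀ α) y :=
  SmoothAltOn.diffAltAt (hα x₀) (chartAt E x₀).open_target hy

theorem extD_apply (α : FormField E M) (x : M) :
    extD α x = pullAlt (chartDeriv x x) (modelD (formAlt x α) (chartAt E x x)) := by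
  funext k
  cases k <;> rfl

variable [IsManifold 𝓘(ℝ, E) (⊤ : ℕ∞) M]

theorem chartDeriv_comp_chartSymmDeriv (x₀ : M) {y : E} (hy : y ∈ (chartAt E x₀).target) :
    (chartDeriv x₀ ((chartAt E x₀).symm y)).comp (chartSymmDeriv x₀ y)
      = ContinuousLinearMap.id ℝ E :=
  (mdifferentiable_chart (I := 𝓘(ℝ, E)) x₀).comp_symm_deriv hy

/-- The change of coordinates between the charts around `x₀` and `q`. -/
def transition (x₀ q : M) (z : E) : E := chartAt E q ((chartAt E x₀).symm z)

/-- The domain of the change of coordinates. -/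
def transitionSource (x₀ q : M) : Set E :=
  (chartAt E x₀).target ∩ (chartAt E x₀).symm ⁻¹' (chartAt E q).source

theorem isOpen_transitionSource (x₀ q : M) : IsOpen (transitionSource (E := E) x₀ q) :=
  (chartAt E x₀).isOpen_inter_preimage_symm (chartAt E q).open_source

theorem transition_mem_target {x₀ q : M} {y : E} (hy : y ∈ transitionSource x₀ q) :
    transition x₀ q y ∈ (chartAt E q).target := (chartAt E q).map_source hy.2

theorem contDiffAt_transition {x₀ q : M} {y : E} (hy : y ∈ transitionSource x₀ q) :
    ContDiffAt ℝ (⊤ : ℕ∞) (transition (E := E) x₀ q) y := by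
  have h := contDiffWithinAt_ext_coord_change (I := 𝓘(ℝ, E)) (n := (⊤ : ℕ∞)) q x₀ (y := y)
    (by simpa [transitionSource] using hy)
  simp only [mfld_simps, contDiffWithinAt_univ] at h
  exact h

theorem fderiv_transition {x₀ q : M} {y : E} (hy : y ∈ transitionSource x₀ q) :
    fderiv ℝ (transition x₀ q) y
      = (chartDeriv q ((chartAt E x₀).symm y)).comp (chartSymmDeriv x₀ y) := by
  rw [← mfderiv_eq_fderiv]
  exact mfderiv_comp y ((mdifferentiable_chart (I := 𝓘(ℝ, E)) q).mdifferentiableAt hy.2)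
    ((mdifferentiable_chart (I := 𝓘(ℝ, E)) x₀).mdifferentiableAt_symm hy.1)

variable [FiniteDimensional ℝ E]

theorem comp_eq_id_of_comp_eq_id {A B : E →L[ℝ] E} (h : A.comp B = ContinuousLinearMap.id ℝ E) :
    B.comp A = ContinuousLinearMap.id ℝ E := by
  have h' : A.toLinearMap ∘ₗ B.toLinearMap = LinearMap.id := by
    rw [← ContinuousLinearMap.toLinearMap_comp, h]; rfl
  apply ContinuousLinearMap.coe_injective
  rw [ContinuousLinearMap.toLinearMap_comp, (LinearMap.comp_eq_id_comm ℝ E).1 h']; rfl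

theorem chartSymmDeriv_comp_chartDeriv (x₀ : M) {y : E} (hy : y ∈ (chartAt E x₀).target) :
    (chartSymmDeriv x₀ y).comp (chartDeriv x₀ ((chartAt E x₀).symm y))
      = ContinuousLinearMap.id ℝ (TangentSpace 𝓘(ℝ, E) ((chartAt E x₀).symm y)) := by
  exact comp_eq_id_of_comp_eq_id (E := E) (chartDeriv_comp_chartSymmDeriv x₀ hy)

theorem pullAlt_formAlt (q : M) (α : FormField E M) {p : M} (hp : p ∈ (chartAt E q).source) :
    pullAlt (chartDeriv q p) (formAlt q α (chartAt E q p)) = α p := by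
  obtain ⟨w, hw, rfl⟩ : ∃ w ∈ (chartAt E q).target, (chartAt E q).symm w = p :=
    ⟨_, (chartAt E q).map_source hp, (chartAt E q).left_inv hp⟩
  rw [(chartAt E q).right_inv hw, formAlt_eq_pullAlt]
  change pullAlt ((chartSymmDeriv q w).comp (chartDeriv q ((chartAt E q).symm w))) (α _) = _
  rw [chartSymmDeriv_comp_chartDeriv q hw]
  rfl

/-- Chart differentials are invertible, so a form is recovered from its chart expressions and
identities of forms become identities on the model space. -/
theorem form_ext {α β : FormField E M}
    (h : ∀ (x₀ : M), ∀ y ∈ (chartAt E x₀).target, formAlt x₀ α y = formAlt x₀ β y) : α = β := by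
  funext x
  rw [← pullAlt_formAlt x α (mem_chart_source E x), ← pullAlt_formAlt x β (mem_chart_source E x),
    h x _ (mem_chart_target E x)]

theorem formAlt_transition {x₀ q : M} (α : FormField E M) {z : E} (hz : z ∈ transitionSource x₀ q) :
    formAlt x₀ α z
      = pullAlt (fderiv ℝ (transition x₀ q) z) (formAlt q α (transition x₀ q z)) := by
  rw [formAlt_eq_pullAlt, ← pullAlt_formAlt q α hz.2, fderiv_transition hz]
  rfl

/-- At each point `extD` uses the chart around that very point. The transition to the chart around
`x₀` is absorbed by the naturality of `d` under pullback. -/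
theorem formAlt_extD {α : FormField E M} (hα : SmoothForm α) (x₀ : M) {y : E}
    (hy : y ∈ (chartAt E x₀).target) : formAlt x₀ (extD α) y = modelD (formAlt x₀ α) y := by
  have hy' : y ∈ transitionSource x₀ ((chartAt E x₀).symm y) := ⟨hy, mem_chart_source E _⟩
  rw [formAlt_eq_pullAlt, extD_apply]
  set q := (chartAt E x₀).symm y with hq
  have h := modelD_pullAlt (hα.diffAltAt q (transition_mem_target hy')) (contDiffAt_transition hy')
  rw [fderiv_transition hy'] at h
  refine Eq.trans ?_ (h.symm.trans ?_)
  · rfl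
  · refine modelD_congr ?_
    filter_upwards [(isOpen_transitionSource x₀ q).mem_nhds hy'] with z hz
    exact (formAlt_transition α hz).symm

theorem SmoothForm.extD {α : FormField E M} (hα : SmoothForm α) : SmoothForm (extD α) := by
  intro x₀ k
  cases k with
  | zero => exact contDiffOn_const.congr fun y _ => show _ = (0 : E [⋀^Fin 0]→L[ℝ] ℝ) from rfl
  | succ k =>
    have h : ContDiffOn ℝ (⊤ : ℕ∞) (extDeriv (formInChart x₀ α k)) (chartAt E x₀).target :=
      (ContinuousAlternatingMap.alternatizeUncurryFinCLM ℝ E ℝ).contDiff.comp_contDiffOn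
        ((hα x₀ k).fderiv_of_isOpen (chartAt E x₀).open_target (by simp))
    exact h.congr fun y hy => congrFun (formAlt_extD hα x₀ hy) (k + 1)

theorem extD_extD {α : FormField E M} (hα : SmoothForm α) : extD (extD α) = 0 := by
  refine form_ext fun x₀ y hy => ?_
  rw [formAlt_extD hα.extD x₀ hy, modelD_congr (β := modelD (formAlt x₀ α))
    (Filter.eventually_of_mem ((chartAt E x₀).open_target.mem_nhds hy)
      fun z hz => formAlt_extD hα x₀ hz)]
  funext k
  match k with
  | 0 => rfl
  -- In degree `1` the outer derivative is applied to the degree `0` part of the inner one, which is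
  -- zero by definition.
  | 1 =>
    change extDeriv (fun _ : E => (0 : E [⋀^Fin 0]→L[ℝ] ℝ)) y = 0
    ext v
    simp [extDeriv, ContinuousAlternatingMap.alternatizeUncurryFin_apply]
  | k + 2 =>
    exact extDeriv_extDeriv_apply ((hα x₀ k).contDiffAt ((chartAt E x₀).open_target.mem_nhds hy))
      (by simpa [one_add_one_eq_two] using two_le_smooth)

theorem formAlt_contract (X : MVField E M) (α : FormField E M) (x₀ : M) {y : E}
    (hy : y ∈ (chartAt E x₀).target) :
    formAlt x₀ (contract X α) y = contractPt (mvInChart x₀ X y) (formAlt x₀ α y) := by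
  have h1 : α ((chartAt E x₀).symm y)
      = pullAlt (chartDeriv x₀ ((chartAt E x₀).symm y)) (formAlt x₀ α y) := by
    have := pullAlt_formAlt x₀ α ((chartAt E x₀).map_target hy)
    rw [(chartAt E x₀).right_inv hy] at this
    exact this.symm
  rw [formAlt_eq_pullAlt x₀ (contract X α), contract, h1, contractPt_pullAlt]
  change pullAlt ((chartDeriv x₀ ((chartAt E x₀).symm y)).comp (chartSymmDeriv x₀ y)) _ = _
  rw [chartDeriv_comp_chartSymmDeriv x₀ hy]
  rfl

theorem SmoothMV.diffMVAt {X : MVField E M} (hX : SmoothMV X) (x₀ : M) {y : E}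
    (hy : y ∈ (chartAt E x₀).target) : DiffMVAt (mvInChart x₀ X) y :=
  SmoothMVOn.diffMVAt (hX x₀) (chartAt E x₀).open_target hy

theorem SmoothForm.contract {X : MVField E M} {α : FormField E M} (hX : SmoothMV X)
    (hα : SmoothForm α) : SmoothForm (contract X α) := fun x₀ k =>
  (SmoothAltOn.contractPt (hX x₀) (hα x₀) k).congr fun _ hy =>
    congrFun (formAlt_contract X α x₀ hy) k

theorem SmoothMV.mul {X Y : MVField E M} (hX : SmoothMV X) (hY : SmoothMV Y) :
    SmoothMV (X * Y) := by
  intro x₀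
  have h : mvInChart x₀ (X * Y) = fun y => mvInChart x₀ X y * mvInChart x₀ Y y := by
    funext y; simp [mvInChart]
  rw [h]
  exact SmoothMVOn.mul (hX x₀) (hY x₀)

theorem mvInChart_involute (x₀ : M) (X : MVField E M) (y : E) :
    mvInChart x₀ (fun x => CliffordAlgebra.involute (X x)) y
      = CliffordAlgebra.involute (mvInChart x₀ X y) := map_involute _ _

theorem SmoothMV.involute {X : MVField E M} (hX : SmoothMV X) :
    SmoothMV (fun x => CliffordAlgebra.involute (X x)) := by
  intro x₀
  rw [funext (mvInChart_involute x₀ X)]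
  exact SmoothMVOn.linearMap (hX x₀) CliffordAlgebra.involute.toLinearMap

/-- The part of integer degree `a` of a multivector field. -/
def mvPart (a : ℤ) (X : MVField E M) : MVField E M := fun x => degProj a (X x)

theorem SmoothMV.mvPart (a : ℤ) {X : MVField E M} (hX : SmoothMV X) : SmoothMV (mvPart a X) := by
  intro x₀
  rw [show mvInChart x₀ (NPlectic.mvPart a X) = fun y => degProj a (mvInChart x₀ X y) from
    funext fun y => map_degProj _ a _]
  exact SmoothMVOn.linearMap (hX x₀) (degProj a)

theorem mvInChart_chartAt (q : M) (X : MVField E M) {p : M} (hp : p ∈ (chartAt E q).source) :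
    mvInChart q X (chartAt E q p) = ExteriorAlgebra.map (chartDeriv q p).toLinearMap (X p) := by
  unfold mvInChart
  rw [(chartAt E q).left_inv hp]

theorem mvInChart_transition {x₀ q : M} (X : MVField E M) {z : E}
    (hz : z ∈ transitionSource x₀ q) : mvInChart q X (transition x₀ q z)
      = ExteriorAlgebra.map (fderiv ℝ (transition x₀ q) z).toLinearMap (mvInChart x₀ X z) := by
  rw [transition, mvInChart_chartAt q X hz.2, fderiv_transition hz, mvInChart,
    ← AlgHom.comp_apply, ExteriorAlgebra.map_comp_map]
  have h : (chartDeriv q ((chartAt E x₀).symm z)).toLinearMap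
      = (((chartDeriv q ((chartAt E x₀).symm z)).comp (chartSymmDeriv x₀ z)).comp
        (chartDeriv x₀ ((chartAt E x₀).symm z))).toLinearMap := by
    rw [ContinuousLinearMap.comp_assoc, chartSymmDeriv_comp_chartDeriv x₀ hz.1]; rfl
  rw [h]
  rfl

theorem inverse_chartDeriv_comp (x : M) :
    (ContinuousLinearMap.inverse (chartDeriv x x)).comp (chartDeriv x x)
      = ContinuousLinearMap.id ℝ (TangentSpace 𝓘(ℝ, E) x) := by
  have hx := mem_chart_target E x
  obtain ⟨S, h1, h2⟩ : ∃ S : E →L[ℝ] TangentSpace 𝓘(ℝ, E) x,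
      (chartDeriv x x).comp S = ContinuousLinearMap.id ℝ E ∧
      S.comp (chartDeriv x x) = ContinuousLinearMap.id ℝ (TangentSpace 𝓘(ℝ, E) x) := by
    -- `chartSymmDeriv` takes values in the tangent space at `(chartAt E x).symm (chartAt E x x)`,
    -- which equals `x` only propositionally; the base point is generalized to cross this equality.
    have h : ∀ p, p = (chartAt E x).symm (chartAt E x x) →
      ∃ S : E →L[ℝ] TangentSpace 𝓘(ℝ, E) p,
      (chartDeriv x p).comp S = ContinuousLinearMap.id ℝ E ∧
      S.comp (chartDeriv x p) = ContinuousLinearMap.id ℝ (TangentSpace 𝓘(ℝ, E) p) := by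
      rintro p rfl
      exact ⟨_, chartDeriv_comp_chartSymmDeriv x hx, chartSymmDeriv_comp_chartDeriv x hx⟩
    exact h x ((chartAt E x).left_inv (mem_chart_source E x)).symm
  rw [ContinuousLinearMap.inverse_eq h1 h2, h2]

/-- As for `d`, the bracket at a point is computed in the chart around that point, and naturality
moves it to the chart around `x₀`. -/
theorem mvInChart_schouten {X Y : MVField E M} (hX : SmoothMV X) (hY : SmoothMV Y) (x₀ : M) {y : E}
    (hy : y ∈ (chartAt E x₀).target) :
    mvInChart x₀ (schouten X Y) y
      = schoutenModel (mvInChart x₀ X) (mvInChart x₀ Y) y := by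
  have hy' : y ∈ transitionSource x₀ ((chartAt E x₀).symm y) := ⟨hy, mem_chart_source E _⟩
  rw [mvInChart, schouten]
  set q := (chartAt E x₀).symm y with hq
  have hn := (isOpen_transitionSource x₀ q).mem_nhds hy'
  have h := schoutenModel_natural (contDiffAt_transition hy') (hX.diffMVAt x₀ hy)
    (hY.diffMVAt x₀ hy) (hX.diffMVAt q (transition_mem_target hy'))
    (hY.diffMVAt q (transition_mem_target hy'))
    (Filter.eventually_of_mem hn fun z hz => mvInChart_transition X hz)
    (Filter.eventually_of_mem hn fun z hz => mvInChart_transition Y hz)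
  rw [show chartAt E q q = transition x₀ q y from rfl, h, ← AlgHom.comp_apply,
    ← AlgHom.comp_apply, ExteriorAlgebra.map_comp_map, ExteriorAlgebra.map_comp_map]
  -- Pushing from the chart around `x₀` to the chart around `q`, down to the tangent space and back
  -- up to the first chart is the identity.
  have h' : (chartDeriv x₀ q).toLinearMap ∘ₗ ((chartDeriv q q).inverse).toLinearMap ∘ₗ
      (fderiv ℝ (transition x₀ q) y).toLinearMap = LinearMap.id := by
    rw [fderiv_transition hy']
    change ((chartDeriv x₀ q).comp (((chartDeriv q q).inverse.comp (chartDeriv q q)).comp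
      (chartSymmDeriv x₀ y))).toLinearMap = _
    rw [inverse_chartDeriv_comp]
    change ((chartDeriv x₀ q).comp (chartSymmDeriv x₀ y)).toLinearMap = _
    rw [chartDeriv_comp_chartSymmDeriv x₀ hy]; rfl
  rw [LinearMap.comp_assoc, h', ExteriorAlgebra.map_id]
  rfl

theorem SmoothMV.schouten {X Y : MVField E M} (hX : SmoothMV X) (hY : SmoothMV Y) :
    SmoothMV (schouten X Y) := fun x₀ S =>
  (SmoothMVOn.schoutenModel (chartAt E x₀).open_target (hX x₀) (hY x₀) S).congr fun _ hy => by
    simp only [mvInChart_schouten hX hY x₀ hy]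

theorem formAlt_lieD {X : MVField E M} {α : FormField E M} (hX : SmoothMV X) (hα : SmoothForm α)
    (x₀ : M) {y : E} (hy : y ∈ (chartAt E x₀).target) :
    formAlt x₀ (lieD X α) y = modelLie (mvInChart x₀ X) (formAlt x₀ α) y := by
  rw [lieD, formAlt_sub, formAlt_extD (hα.contract hX) x₀ hy, formAlt_contract _ _ _ hy,
    formAlt_extD hα x₀ hy, mvInChart_involute, modelLie]
  congr 1
  exact modelD_congr (Filter.eventually_of_mem ((chartAt E x₀).open_target.mem_nhds hy)
    fun z hz => formAlt_contract X α x₀ hz)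

/-- The multivector field `X` has the parity of `r`. -/
def HasParity (r : ℤ) (X : MVField E M) : Prop :=
  ∀ x, CliffordAlgebra.involute (X x) = sgn r • X x

theorem HasParity.mvInChart {r : ℤ} {X : MVField E M} (h : HasParity r X) (x₀ : M) (y : E) :
    CliffordAlgebra.involute (mvInChart x₀ X y) = sgn r • mvInChart x₀ X y := by
  rw [← mvInChart_involute, NPlectic.mvInChart, h, map_smul]; rfl

/-- The Cartan formula `i_{[X, Y]} = (-1)^((r-1)s) L_X i_Y - i_Y L_X`. -/
theorem contract_schouten {X Y : MVField E M} {α : FormField E M} {r s : ℤ} (hX : SmoothMV X)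
    (hY : SmoothMV Y) (hα : SmoothForm α) (hr : HasParity r X) (hs : HasParity s Y) :
    contract (schouten X Y) α
      = sgn ((r - 1) * s) • lieD X (contract Y α) - contract Y (lieD X α) := by
  refine form_ext fun x₀ y hy => ?_
  rw [formAlt_contract _ _ _ hy, mvInChart_schouten hX hY x₀ hy, formAlt_sub, formAlt_smul,
    formAlt_lieD hX (hα.contract hY) x₀ hy, formAlt_contract _ _ _ hy, formAlt_lieD hX hα x₀ hy,
    contractPt_schoutenModel (hX.diffMVAt x₀ hy) (hY.diffMVAt x₀ hy) (hα.diffAltAt x₀ hy)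
      (hr.mvInChart x₀) (hs.mvInChart x₀),
    modelLie_congr _ (Filter.eventually_of_mem ((chartAt E x₀).open_target.mem_nhds hy)
      fun z hz => formAlt_contract Y α x₀ hz)]

theorem schouten_add_left {X X' : MVField E M} (hX : SmoothMV X) (hX' : SmoothMV X')
    (Y : MVField E M) : schouten (X + X') Y = schouten X Y + schouten X' Y := by
  funext x
  have h : mvInChart x (X + X') = fun y => mvInChart x X y + mvInChart x X' y := by
    funext y; simp [mvInChart]
  rw [schouten, h, schoutenModel_add_left (hX.diffMVAt x (mem_chart_target E x))
    (hX'.diffMVAt x (mem_chart_target E x)), map_add]; rfl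

theorem schouten_add_right {Y Y' : MVField E M} (hY : SmoothMV Y) (hY' : SmoothMV Y')
    (X : MVField E M) : schouten X (Y + Y') = schouten X Y + schouten X Y' := by
  funext x
  have h : mvInChart x (Y + Y') = fun y => mvInChart x Y y + mvInChart x Y' y := by
    funext y; simp [mvInChart]
  rw [schouten, h, schoutenModel_add_right (hY.diffMVAt x (mem_chart_target E x))
    (hY'.diffMVAt x (mem_chart_target E x)), map_add]; rfl

theorem schouten_smul_left {X : MVField E M} (hX : SmoothMV X) (c : ℝ)
    (Y : MVField E M) : schouten (c • X) Y = c • schouten X Y := by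
  funext x
  have h : mvInChart x (c • X) = fun y => c • mvInChart x X y := by
    funext y; simp [mvInChart]
  rw [schouten, h, schoutenModel_smul_left (hX.diffMVAt x (mem_chart_target E x)), map_smul]; rfl

end Charts

/-! ### Degrees of forms, and independence of the choice of fields. -/

section Operators

variable {E : Type*} [NormedAddCommGroup E] [NormedSpace ℝ E]
  {M : Type*} [TopologicalSpace M] [ChartedSpace E M]

theorem contract_add_left (X Y : MVField E M) (α : FormField E M) :
    contract (X + Y) α = contract X α + contract Y α := funext fun _ => contractPt_add_left _ _ _

theorem contract_smul_left (c : ℝ) (X : MVField E M) (α : FormField E M) :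
    contract (c • X) α = c • contract X α := funext fun _ => contractPt_smul_left _ _ _

theorem contract_sub_left (X Y : MVField E M) (α : FormField E M) :
    contract (X - Y) α = contract X α - contract Y α := funext fun _ => contractPt_sub_left _ _ _

theorem contract_zero_left (α : FormField E M) : contract (0 : MVField E M) α = 0 :=
  funext fun _ => contractPt_zero_left _

theorem contract_add (X : MVField E M) (α β : FormField E M) :
    contract X (α + β) = contract X α + contract X β := funext fun _ => contractPt_add _ _ _

theorem contract_smul (c : ℝ) (X : MVField E M) (α : FormField E M) :
    contract X (c • α) = c • contract X α := funext fun _ => contractPt_smul _ _ _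

theorem contract_neg (X : MVField E M) (α : FormField E M) :
    contract X (-α) = -contract X α := funext fun _ => contractPt_neg _ _

theorem contract_sub (X : MVField E M) (α β : FormField E M) :
    contract X (α - β) = contract X α - contract X β := by
  rw [sub_eq_add_neg, contract_add, contract_neg, sub_eq_add_neg]

theorem contract_zero (X : MVField E M) : contract X (0 : FormField E M) = 0 :=
  funext fun _ => contractPt_zero _

theorem contract_mul (X Y : MVField E M) (α : FormField E M) :
    contract (X * Y) α = contract Y (contract X α) := funext fun _ => contractPt_mul _ _ _

theorem extD_zero : extD (0 : FormField E M) = 0 := by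
  simpa using extD_smul (0 : ℝ) (0 : FormField E M)

theorem extD_neg (α : FormField E M) : extD (-α) = -extD α := by
  rw [← neg_one_smul ℝ α, extD_smul]; module

theorem SmoothForm.neg {α : FormField E M} (hα : SmoothForm α) : SmoothForm (-α) := by
  rw [← neg_one_smul ℝ α]; exact hα.smul (-1)

theorem SmoothForm.sub {α β : FormField E M} (hα : SmoothForm α) (hβ : SmoothForm β) :
    SmoothForm (α - β) := by
  rw [sub_eq_add_neg]; exact hα.add hβ.neg

theorem extD_sub {α β : FormField E M} (hα : SmoothForm α) (hβ : SmoothForm β) :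
    extD (α - β) = extD α - extD β := by
  rw [sub_eq_add_neg, extD_add hα hβ.neg, extD_neg, sub_eq_add_neg]

theorem lieD_zero_right (X : MVField E M) : lieD X (0 : FormField E M) = 0 := by
  rw [lieD, contract_zero, extD_zero, contract_zero, sub_zero]

theorem formInChart_eq_zero {α : FormField E M} {k : ℕ} (h : ∀ x, α x k = 0) (x₀ : M) :
    formInChart x₀ α k = fun _ => 0 := by
  funext y
  rw [formInChart, h]; rfl

theorem extD_succ_eq_zero {α : FormField E M} {k : ℕ} (h : ∀ x, α x k = 0) (x : M) :
    extD α x (k + 1) = 0 := by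
  change (extDeriv (formInChart x α k) (chartAt E x x)).compContinuousLinearMap _ = 0
  rw [formInChart_eq_zero h]
  ext v
  simp [extDeriv, ContinuousAlternatingMap.alternatizeUncurryFin_apply]

theorem HasDeg.extD {n : ℕ} {a : ℤ} {f : FormField E M} (hf : HasDeg n a f) :
    HasDeg n (a - 1) (extD f) := by
  intro x k hk
  cases k with
  | zero => rfl
  | succ k => exact extD_succ_eq_zero (fun x => hf x k (by push_cast at hk; lia)) x

theorem HasDeg.add {n : ℕ} {a : ℤ} {f g : FormField E M} (hf : HasDeg n a f) (hg : HasDeg n a g) :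
    HasDeg n a (f + g) := fun x k hk => by
  rw [Pi.add_apply, Pi.add_apply, hf x k hk, hg x k hk, add_zero]

theorem HasDeg.smul {n : ℕ} {a : ℤ} (c : ℝ) {f : FormField E M} (hf : HasDeg n a f) :
    HasDeg n a (c • f) := fun x k hk => by
  rw [Pi.smul_apply, Pi.smul_apply, hf x k hk, smul_zero]

theorem HasDeg.neg {n : ℕ} {a : ℤ} {f : FormField E M} (hf : HasDeg n a f) :
    HasDeg n a (-f) := by
  rw [← neg_one_smul ℝ f]; exact hf.smul (-1)

theorem HasDeg.sub {n : ℕ} {a : ℤ} {f g : FormField E M} (hf : HasDeg n a f) (hg : HasDeg n a g) :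
    HasDeg n a (f - g) := by rw [sub_eq_add_neg]; exact hf.add hg.neg

theorem hasDeg_zero (n : ℕ) (a : ℤ) : HasDeg n a (0 : FormField E M) := fun _ _ _ => rfl

theorem hasDeg_component (n k : ℕ) (f : FormField E M) : HasDeg n (n - k) (component k f) :=
  fun x j hj => Pi.single_eq_of_ne (by lia) _

theorem component_apply_of_ne {k j : ℕ} (h : j ≠ k) (f : FormField E M) (x : M) :
    component k f x j = 0 := Pi.single_eq_of_ne h _

theorem component_apply_self (k : ℕ) (f : FormField E M) (x : M) :
    component k f x k = f x k := Pi.single_eq_same _ _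

theorem component_add (k : ℕ) (f g : FormField E M) :
    component k (f + g) = component k f + component k g :=
  funext fun _ => Pi.single_add _ _ _

theorem component_smul (k : ℕ) (c : ℝ) (f : FormField E M) :
    component k (c • f) = c • component k f := by
  funext x j
  change component k (c • f) x j = c • component k f x j
  by_cases hj : j = k
  · subst hj; rw [component_apply_self, component_apply_self]; rfl
  · rw [component_apply_of_ne hj, component_apply_of_ne hj, smul_zero]

theorem component_eq_self {n k : ℕ} {a : ℤ} {f : FormField E M} (hf : HasDeg n a f)
    (h : (n : ℤ) - k = a) : component k f = f := by
  funext x j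
  by_cases hj : j = k
  · subst hj; exact component_apply_self _ _ _
  · rw [component_apply_of_ne hj, hf x j (by lia)]

theorem component_eq_zero {n k : ℕ} {a : ℤ} {f : FormField E M} (hf : HasDeg n a f)
    (h : (n : ℤ) - k ≠ a) : component k f = 0 := by
  funext x j
  by_cases hj : j = k
  · subst hj; rw [component_apply_self, hf x j h]; rfl
  · rw [component_apply_of_ne hj]; rfl

theorem SmoothForm.component (k : ℕ) {f : FormField E M} (hf : SmoothForm f) :
    SmoothForm (component k f) := by
  intro x₀ j
  by_cases hj : j = k
  · subst hj
    have h : formInChart x₀ (NPlectic.component j f) j = formInChart x₀ f j := by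
      funext y
      rw [formInChart, component_apply_self]; rfl
    rw [h]; exact hf x₀ j
  · rw [formInChart_eq_zero (component_apply_of_ne hj f)]
    exact contDiffOn_const

theorem extD_component_succ (k : ℕ) (f : FormField E M) (x : M) :
    extD (component k f) x (k + 1) = extD f x (k + 1) := by
  have h : formInChart x (component k f) k = formInChart x f k := by
    funext y
    rw [formInChart, component_apply_self]; rfl
  change (extDeriv (formInChart x (component k f) k) (chartAt E x x)).compContinuousLinearMap _ = _
  rw [h]; rfl

/-- The degree `k` part of `i_X α` only involves the part of `X` of degree `m - k`, where the
involution is a sign. Hence `i_X α` determines the contraction along the involution of `X`, even for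
mixed `X`. -/
theorem contractPt_involute {V : Type*} [AddCommGroup V] [Module ℝ V] [TopologicalSpace V]
    [IsTopologicalAddGroup V] [ContinuousConstSMul ℝ V] {m : ℤ} {α : Alt V}
    (hα : ∀ j : ℕ, (j : ℤ) ≠ m → α j = 0) (X : ExteriorAlgebra ℝ V) (k : ℕ) :
    contractPt (CliffordAlgebra.involute X) α k = sgn (m - k) • contractPt X α k := by
  induction X using exteriorAlgebra_graded_induction with
  | mem i x hx =>
    rw [involute_of_mem_exteriorPower hx, contractPt_smul_left, Pi.smul_apply]
    by_cases h : (k : ℤ) + i = m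
    · rw [show m - k = i by lia]
    · rw [contractPt_eq_zero_of_mem hx (hα _ (by push_cast; exact h)), smul_zero, smul_zero]
  | add x y hx hy =>
    rw [map_add, contractPt_add_left, contractPt_add_left, Pi.add_apply, Pi.add_apply, hx, hy,
      smul_add]

variable {n : ℕ} {ω : FormField E M}

theorem IsNPlectic.eq_zero (hω : IsNPlectic n ω) (x : M) (j : ℕ) (hj : (j : ℤ) ≠ n + 1) :
    ω x j = 0 := hω.degree x j (by lia)

theorem contract_involute_congr (hω : IsNPlectic n ω) {X X' : MVField E M}
    (h : contract X ω = contract X' ω) :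
    contract (fun x => CliffordAlgebra.involute (X x)) ω
      = contract (fun x => CliffordAlgebra.involute (X' x)) ω := by
  funext x k
  have h' := congrFun (congrFun h x) k
  simp only [contract] at h' ⊢
  rw [contractPt_involute (hω.eq_zero x), contractPt_involute (hω.eq_zero x), h']

/-- Moving `K` past a homogeneous `Y` replaces `K` by itself or by its involution, and both
annihilate `α`. -/
theorem contractPt_contractPt_eq_zero {V : Type*} [AddCommGroup V] [Module ℝ V]
    [TopologicalSpace V] [IsTopologicalAddGroup V] [ContinuousConstSMul ℝ V] {m : ℤ} {α : Alt V}
    (hα : ∀ j : ℕ, (j : ℤ) ≠ m → α j = 0) {K : ExteriorAlgebra ℝ V} (hK : contractPt K α = 0)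
    (Y : ExteriorAlgebra ℝ V) : contractPt K (contractPt Y α) = 0 := by
  have hK' : contractPt (CliffordAlgebra.involute K) α = 0 := by
    funext k
    rw [contractPt_involute hα, hK, Pi.zero_apply, smul_zero]
  induction Y using exteriorAlgebra_graded_induction with
  | mem i y hy =>
    have h := involute_of_mem_exteriorPower hy
    rw [← contractPt_mul]
    rcases Int.even_or_odd i with hi | hi
    · rw [sgn_of_even hi, one_smul] at h
      rw [← mul_comm_of_involute_eq h, contractPt_mul, hK, contractPt_zero]
    · rw [sgn_of_odd hi, neg_one_smul] at h
      have h' := mul_comm_of_involute_eq_neg h (CliffordAlgebra.involute K)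
      rw [CliffordAlgebra.involute_involute] at h'
      rw [← h', contractPt_mul, hK', contractPt_zero]
  | add y z hy hz => rw [contractPt_add_left, contractPt_add, hy, hz, add_zero]

/-- A form that is a contraction of `ω`. -/
def IsContraction (ω g : FormField E M) : Prop := ∃ Y : MVField E M, contract Y ω = g

/-- Contractions of `ω`-contractions depend only on the contraction of `ω`. -/
theorem contract_congr (hω : IsNPlectic n ω) {X X' : MVField E M}
    (h : contract X ω = contract X' ω) {g : FormField E M} (hg : IsContraction ω g) :
    contract X g = contract X' g := by
  obtain ⟨Y, rfl⟩ := hg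
  rw [← sub_eq_zero, ← contract_sub_left] at h ⊢
  funext x
  exact contractPt_contractPt_eq_zero (hω.eq_zero x) (congrFun h x) (Y x)

theorem IsContraction.contract {g : FormField E M} (hg : IsContraction ω g) (X : MVField E M) :
    IsContraction ω (contract X g) := by
  obtain ⟨Y, rfl⟩ := hg
  exact ⟨Y * X, contract_mul _ _ _⟩

theorem IsContraction.neg {g : FormField E M} (hg : IsContraction ω g) : IsContraction ω (-g) := by
  obtain ⟨Y, rfl⟩ := hg
  exact ⟨(-1 : ℝ) • Y, by rw [contract_smul_left]; module⟩

theorem contract_mvPart_apply (hω : IsNPlectic n ω) (a : ℤ) (X : MVField E M) (x : M) (k : ℕ) :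
    contract (mvPart a X) ω x k = if (k : ℤ) + a = n + 1 then contract X ω x k else 0 :=
  contractPt_degProj (hω.eq_zero x) a (X x) k

/-- Symmetric degree `a - 1` is tensor degree `n + 1 - a`, which from the `(n+1)`-form `ω` is
reached only by the degree `a` part of `X`. -/
theorem contract_mvPart (hω : IsNPlectic n ω) {a : ℤ} {X : MVField E M}
    (h : HasDeg n (a - 1) (contract X ω)) : contract (mvPart a X) ω = contract X ω := by
  funext x k
  rw [contract_mvPart_apply hω]
  split_ifs with hk
  · rfl
  · exact (h x k (by lia)).symm

theorem hasParity_mvPart (a : ℤ) (X : MVField E M) : HasParity a (mvPart a X) :=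
  fun x => involute_degProj a (X x)

theorem HasDeg.contract_mvPart {a b : ℤ} {f : FormField E M} (hf : HasDeg n b f)
    (X : MVField E M) : HasDeg n (a + b) (contract (mvPart a X) f) := fun x k hk =>
  contractPt_eq_zero_of_degProj_eq (degProj_degProj a (X x)) (m := n - b)
    (fun j hj => hf x j (by lia)) k (by lia)

theorem HasParity.contract_contract {r s : ℤ} {X Y : MVField E M} (hX : HasParity r X)
    (hY : HasParity s Y) (α : FormField E M) :
    contract X (contract Y α) = sgn (r * s) • contract Y (contract X α) :=
  funext fun x => contractPt_contractPt_comm (hX x) (hY x) (α x)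

end Operators

/-! ### Hamiltonian forms and their associated fields. -/

section Hamiltonian

variable {E : Type*} [NormedAddCommGroup E] [NormedSpace ℝ E] [FiniteDimensional ℝ E]
  {M : Type*} [TopologicalSpace M] [ChartedSpace E M] [IsManifold 𝓘(ℝ, E) (⊤ : ℕ∞) M]
  {n : ℕ} {ω : FormField E M}

/-- `f` is a Hamiltonian form, homogeneous of symmetric degree `a`. -/
structure HomHam (n : ℕ) (ω : FormField E M) (a : ℤ) (f : FormField E M) : Prop where
  mem : f ∈ hamForms ω
  deg : HasDeg n a f

theorem HomHam.smooth {a : ℤ} {f : FormField E M} (hf : HomHam n ω a f) : SmoothForm f := hf.mem.1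

theorem IsHam.isContraction {Y : MVField E M} {f : FormField E M} (h : IsHam ω Y f) :
    IsContraction ω f := by
  have : IsContraction ω (-f) := ⟨Y, h.2⟩
  simpa using this.neg

theorem HomHam.isContraction {a : ℤ} {f : FormField E M} (hf : HomHam n ω a f) :
    IsContraction ω f := hf.mem.2.2.choose_spec.isContraction

/-- Being semi-Hamiltonian for `f` is the same as being Hamiltonian for `df`; formulas for
Hamiltonian fields thereby also apply to brackets of two semi-Hamiltonian fields. -/
theorem IsSemiHam.isHam_extD {X : MVField E M} {f : FormField E M} (h : IsSemiHam ω X f) :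
    IsHam ω X (extD f) := h

theorem isSemiHam_zero_of_extD_eq_zero {f : FormField E M} (h : extD f = 0) :
    IsSemiHam ω (0 : MVField E M) f :=
  ⟨smoothMV_zero, by rw [h, contract_zero_left, neg_zero]⟩

theorem HomHam.extD {a : ℤ} {f : FormField E M} (hf : HomHam n ω a f) :
    HomHam n ω (a - 1) (extD f) :=
  ⟨⟨hf.smooth.extD, ⟨0, isSemiHam_zero_of_extD_eq_zero (extD_extD hf.smooth)⟩,
    hf.mem.2.1.choose, hf.mem.2.1.choose_spec.isHam_extD⟩, hf.deg.extD⟩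

theorem homHam_zero (n : ℕ) (ω : FormField E M) (a : ℤ) : HomHam n ω a 0 :=
  ⟨zero_mem _, hasDeg_zero n a⟩

theorem IsSemiHam.mvPart (hω : IsNPlectic n ω) {a : ℤ} {X : MVField E M} {f : FormField E M}
    (hX : IsSemiHam ω X f) (hf : HasDeg n a f) : IsSemiHam ω (mvPart a X) f :=
  ⟨hX.1.mvPart a, by rw [contract_mvPart hω (hX.2 ▸ hf.extD.neg), hX.2]⟩

theorem IsHam.mvPart (hω : IsNPlectic n ω) {a : ℤ} {Y : MVField E M} {f : FormField E M}
    (hY : IsHam ω Y f) (hf : HasDeg n a f) : IsHam ω (mvPart (a + 1) Y) f :=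
  ⟨hY.1.mvPart _, by
    rw [contract_mvPart hω (by rw [add_sub_cancel_right, hY.2]; exact hf.neg), hY.2]⟩

/-- Since `ω` is homogeneous, suitable homogeneous parts of the fields of `f` are associated to its
components: a form of tensor degree `k` needs degree `n - k` for `df` and `n - k + 1` for `f`. -/
theorem component_mem_hamForms (hω : IsNPlectic n ω) (k : ℕ) {f : FormField E M}
    (hf : f ∈ hamForms ω) : component k f ∈ hamForms ω := by
  obtain ⟨hs, ⟨X, hX⟩, Y, hY⟩ := hf
  refine ⟨hs.component k, ⟨mvPart (n - k) X, hX.1.mvPart _, ?_⟩, mvPart (n - k + 1) Y,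
    hY.1.mvPart _, ?_⟩
  · funext x j
    rw [contract_mvPart_apply hω, hX.2]
    split_ifs with hj
    · obtain rfl : j = k + 1 := by lia
      exact congrArg Neg.neg (extD_component_succ k f x).symm
    · refine (neg_eq_zero.2 ?_).symm
      exact (hasDeg_component n k f).extD x j (by lia)
  · funext x j
    rw [contract_mvPart_apply hω, hY.2]
    split_ifs with hj
    · obtain rfl : j = k := by lia
      exact congrArg Neg.neg (component_apply_self j f x).symm
    · exact (neg_eq_zero.2 (component_apply_of_ne (by lia) f x)).symm

theorem homHam_component (hω : IsNPlectic n ω) (k : ℕ) {f : FormField E M}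
    (hf : f ∈ hamForms ω) : HomHam n ω (n - k) (component k f) :=
  ⟨component_mem_hamForms hω k hf, hasDeg_component n k f⟩

theorem isSemiHam_someSemiHam {f : FormField E M} (hf : f ∈ hamForms ω) :
    IsSemiHam ω (someSemiHam ω f) f := by
  unfold someSemiHam
  rw [dif_pos hf.2.1]
  exact hf.2.1.choose_spec

theorem IsSemiHam.contract_congr (hω : IsNPlectic n ω) {X X' : MVField E M} {f g : FormField E M}
    (hX : IsSemiHam ω X f) (hX' : IsSemiHam ω X' f) (hg : IsContraction ω g) :
    contract X g = contract X' g := NPlectic.contract_congr hω (hX.2.trans hX'.2.symm) hg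

theorem HasDeg.contract_isSemiHam (hω : IsNPlectic n ω) {a b : ℤ} {X : MVField E M}
    {f g : FormField E M} (hX : IsSemiHam ω X f) (hf : HasDeg n a f) (hg : HasDeg n b g)
    (hg' : IsContraction ω g) : HasDeg n (a + b) (contract X g) := by
  rw [hX.contract_congr hω (hX.mvPart hω hf) hg']
  exact hg.contract_mvPart X

/-- The Lie derivative along a semi-Hamiltonian multivector field. -/
theorem IsSemiHam.lieD_eq (hω : IsNPlectic n ω) {a b : ℤ} {X : MVField E M} {f g : FormField E M}
    (hX : IsSemiHam ω X f) (hf : HasDeg n a f) (hg : HomHam n ω b g) :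
    lieD X g = extD (contract X g) - sgn a • contract X (extD g) := by
  have hX' := hX.mvPart hω hf
  rw [lieD, NPlectic.contract_congr hω (contract_involute_congr hω (hX.2.trans hX'.2.symm))
    hg.extD.isContraction, hX.contract_congr hω hX' hg.extD.isContraction,
    show (fun x => CliffordAlgebra.involute (NPlectic.mvPart a X x))
      = sgn a • NPlectic.mvPart a X from funext fun x => hasParity_mvPart a X x,
    contract_smul_left]

/-- Both sides are double contractions of `ω`, since `df = -i_X ω` and `dg = -i_Y ω`; the sign comes
from exchanging homogeneous representatives of the two fields. -/
theorem IsSemiHam.contract_extD_comm (hω : IsNPlectic n ω) {a b : ℤ} {X Y : MVField E M}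
    {f g : FormField E M} (hX : IsSemiHam ω X f) (hY : IsSemiHam ω Y g) (hf : HomHam n ω a f)
    (hg : HomHam n ω b g) :
    contract X (extD g) = sgn (a * b) • contract Y (extD f) := by
  have hX' := hX.mvPart hω hf.deg
  have hY' := hY.mvPart hω hg.deg
  rw [hX.contract_congr hω hX' hg.extD.isContraction,
    hY.contract_congr hω hY' hf.extD.isContraction,
    ← neg_neg (extD g), ← hY'.2, ← neg_neg (extD f), ← hX'.2, contract_neg, contract_neg,
    (hasParity_mvPart a X).contract_contract (hasParity_mvPart b Y), smul_neg]

theorem IsSemiHam.contract_contract_comm (hω : IsNPlectic n ω) {a b : ℤ} {X Y : MVField E M}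
    {f g h : FormField E M} (hX : IsSemiHam ω X f) (hY : IsSemiHam ω Y g) (hf : HasDeg n a f)
    (hg : HasDeg n b g) (hh : IsContraction ω h) :
    contract X (contract Y h) = sgn (a * b) • contract Y (contract X h) := by
  have hX' := hX.mvPart hω hf
  have hY' := hY.mvPart hω hg
  rw [hX.contract_congr hω hX' (hh.contract Y), hY.contract_congr hω hY' hh,
    hY.contract_congr hω hY' (hh.contract X), hX.contract_congr hω hX' hh,
    (hasParity_mvPart a X).contract_contract (hasParity_mvPart b Y)]

/-- The Cartan formula for contractions of `ω` along brackets with a closed homogeneous field. -/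
theorem contract_schouten_of_closed (hω : IsNPlectic n ω) {r s : ℤ} {X Y : MVField E M}
    (hX : SmoothMV X) (hY : SmoothMV Y) (hr : HasParity r X) (hs : HasParity s Y)
    (hcl : extD (contract X ω) = 0) :
    contract (schouten X Y) ω = sgn ((r - 1) * s) • lieD X (contract Y ω) := by
  have h : lieD X ω = 0 := by rw [lieD, hcl, hω.closed, contract_zero, sub_zero]
  rw [contract_schouten hX hY hω.smooth hr hs, h, contract_zero, sub_zero]

/-- The even (`t` even) or odd (`t` odd) part of a multivector field. -/
def mvParity (t : ℤ) (X : MVField E M) : MVField E M :=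
  (1 / 2 : ℝ) • (X + sgn t • fun x => CliffordAlgebra.involute (X x))

theorem hasParity_mvParity (t : ℤ) (X : MVField E M) : HasParity t (mvParity t X) := by
  intro x
  simp only [mvParity, Pi.smul_apply, Pi.add_apply, map_smul, map_add,
    CliffordAlgebra.involute_involute]
  rcases mul_self_eq_one_iff.1 (sgn_mul_self t) with h | h <;> rw [h] <;> module

theorem mvParity_add_mvParity (X : MVField E M) : mvParity 0 X + mvParity 1 X = X := by
  simp only [mvParity, sgn_zero, sgn_one]
  module

theorem SmoothMV.mvParity (t : ℤ) {X : MVField E M} (hX : SmoothMV X) : SmoothMV (mvParity t X) :=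
  (hX.add (hX.involute.smul _)).smul _

theorem contract_mvParity_eq_zero (hω : IsNPlectic n ω) (t : ℤ) {K : MVField E M}
    (hK : contract K ω = 0) : contract (mvParity t K) ω = 0 := by
  have h : contract (fun x => CliffordAlgebra.involute (K x)) ω = 0 := by
    funext x k
    have := congrFun (congrFun hK x) k
    simp only [contract] at this ⊢
    rw [contractPt_involute (hω.eq_zero x), this, Pi.zero_apply, Pi.zero_apply, smul_zero]
  rw [mvParity, contract_smul_left, contract_add_left, contract_smul_left, h, hK, smul_zero,
    add_zero, smul_zero]

/-- `K` and its involution annihilate `ω`, hence also `g` and `dg`, which are contractions of `ω`.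
-/
theorem lieD_eq_zero_of_contract_eq_zero (hω : IsNPlectic n ω) {K : MVField E M}
    (hK : contract K ω = 0) {b : ℤ} {g : FormField E M} (hg : HomHam n ω b g) :
    lieD K g = 0 := by
  have h0 : contract K ω = contract 0 ω := by rw [hK, contract_zero_left]
  have h1 := contract_involute_congr hω h0
  have h2 : (fun x => CliffordAlgebra.involute ((0 : MVField E M) x)) = (0 : MVField E M) := by
    funext x; exact map_zero _
  rw [h2] at h1
  rw [lieD, NPlectic.contract_congr hω h1 hg.extD.isContraction,
    NPlectic.contract_congr hω h0 hg.isContraction, contract_zero_left, contract_zero_left,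
    extD_zero, sub_zero]

/-- The bracket of a semi-Hamiltonian and a Hamiltonian multivector field. -/
theorem contract_schouten_isHam (hω : IsNPlectic n ω) {a b : ℤ} {X Y : MVField E M}
    {f g : FormField E M} (hX : IsSemiHam ω X f) (hf : SmoothForm f) (hfa : HasDeg n a f)
    (hY : IsHam ω Y g) (hg : HomHam n ω b g) :
    contract (schouten X Y) ω = -(sgn ((a - 1) * (b + 1)) • lieD X g) := by
  have hX' := hX.mvPart hω hfa
  have hY' := hY.mvPart hω hg.deg
  -- The given fields may have mixed degree, while the Cartan formula needs parities. So the parts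
  -- of degrees `a` and `b + 1` are split off; the remainders annihilate `ω`, and so do their even
  -- and odd parts.
  obtain ⟨K, hKs, hK, hXK⟩ : ∃ K : MVField E M, SmoothMV K ∧ contract K ω = 0 ∧
      X = mvPart a X + K := by
    refine ⟨X + (-1 : ℝ) • mvPart a X, hX.1.add (hX'.1.smul _), ?_, by module⟩
    rw [contract_add_left, contract_smul_left, hX.2, hX'.2]; module
  obtain ⟨N, hNs, hN, hYN⟩ : ∃ N : MVField E M, SmoothMV N ∧ contract N ω = 0 ∧
      Y = mvPart (b + 1) Y + N := by
    refine ⟨Y + (-1 : ℝ) • mvPart (b + 1) Y, hY.1.add (hY'.1.smul _), ?_, by module⟩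
    rw [contract_add_left, contract_smul_left, hY.2, hY'.2]; module
  have hcl : extD (contract (mvPart a X) ω) = 0 := by
    rw [hX'.2, extD_neg, extD_extD hf, neg_zero]
  have hKcl : ∀ t, extD (contract (mvParity t K) ω) = 0 := fun t => by
    rw [contract_mvParity_eq_zero hω t hK, extD_zero]
  have hng : HomHam n ω b (-g) := ⟨neg_mem hg.mem, hg.deg.neg⟩
  have h1 : contract (schouten (mvPart a X) (mvPart (b + 1) Y)) ω
      = -(sgn ((a - 1) * (b + 1)) • lieD X g) := by
    rw [contract_schouten_of_closed hω hX'.1 hY'.1 (hasParity_mvPart _ _) (hasParity_mvPart _ _)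
      hcl, hY'.2, hX'.lieD_eq hω hfa hng, hX.lieD_eq hω hfa hg,
      hX.contract_congr hω hX' hg.isContraction, hX.contract_congr hω hX' hg.extD.isContraction,
      contract_neg, extD_neg, extD_neg, contract_neg]
    module
  have h2 : contract (schouten (mvPart a X) N) ω = 0 := by
    rw [← mvParity_add_mvParity N, schouten_add_right (hNs.mvParity _) (hNs.mvParity _),
      contract_add_left,
      contract_schouten_of_closed hω hX'.1 (hNs.mvParity 0) (hasParity_mvPart _ _)
        (hasParity_mvParity 0 N) hcl,
      contract_schouten_of_closed hω hX'.1 (hNs.mvParity 1) (hasParity_mvPart _ _)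
        (hasParity_mvParity 1 N) hcl, contract_mvParity_eq_zero hω 0 hN,
      contract_mvParity_eq_zero hω 1 hN, lieD_zero_right, smul_zero, smul_zero, add_zero]
  -- `W` plays two roles: the homogeneous part of `Y`, and the even or odd part of the remainder
  -- `N`.
  have h3 : ∀ (c : ℤ) (W : MVField E M), SmoothMV W → HasParity c W →
      (contract W ω = -g ∨ contract W ω = 0) → contract (schouten K W) ω = 0 := by
    intro c W hW hWc hWg
    have h0 : ∀ t, lieD (mvParity t K) (contract W ω) = 0 := fun t => by
      rcases hWg with h | h
      · rw [h]; exact lieD_eq_zero_of_contract_eq_zero hω (contract_mvParity_eq_zero hω t hK) hng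
      · rw [h, lieD_zero_right]
    rw [← mvParity_add_mvParity K, schouten_add_left (hKs.mvParity _) (hKs.mvParity _),
      contract_add_left,
      contract_schouten_of_closed hω (hKs.mvParity 0) hW (hasParity_mvParity 0 K) hWc (hKcl 0),
      contract_schouten_of_closed hω (hKs.mvParity 1) hW (hasParity_mvParity 1 K) hWc (hKcl 1),
      h0, h0, smul_zero, smul_zero, add_zero]
  have h4 : contract (schouten K N) ω = 0 := by
    rw [← mvParity_add_mvParity N, schouten_add_right (hNs.mvParity _) (hNs.mvParity _),
      contract_add_left,
      h3 0 _ (hNs.mvParity 0) (hasParity_mvParity 0 N) (Or.inr (contract_mvParity_eq_zero hω 0 hN)),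
      h3 1 _ (hNs.mvParity 1) (hasParity_mvParity 1 N) (Or.inr (contract_mvParity_eq_zero hω 1 hN)),
      add_zero]
  have hsplit : schouten X Y = (schouten (mvPart a X) (mvPart (b + 1) Y)
      + schouten (mvPart a X) N) + (schouten K (mvPart (b + 1) Y) + schouten K N) := by
    rw [← schouten_add_right hY'.1 hNs, ← schouten_add_right hY'.1 hNs, ← hYN,
      ← schouten_add_left hX'.1 hKs, ← hXK]
  rw [hsplit, contract_add_left, contract_add_left, contract_add_left, h1, h2,
    h3 _ _ hY'.1 (hasParity_mvPart _ _) (Or.inl hY'.2), h4, add_zero, add_zero, add_zero]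

end Hamiltonian

/-! ### The binary bracket and contractions along its associated fields. -/

section Brackets

variable {E : Type*} [NormedAddCommGroup E] [NormedSpace ℝ E] [FiniteDimensional ℝ E]
  {M : Type*} [TopologicalSpace M] [ChartedSpace E M] [IsManifold 𝓘(ℝ, E) (⊤ : ℕ∞) M]
  {n : ℕ} {ω : FormField E M}

theorem HomHam.add {a : ℤ} {f g : FormField E M} (hf : HomHam n ω a f) (hg : HomHam n ω a g) :
    HomHam n ω a (f + g) := ⟨add_mem hf.mem hg.mem, hf.deg.add hg.deg⟩

theorem HomHam.smul {a : ℤ} (c : ℝ) {f : FormField E M} (hf : HomHam n ω a f) :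
    HomHam n ω a (c • f) := ⟨(hamForms ω).smul_mem c hf.mem, hf.deg.smul c⟩

/-- The two Lie derivatives contribute `-i_X dg` and `-e(f, g) i_Y df`, which coincide by
`IsSemiHam.contract_extD_comm`; hence the coefficient `2`. -/
theorem D₂formula_eq (hω : IsNPlectic n ω) {a b : ℤ} {X Y : MVField E M} {f g : FormField E M}
    (hX : IsSemiHam ω X f) (hY : IsSemiHam ω Y g) (hf : HomHam n ω a f) (hg : HomHam n ω b g) :
    D₂formula a b X Y f g = sgn a • extD (contract X g)
      + (sgn (a * b) * sgn b) • extD (contract Y f) - (2 : ℝ) • contract X (extD g) := by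
  rw [D₂formula, hX.lieD_eq hω hf.deg hg, hY.lieD_eq hω hg.deg hf,
    hY.contract_extD_comm hω hX hg hf, mul_comm b a]
  rcases mul_self_eq_one_iff.1 (sgn_mul_self a) with h1 | h1 <;>
  rcases mul_self_eq_one_iff.1 (sgn_mul_self b) with h2 | h2 <;>
  rcases mul_self_eq_one_iff.1 (sgn_mul_self (a * b)) with h3 | h3 <;>
  rw [h1, h2, h3] <;> module

theorem extD_D₂formula (hω : IsNPlectic n ω) {a b : ℤ} {X Y : MVField E M} {f g : FormField E M}
    (hX : IsSemiHam ω X f) (hY : IsSemiHam ω Y g) (hf : HomHam n ω a f) (hg : HomHam n ω b g) :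
    extD (D₂formula a b X Y f g) = (-2 : ℝ) • extD (contract X (extD g)) := by
  have h1 := hg.smooth.contract hX.1
  have h2 := hf.smooth.contract hY.1
  have h3 := hg.smooth.extD.contract hX.1
  rw [D₂formula_eq hω hX hY hf hg,
    extD_sub ((h1.extD.smul _).add (h2.extD.smul _)) (h3.smul _),
    extD_add (h1.extD.smul _) (h2.extD.smul _), extD_smul, extD_smul, extD_smul, extD_extD h1,
    extD_extD h2]
  module

/-- `X` is a Hamiltonian field of `df`, so contracting `ω` along `[Y, X]` gives `± L_Y df = ± d i_Y
df`. By symmetry this is `± d i_X dg`, the only non-closed contribution to `D₂`. -/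
theorem isSemiHam_D₂formula (hω : IsNPlectic n ω) {a b : ℤ} {X Y : MVField E M}
    {f g : FormField E M} (hX : IsSemiHam ω X f) (hY : IsSemiHam ω Y g) (hf : HomHam n ω a f)
    (hg : HomHam n ω b g) :
    IsSemiHam ω ((-2 * sgn a) • schouten Y X) (D₂formula a b X Y f g) := by
  refine ⟨(hY.1.schouten hX.1).smul _, ?_⟩
  rw [extD_D₂formula hω hX hY hf hg, contract_smul_left,
    contract_schouten_isHam hω hY hg.smooth hg.deg hX.isHam_extD hf.extD,
    hY.lieD_eq hω hg.deg hf.extD, extD_extD hf.smooth, contract_zero,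
    hX.contract_extD_comm hω hY hf hg, extD_smul, sub_add_cancel, sub_mul, one_mul, sgn_sub,
    mul_comm b a]
  rcases mul_self_eq_one_iff.1 (sgn_mul_self a) with h1 | h1 <;> rw [h1] <;> module

theorem isHam_lieD (hω : IsNPlectic n ω) {a b : ℤ} {X Y : MVField E M} {f g : FormField E M}
    (hX : IsSemiHam ω X f) (hf : HomHam n ω a f) (hY : IsHam ω Y g) (hg : HomHam n ω b g) :
    IsHam ω (sgn ((a - 1) * (b + 1)) • schouten X Y) (lieD X g) := by
  refine ⟨(hX.1.schouten hY.1).smul _, ?_⟩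
  rw [contract_smul_left, contract_schouten_isHam hω hX hf.smooth hf.deg hY hg, smul_neg, smul_smul,
    sgn_mul_self, one_smul]

theorem hasDeg_lieD (hω : IsNPlectic n ω) {a b : ℤ} {X : MVField E M} {f g : FormField E M}
    (hX : IsSemiHam ω X f) (hf : HomHam n ω a f) (hg : HomHam n ω b g) :
    HasDeg n (a + b - 1) (lieD X g) := by
  rw [hX.lieD_eq hω hf.deg hg]
  refine (HasDeg.contract_isSemiHam hω hX hf.deg hg.deg hg.isContraction).extD.sub
    (HasDeg.smul _ ?_)
  have := HasDeg.contract_isSemiHam hω hX hf.deg hg.extD.deg hg.extD.isContraction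
  rwa [← add_sub_assoc] at this

theorem smooth_lieD (hω : IsNPlectic n ω) {a b : ℤ} {X : MVField E M} {f g : FormField E M}
    (hX : IsSemiHam ω X f) (hf : HomHam n ω a f) (hg : HomHam n ω b g) :
    SmoothForm (lieD X g) := by
  rw [hX.lieD_eq hω hf.deg hg]
  exact (hg.smooth.contract hX.1).extD.sub ((hg.smooth.extD.contract hX.1).smul _)

theorem homHam_D₂formula (hω : IsNPlectic n ω) {a b : ℤ} {X Y : MVField E M}
    {f g : FormField E M} (hX : IsSemiHam ω X f) (hY : IsSemiHam ω Y g) (hf : HomHam n ω a f)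
    (hg : HomHam n ω b g) : HomHam n ω (a + b - 1) (D₂formula a b X Y f g) := by
  obtain ⟨V, hV⟩ := hf.mem.2.2
  obtain ⟨W, hW⟩ := hg.mem.2.2
  refine ⟨⟨((smooth_lieD hω hX hf hg).smul _).add ((smooth_lieD hω hY hg hf).smul _),
    ⟨_, isSemiHam_D₂formula hω hX hY hf hg⟩,
    _, ((isHam_lieD hω hX hf hW hg).smul _).add ((isHam_lieD hω hY hg hV hf).smul _)⟩,
    ((hasDeg_lieD hω hX hf hg).smul _).add (HasDeg.smul _ ?_)⟩
  have := hasDeg_lieD hω hY hg hf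
  rwa [add_comm b a] at this

theorem D₂formula_congr (hω : IsNPlectic n ω) {a b : ℤ} {X Y X' Y' : MVField E M}
    {f g : FormField E M} (hX : IsSemiHam ω X f) (hY : IsSemiHam ω Y g)
    (hX' : IsSemiHam ω X' f) (hY' : IsSemiHam ω Y' g) (hf : HomHam n ω a f)
    (hg : HomHam n ω b g) : D₂formula a b X Y f g = D₂formula a b X' Y' f g := by
  rw [D₂formula_eq hω hX hY hf hg, D₂formula_eq hω hX' hY' hf hg,
    hX.contract_congr hω hX' hg.isContraction, hY.contract_congr hω hY' hf.isContraction,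
    hX.contract_congr hω hX' hg.extD.isContraction]

theorem D₂formula_zero_left (hω : IsNPlectic n ω) {a b : ℤ} {X : MVField E M} (Y : MVField E M)
    {g : FormField E M} (hX : IsSemiHam ω X 0) (hg : HomHam n ω b g) :
    D₂formula a b X Y 0 g = 0 := by
  rw [D₂formula, lieD_eq_zero_of_contract_eq_zero hω (by rw [hX.2, extD_zero, neg_zero]) hg,
    lieD_zero_right, smul_zero, smul_zero, add_zero]

theorem D₂formula_zero_right (hω : IsNPlectic n ω) {a b : ℤ} (X : MVField E M) {Y : MVField E M}
    {f : FormField E M} (hY : IsSemiHam ω Y 0) (hf : HomHam n ω a f) :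
    D₂formula a b X Y f 0 = 0 := by
  rw [D₂formula, lieD_eq_zero_of_contract_eq_zero hω (by rw [hY.2, extD_zero, neg_zero]) hf,
    lieD_zero_right, smul_zero, smul_zero, add_zero]

theorem form_apply_eq_zero_of_finrank_lt (f : FormField E M) (x : M) {k : ℕ}
    (hk : Module.finrank ℝ E < k) : f x k = 0 := by
  ext v
  refine (f x k).toAlternatingMap.map_linearDependent v fun h => ?_
  have h' : LinearIndependent ℝ (M := E) v := h
  have := h'.fintype_card_le_finrank
  rw [Fintype.card_fin] at this
  lia

/-- The sums defining `D₂` and `D₃` stop at the dimension; nothing is lost, since forms of larger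
tensor degree vanish. -/
theorem HasDeg.exists_or_eq_zero {a : ℤ} {f : FormField E M} (hf : HasDeg n a f) :
    (∃ k < Module.finrank ℝ E + 1, (n : ℤ) - (k : ℕ) = a) ∨ f = 0 := by
  by_cases h : ∃ k < Module.finrank ℝ E + 1, (n : ℤ) - (k : ℕ) = a
  · exact Or.inl h
  · refine Or.inr (funext fun x => funext fun k => ?_)
    by_cases hk : k < Module.finrank ℝ E + 1
    · exact hf x k fun h' => h ⟨k, hk, h'⟩
    · exact form_apply_eq_zero_of_finrank_lt f x (by lia)

theorem component_zero (k : ℕ) : component k (0 : FormField E M) = 0 := by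
  simpa using component_smul k 0 (0 : FormField E M)

/-- On homogeneous forms `D₂` is given by its formula. -/
theorem D₂_eq (hω : IsNPlectic n ω) {a b : ℤ} {X Y : MVField E M} {f g : FormField E M}
    (hX : IsSemiHam ω X f) (hY : IsSemiHam ω Y g) (hf : HomHam n ω a f) (hg : HomHam n ω b g) :
    D₂ n ω f g = D₂formula a b X Y f g := by
  -- The field chosen for a zero component may be nonzero, but it annihilates `ω`, so its Lie
  -- derivatives of Hamiltonian forms vanish.
  have hl : ∀ (k : ℕ) (l : ℕ), component k f = 0 →
      D₂formula (n - k) (n - l) (someSemiHam ω (component k f)) (someSemiHam ω (component l g))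
        (component k f) (component l g) = 0 := fun k l h => by
    rw [h]
    exact D₂formula_zero_left hω _ (isSemiHam_someSemiHam (zero_mem _))
      (homHam_component hω l hg.mem)
  have hr : ∀ (k : ℕ) (l : ℕ), component l g = 0 →
      D₂formula (n - k) (n - l) (someSemiHam ω (component k f)) (someSemiHam ω (component l g))
        (component k f) (component l g) = 0 := fun k l h => by
    rw [h]
    exact D₂formula_zero_right hω _ (isSemiHam_someSemiHam (zero_mem _))
      (homHam_component hω k hf.mem)
  unfold D₂
  rcases hf.deg.exists_or_eq_zero with ⟨k, hk, hka⟩ | h0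
  · rcases hg.deg.exists_or_eq_zero with ⟨l, hl', hlb⟩ | h0
    · rw [Finset.sum_eq_single_of_mem k (Finset.mem_range.2 hk), Finset.sum_eq_single_of_mem l
        (Finset.mem_range.2 hl'), component_eq_self hf.deg hka, component_eq_self hg.deg hlb, hka,
        hlb]
      · exact D₂formula_congr hω (isSemiHam_someSemiHam hf.mem) (isSemiHam_someSemiHam hg.mem)
          hX hY hf hg
      · exact fun l' _ hne => hr _ _ (component_eq_zero hg.deg (by lia))
      · exact fun k' _ hne => Finset.sum_eq_zero fun l' _ =>
          hl _ _ (component_eq_zero hf.deg (by lia))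
    · subst h0
      rw [D₂formula_zero_right hω X hY hf]
      exact Finset.sum_eq_zero fun k' _ => Finset.sum_eq_zero fun l' _ => hr _ _ (component_zero _)
  · subst h0
    rw [D₂formula_zero_left hω Y hX hg]
    exact Finset.sum_eq_zero fun k' _ => Finset.sum_eq_zero fun l' _ => hl _ _ (component_zero _)

theorem HomHam.exists_isSemiHam {a : ℤ} {f : FormField E M} (hf : HomHam n ω a f) :
    ∃ X, IsSemiHam ω X f := hf.mem.2.1

theorem homHam_D₂ (hω : IsNPlectic n ω) {a b : ℤ} {f g : FormField E M} (hf : HomHam n ω a f)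
    (hg : HomHam n ω b g) : HomHam n ω (a + b - 1) (D₂ n ω f g) := by
  obtain ⟨X, hX⟩ := hf.exists_isSemiHam
  obtain ⟨Y, hY⟩ := hg.exists_isSemiHam
  rw [D₂_eq hω hX hY hf hg]
  exact homHam_D₂formula hω hX hY hf hg

theorem isSemiHam_D₂ (hω : IsNPlectic n ω) {a b : ℤ} {X Y : MVField E M}
    {f g : FormField E M} (hX : IsSemiHam ω X f) (hY : IsSemiHam ω Y g) (hf : HomHam n ω a f)
    (hg : HomHam n ω b g) : IsSemiHam ω ((-2 * sgn a) • schouten Y X) (D₂ n ω f g) := by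
  rw [D₂_eq hω hX hY hf hg]
  exact isSemiHam_D₂formula hω hX hY hf hg

theorem extD_D₂ (hω : IsNPlectic n ω) {a b : ℤ} {X : MVField E M} {f g : FormField E M}
    (hX : IsSemiHam ω X f) (hf : HomHam n ω a f) (hg : HomHam n ω b g) :
    extD (D₂ n ω f g) = (-2 : ℝ) • extD (contract X (extD g)) := by
  obtain ⟨Y, hY⟩ := hg.exists_isSemiHam
  rw [D₂_eq hω hX hY hf hg, extD_D₂formula hω hX hY hf hg]

theorem D₂_symm (hω : IsNPlectic n ω) {a b : ℤ} {f g : FormField E M} (hf : HomHam n ω a f)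
    (hg : HomHam n ω b g) : D₂ n ω f g = sgn (a * b) • D₂ n ω g f := by
  obtain ⟨X, hX⟩ := hf.exists_isSemiHam
  obtain ⟨Y, hY⟩ := hg.exists_isSemiHam
  rw [D₂_eq hω hX hY hf hg, D₂_eq hω hY hX hg hf, D₂formula, D₂formula, mul_comm b a]
  rcases mul_self_eq_one_iff.1 (sgn_mul_self (a * b)) with h | h <;> rw [h] <;> module

theorem D₂_linear_left (hω : IsNPlectic n ω) {a b : ℤ} {f f' g : FormField E M} (c : ℝ)
    (hf : HomHam n ω a f) (hf' : HomHam n ω a f') (hg : HomHam n ω b g) :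
    D₂ n ω (c • f + f') g = c • D₂ n ω f g + D₂ n ω f' g := by
  obtain ⟨X, hX⟩ := hf.exists_isSemiHam
  obtain ⟨X', hX'⟩ := hf'.exists_isSemiHam
  obtain ⟨Y, hY⟩ := hg.exists_isSemiHam
  have hcX := (hX.smul c).add (hf.smooth.smul c) hf'.smooth hX'
  rw [D₂_eq hω hX hY hf hg, D₂_eq hω hX' hY hf' hg, D₂_eq hω hcX hY ((hf.smul c).add hf') hg,
    D₂formula_eq hω hX hY hf hg, D₂formula_eq hω hX' hY hf' hg,
    D₂formula_eq hω hcX hY ((hf.smul c).add hf') hg, contract_add_left, contract_smul_left,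
    contract_add_left, contract_smul_left, contract_add, contract_smul,
    extD_add ((hg.smooth.contract hX.1).smul c) (hg.smooth.contract hX'.1),
    extD_add ((hf.smooth.contract hY.1).smul c) (hf'.smooth.contract hY.1), extD_smul, extD_smul]
  module

variable (n ω) in
/-- The contraction of `h` along a semi-Hamiltonian multivector field associated to
`D₂(f, g)`. -/
def triple (f g h : FormField E M) : FormField E M := contract (someSemiHam ω (D₂ n ω f g)) h

theorem triple_eq (hω : IsNPlectic n ω) {a b c : ℤ} {f g h : FormField E M}
    (hf : HomHam n ω a f) (hg : HomHam n ω b g) (hh : HomHam n ω c h) {Z : MVField E M}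
    (hZ : IsSemiHam ω Z (D₂ n ω f g)) : triple n ω f g h = contract Z h :=
  (isSemiHam_someSemiHam (homHam_D₂ hω hf hg).mem).contract_congr hω hZ hh.isContraction

/-- The chosen fields need not depend linearly on the forms. However, a linear combination of
associated fields is again associated, and the contraction does not see the choice. -/
theorem triple_linear_left (hω : IsNPlectic n ω) {a b c : ℤ} {f f' g h : FormField E M} (t : ℝ)
    (hf : HomHam n ω a f) (hf' : HomHam n ω a f') (hg : HomHam n ω b g) (hh : HomHam n ω c h) :
    triple n ω (t • f + f') g h = t • triple n ω f g h + triple n ω f' g h := by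
  have hZ := isSemiHam_someSemiHam (homHam_D₂ hω hf hg).mem
  have hZ' := isSemiHam_someSemiHam (homHam_D₂ hω hf' hg).mem
  have hs := (hZ.smul t).add ((homHam_D₂ hω hf hg).smooth.smul t) (homHam_D₂ hω hf' hg).smooth hZ'
  rw [← D₂_linear_left hω t hf hf' hg] at hs
  rw [triple_eq hω ((hf.smul t).add hf') hg hh hs, contract_add_left, contract_smul_left]
  rfl

theorem triple_symm (hω : IsNPlectic n ω) {a b c : ℤ} {f g h : FormField E M}
    (hf : HomHam n ω a f) (hg : HomHam n ω b g) (hh : HomHam n ω c h) :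
    triple n ω f g h = sgn (a * b) • triple n ω g f h := by
  have hZ := (isSemiHam_someSemiHam (homHam_D₂ hω hg hf).mem).smul (sgn (a * b))
  rw [← D₂_symm hω hf hg] at hZ
  rw [triple_eq hω hf hg hh hZ, contract_smul_left]; rfl

theorem triple_linear_mid (hω : IsNPlectic n ω) {a b c : ℤ} {f g g' h : FormField E M} (t : ℝ)
    (hf : HomHam n ω a f) (hg : HomHam n ω b g) (hg' : HomHam n ω b g') (hh : HomHam n ω c h) :
    triple n ω f (t • g + g') h = t • triple n ω f g h + triple n ω f g' h := by
  rw [triple_symm hω hf ((hg.smul t).add hg') hh, triple_symm hω hf hg hh, triple_symm hω hf hg' hh,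
    triple_linear_left hω t hg hg' hf hh]
  module

theorem triple_linear_right {f g : FormField E M} (t : ℝ) (h h' : FormField E M) :
    triple n ω f g (t • h + h') = t • triple n ω f g h + triple n ω f g h' := by
  rw [triple, contract_add, contract_smul]; rfl

theorem homHam_triple (hω : IsNPlectic n ω) {a b c : ℤ} {f g h : FormField E M}
    (hf : HomHam n ω a f) (hg : HomHam n ω b g) (hh : HomHam n ω c h) :
    HomHam n ω (a + b + c - 1) (triple n ω f g h) := by
  have hD := homHam_D₂ hω hf hg
  have hZ := isSemiHam_someSemiHam hD.mem
  unfold triple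
  set Z := someSemiHam ω (D₂ n ω f g)
  obtain ⟨X, hX⟩ := hh.exists_isSemiHam
  obtain ⟨Y, hY⟩ := hh.mem.2.2
  -- Since `d i_Z h = L_Z h + e(D₂) i_Z dh`, the bracket `[Z, Y]` accounts for the Lie derivative
  -- and `X ∧ Z` for the other term. The form `i_Z h` itself comes from `Y ∧ Z`, as `i_(Y ∧ Z) = i_Z
  -- i_Y`.
  refine ⟨⟨hh.smooth.contract hZ.1, ⟨sgn ((a + b - 1 - 1) * (c + 1)) • schouten Z Y
    + sgn (a + b - 1) • (X * Z), ((hZ.1.schouten hY.1).smul _).add ((hX.1.mul hZ.1).smul _), ?_⟩,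
    Y * Z, hY.1.mul hZ.1, ?_⟩, ?_⟩
  · rw [contract_add_left, (isHam_lieD hω hZ hD hY hh).2, hZ.lieD_eq hω hD.deg hh,
      contract_smul_left, contract_mul, hX.2, contract_neg]
    module
  · rw [contract_mul, hY.2, contract_neg]
  · have := HasDeg.contract_isSemiHam hω hZ hD.deg hh.deg hh.isContraction
    rwa [show a + b - 1 + c = a + b + c - 1 by ring] at this

end Brackets

/-! ### Shuffles and Koszul signs for three arguments. -/

section Shuffles

/-- The summands belong to the orders `(0,1,2)`, `(0,2,1)` and `(1,2,0)`. -/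
theorem sum_shuffles_two_one {A : Type*} [AddCommMonoid A] (F : Equiv.Perm (Fin 3) → A) :
    ∑ s ∈ shuffles 2 1, F s = F 1 + F (Equiv.swap 1 2) + F (finRotate 3) := by
  have h : shuffles 2 1 = {1, Equiv.swap 1 2, finRotate 3} := by decide
  rw [h, Finset.sum_insert (by decide), Finset.sum_insert (by decide), Finset.sum_singleton,
    add_assoc]

/-- The summands belong to the orders `(0,1,2)`, `(1,0,2)` and `(2,0,1)`. -/
theorem sum_shuffles_one_two {A : Type*} [AddCommMonoid A] (F : Equiv.Perm (Fin 3) → A) :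
    ∑ s ∈ shuffles 1 2, F s = F 1 + F (Equiv.swap 0 1) + F (finRotate 3).symm := by
  have h : shuffles 1 2 = {1, Equiv.swap 0 1, (finRotate 3).symm} := by decide
  rw [h, Finset.sum_insert (by decide), Finset.sum_insert (by decide), Finset.sum_singleton,
    add_assoc]

theorem koszul_three (s : Equiv.Perm (Fin 3)) (a : Fin 3 → ℤ) :
    koszul s a = (if s 1 < s 0 then sgn (a (s 0) * a (s 1)) else 1)
      * (if s 2 < s 0 then sgn (a (s 0) * a (s 2)) else 1)
      * (if s 2 < s 1 then sgn (a (s 1) * a (s 2)) else 1) := by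
  simp [koszul, Fin.prod_univ_three]

theorem koszul_one (a : Fin 3 → ℤ) : koszul 1 a = 1 := by
  rw [koszul_three, if_neg (by decide), if_neg (by decide), if_neg (by decide), one_mul, one_mul]

theorem koszul_swap_zero_one (a : Fin 3 → ℤ) : koszul (Equiv.swap 0 1) a = sgn (a 0 * a 1) := by
  rw [koszul_three, if_pos (by decide), if_neg (by decide), if_neg (by decide), mul_one, mul_one,
    mul_comm (a 0)]
  rfl

theorem koszul_swap_one_two (a : Fin 3 → ℤ) : koszul (Equiv.swap 1 2) a = sgn (a 1 * a 2) := by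
  rw [koszul_three, if_neg (by decide), if_neg (by decide), if_pos (by decide), one_mul, one_mul,
    mul_comm (a 1)]
  rfl

theorem koszul_swap_zero_two (a : Fin 3 → ℤ) :
    koszul (Equiv.swap 0 2) a = sgn (a 1 * a 2) * sgn (a 0 * a 2) * sgn (a 0 * a 1) := by
  rw [koszul_three, if_pos (by decide), if_pos (by decide), if_pos (by decide),
    mul_comm (a 0), mul_comm (a 1), mul_comm (a 0)]
  rfl

theorem koszul_finRotate (a : Fin 3 → ℤ) :
    koszul (finRotate 3) a = sgn (a 0 * a 1) * sgn (a 0 * a 2) := by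
  rw [koszul_three, if_neg (by decide), if_pos (by decide), if_pos (by decide), one_mul,
    mul_comm (a 0), mul_comm (a 0)]
  rfl

theorem koszul_finRotate_symm (a : Fin 3 → ℤ) :
    koszul (finRotate 3).symm a = sgn (a 0 * a 2) * sgn (a 1 * a 2) := by
  rw [koszul_three, if_pos (by decide), if_pos (by decide), if_neg (by decide), mul_one,
    mul_comm (a 0), mul_comm (a 1)]
  rfl

theorem perm_fin_three (s : Equiv.Perm (Fin 3)) :
    s = 1 ∨ s = Equiv.swap 0 1 ∨ s = Equiv.swap 1 2 ∨ s = Equiv.swap 0 2 ∨ s = finRotate 3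
      ∨ s = (finRotate 3).symm := by
  revert s; decide

end Shuffles

/-! ### The ternary bracket: trilinearity, degree and graded symmetry. -/

section TernaryBracket

variable {E : Type*} [NormedAddCommGroup E] [NormedSpace ℝ E] [FiniteDimensional ℝ E]
  {M : Type*} [TopologicalSpace M] [ChartedSpace E M] [IsManifold 𝓘(ℝ, E) (⊤ : ℕ∞) M]
  {n : ℕ} {ω : FormField E M}

theorem D₃formula_eq (a : Fin 3 → ℤ) (Z : Fin 3 → Fin 3 → MVField E M) (f : Fin 3 → FormField E M) :
    D₃formula a Z f = (-(1 / 2) : ℝ) • ((sgn (a 0) * sgn (a 1)) • contract (Z 0 1) (f 2)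
      + (sgn (a 1 * a 2) * sgn (a 0) * sgn (a 2)) • contract (Z 0 2) (f 1)
      + (sgn (a 0 * a 1) * sgn (a 0 * a 2) * sgn (a 1) * sgn (a 2)) • contract (Z 1 2) (f 0)) := by
  rw [D₃formula, sum_shuffles_two_one, koszul_one, koszul_swap_one_two, koszul_finRotate, one_mul]
  rfl

variable (n ω) in
/-- The formula for `D₃` in terms of contractions along fields associated to the forms `D₂`. -/
def tripleSum (a b c : ℤ) (f g h : FormField E M) : FormField E M :=
  (-(1 / 2) : ℝ) • ((sgn a * sgn b) • triple n ω f g h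
    + (sgn (b * c) * sgn a * sgn c) • triple n ω f h g
    + (sgn (a * b) * sgn (a * c) * sgn b * sgn c) • triple n ω g h f)

theorem triple_zero_left (hω : IsNPlectic n ω) {b c : ℤ} {g h : FormField E M}
    (hg : HomHam n ω b g) (hh : HomHam n ω c h) : triple n ω 0 g h = 0 := by
  have h' := triple_linear_left hω 1 (homHam_zero n ω 0) (homHam_zero n ω 0) hg hh
  rw [add_zero, smul_zero, one_smul] at h'
  exact left_eq_add.1 h'

theorem triple_zero_mid (hω : IsNPlectic n ω) {a c : ℤ} {f h : FormField E M}
    (hf : HomHam n ω a f) (hh : HomHam n ω c h) : triple n ω f 0 h = 0 := by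
  rw [triple_symm hω hf (homHam_zero n ω 0) hh, triple_zero_left hω hf hh, smul_zero]

theorem triple_zero_right (f g : FormField E M) : triple n ω f g 0 = 0 := contract_zero _

theorem tripleSum_eq_zero (hω : IsNPlectic n ω) {a b c : ℤ} {f g h : FormField E M}
    (hf : HomHam n ω a f) (hg : HomHam n ω b g) (hh : HomHam n ω c h)
    (h0 : f = 0 ∨ g = 0 ∨ h = 0) : tripleSum n ω a b c f g h = 0 := by
  unfold tripleSum
  rcases h0 with rfl | rfl | rfl
  · rw [triple_zero_left hω hg hh, triple_zero_left hω hh hg, triple_zero_right]; module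
  · rw [triple_zero_mid hω hf hh, triple_zero_left hω hh hf, triple_zero_right]; module
  · rw [triple_zero_mid hω hf hg, triple_zero_mid hω hg hf, triple_zero_right]; module

theorem homHam_tripleSum (hω : IsNPlectic n ω) {a b c : ℤ} {f g h : FormField E M}
    (hf : HomHam n ω a f) (hg : HomHam n ω b g) (hh : HomHam n ω c h) :
    HomHam n ω (a + b + c - 1) (tripleSum n ω a b c f g h) := by
  have h1 := homHam_triple hω hf hg hh
  have h2 := homHam_triple hω hf hh hg
  have h3 := homHam_triple hω hg hh hf
  rw [show a + c + b - 1 = a + b + c - 1 by ring] at h2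
  rw [show b + c + a - 1 = a + b + c - 1 by ring] at h3
  exact (((h1.smul _).add (h2.smul _)).add (h3.smul _)).smul _

theorem D₃_eq_sum_tripleSum (f : Fin 3 → FormField E M) :
    D₃ n ω f = ∑ k : Fin 3 → Fin (Module.finrank ℝ E + 1),
      tripleSum n ω (n - (k 0 : ℕ)) (n - (k 1 : ℕ)) (n - (k 2 : ℕ)) (component (k 0) (f 0))
        (component (k 1) (f 1)) (component (k 2) (f 2)) :=
  Finset.sum_congr rfl fun _ _ => D₃formula_eq _ _ _

theorem D₃_mem_hamForms (hω : IsNPlectic n ω) {f : Fin 3 → FormField E M}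
    (hf : ∀ i, f i ∈ hamForms ω) : D₃ n ω f ∈ hamForms ω := by
  rw [D₃_eq_sum_tripleSum]
  exact sum_mem fun k _ => (homHam_tripleSum hω (homHam_component hω _ (hf 0))
    (homHam_component hω _ (hf 1)) (homHam_component hω _ (hf 2))).mem

theorem D₃_update (hω : IsNPlectic n ω) {f : Fin 3 → FormField E M} (hf : ∀ i, f i ∈ hamForms ω)
    (i : Fin 3) (t : ℝ) {g h : FormField E M} (hg : g ∈ hamForms ω) (hh : h ∈ hamForms ω) :
    D₃ n ω (Function.update f i (t • g + h))
      = t • D₃ n ω (Function.update f i g) + D₃ n ω (Function.update f i h) := by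
  rw [D₃_eq_sum_tripleSum, D₃_eq_sum_tripleSum, D₃_eq_sum_tripleSum, Finset.smul_sum,
    ← Finset.sum_add_distrib]
  refine Finset.sum_congr rfl fun k _ => ?_
  have Hf := fun i j => homHam_component hω (k j) (hf i)
  have Hg := fun j => homHam_component hω (k j) hg
  have Hh := fun j => homHam_component hω (k j) hh
  fin_cases i
  · simp only [Function.update_apply, Fin.reduceEq, if_true, if_false, Fin.zero_eta,
      component_add, component_smul, tripleSum]
    rw [triple_linear_left hω t (Hg 0) (Hh 0) (Hf 1 1) (Hf 2 2),
      triple_linear_left hω t (Hg 0) (Hh 0) (Hf 2 2) (Hf 1 1), triple_linear_right]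
    module
  · simp only [Function.update_apply, Fin.reduceEq, if_true, if_false, Fin.mk_one,
      component_add, component_smul, tripleSum]
    rw [triple_linear_mid hω t (Hf 0 0) (Hg 1) (Hh 1) (Hf 2 2),
      triple_linear_left hω t (Hg 1) (Hh 1) (Hf 2 2) (Hf 0 0), triple_linear_right]
    module
  · simp only [Function.update_apply, Fin.reduceEq, if_true, if_false, Fin.reduceFinMk,
      component_add, component_smul, tripleSum]
    rw [triple_linear_mid hω t (Hf 0 0) (Hg 2) (Hh 2) (Hf 1 1),
      triple_linear_mid hω t (Hf 1 1) (Hg 2) (Hh 2) (Hf 0 0), triple_linear_right]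
    module

/-- On homogeneous forms `D₃` is given by its formula. -/
theorem D₃_eq (hω : IsNPlectic n ω) {a : Fin 3 → ℤ} {f : Fin 3 → FormField E M}
    (hf : ∀ i, HomHam n ω (a i) (f i)) :
    D₃ n ω f = tripleSum n ω (a 0) (a 1) (a 2) (f 0) (f 1) (f 2) := by
  rw [D₃_eq_sum_tripleSum]
  have hz : ∀ k : Fin 3 → Fin (Module.finrank ℝ E + 1), (∃ i, component (k i) (f i) = 0) →
      tripleSum n ω (n - (k 0 : ℕ)) (n - (k 1 : ℕ)) (n - (k 2 : ℕ)) (component (k 0) (f 0))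
        (component (k 1) (f 1)) (component (k 2) (f 2)) = 0 := by
    rintro k ⟨i, hi⟩
    refine tripleSum_eq_zero hω (homHam_component hω _ (hf 0).mem)
      (homHam_component hω _ (hf 1).mem) (homHam_component hω _ (hf 2).mem) ?_
    fin_cases i
    · exact Or.inl hi
    · exact Or.inr (Or.inl hi)
    · exact Or.inr (Or.inr hi)
  by_cases h0 : ∃ i, f i = 0
  · obtain ⟨i, hi⟩ := h0
    rw [Finset.sum_eq_zero fun k _ => hz k ⟨i, by rw [hi, component_zero]⟩]
    refine (tripleSum_eq_zero hω (hf 0) (hf 1) (hf 2) ?_).symm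
    fin_cases i
    · exact Or.inl hi
    · exact Or.inr (Or.inl hi)
    · exact Or.inr (Or.inr hi)
  · push Not at h0
    have hk : ∀ i, ∃ k : Fin (Module.finrank ℝ E + 1), (n : ℤ) - (k : ℕ) = a i := fun i => by
      rcases (hf i).deg.exists_or_eq_zero with ⟨k, hk, hka⟩ | h
      · exact ⟨⟨k, hk⟩, hka⟩
      · exact absurd h (h0 i)
    choose k hk using hk
    rw [Finset.sum_eq_single_of_mem k (Finset.mem_univ _), component_eq_self (hf 0).deg (hk 0),
      component_eq_self (hf 1).deg (hk 1), component_eq_self (hf 2).deg (hk 2), hk, hk, hk]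
    intro k' _ hne
    obtain ⟨i, hi⟩ := Function.ne_iff.1 hne
    refine hz k' ⟨i, component_eq_zero (hf i).deg fun h => hi ?_⟩
    have := (hk i).trans h.symm
    exact Fin.ext (by lia)

/-- The symmetry of `D₂` handles the term in which `f` and `g` are bracketed; the other two terms
trade places. -/
theorem tripleSum_swap_left (hω : IsNPlectic n ω) {a b c : ℤ} {f g h : FormField E M}
    (hf : HomHam n ω a f) (hg : HomHam n ω b g) (hh : HomHam n ω c h) :
    tripleSum n ω a b c f g h = sgn (a * b) • tripleSum n ω b a c g f h := by
  unfold tripleSum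
  rw [triple_symm hω hf hg hh, mul_comm b a]
  rcases mul_self_eq_one_iff.1 (sgn_mul_self (a * b)) with h' | h' <;> rw [h'] <;> module

theorem tripleSum_swap_right (hω : IsNPlectic n ω) {a b c : ℤ} {f g h : FormField E M}
    (hf : HomHam n ω a f) (hg : HomHam n ω b g) (hh : HomHam n ω c h) :
    tripleSum n ω a b c f g h = sgn (b * c) • tripleSum n ω a c b f h g := by
  unfold tripleSum
  rw [triple_symm hω hg hh hf, mul_comm c b]
  rcases mul_self_eq_one_iff.1 (sgn_mul_self (b * c)) with h' | h' <;> rw [h'] <;> module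

/-- Graded symmetry of `D₃`. -/
theorem D₃_perm (hω : IsNPlectic n ω) {a : Fin 3 → ℤ} {f : Fin 3 → FormField E M}
    (hf : ∀ i, HomHam n ω (a i) (f i)) (s : Equiv.Perm (Fin 3)) :
    D₃ n ω f = koszul s a • D₃ n ω (fun i => f (s i)) := by
  rw [D₃_eq hω hf, D₃_eq hω (a := fun i => a (s i)) fun i => hf (s i)]
  have h0 := hf 0
  have h1 := hf 1
  have h2 := hf 2
  -- Each permutation is a product of the two adjacent transpositions, for which the symmetry is
  -- already known.
  rcases perm_fin_three s with rfl | rfl | rfl | rfl | rfl | rfl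
  · rw [koszul_one, one_smul]; rfl
  · rw [koszul_swap_zero_one, tripleSum_swap_left hω h0 h1 h2]; rfl
  · rw [koszul_swap_one_two, tripleSum_swap_right hω h0 h1 h2]; rfl
  · rw [koszul_swap_zero_two, tripleSum_swap_right hω h0 h1 h2, tripleSum_swap_left hω h0 h2 h1,
      tripleSum_swap_right hω h2 h0 h1, smul_smul, smul_smul]; rfl
  · rw [koszul_finRotate, tripleSum_swap_left hω h0 h1 h2, tripleSum_swap_right hω h1 h0 h2,
      smul_smul]; rfl
  · rw [koszul_finRotate_symm, tripleSum_swap_right hω h0 h1 h2, tripleSum_swap_left hω h0 h2 h1,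
      smul_smul, mul_comm (sgn (a 0 * a 2))]; rfl

end TernaryBracket

/-! ### Terms of the Jacobi equation and the algebra behind it. -/

section Jacobi

variable {E : Type*} [NormedAddCommGroup E] [NormedSpace ℝ E] [FiniteDimensional ℝ E]
  {M : Type*} [TopologicalSpace M] [ChartedSpace E M] [IsManifold 𝓘(ℝ, E) (⊤ : ℕ∞) M]
  {n : ℕ} {ω : FormField E M}

theorem HasParity.lieD_eq {r : ℤ} {X : MVField E M} (hX : HasParity r X) (α : FormField E M) :
    lieD X α = extD (contract X α) - sgn r • contract X (extD α) := by
  rw [lieD, show (fun x => CliffordAlgebra.involute (X x)) = sgn r • X from funext hX,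
    contract_smul_left]

theorem HomHam.D₁ {a : ℤ} {f : FormField E M} (hf : HomHam n ω a f) :
    HomHam n ω (a - 1) (D₁ f) := ⟨neg_mem hf.extD.mem, hf.extD.deg.neg⟩

theorem extD_D₁ {a : ℤ} {f : FormField E M} (hf : HomHam n ω a f) : extD (D₁ f) = 0 := by
  rw [NPlectic.D₁, extD_neg, extD_extD hf.smooth, neg_zero]

/-- `D₁ f` is closed, so the zero field is associated to it and `D₂(D₁ f, g)` is closed; then zero
is an admissible field for the latter too. -/
theorem triple_D₁_left (hω : IsNPlectic n ω) {a b c : ℤ} {f g h : FormField E M}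
    (hf : HomHam n ω a f) (hg : HomHam n ω b g) (hh : HomHam n ω c h) :
    triple n ω (D₁ f) g h = 0 := by
  have hZ : IsSemiHam ω (0 : MVField E M) (D₂ n ω (D₁ f) g) := by
    refine isSemiHam_zero_of_extD_eq_zero ?_
    rw [extD_D₂ hω (isSemiHam_zero_of_extD_eq_zero (extD_D₁ hf)) hf.D₁ hg, contract_zero_left,
      extD_zero, smul_zero]
  rw [triple_eq hω hf.D₁ hg hh hZ, contract_zero_left]

/-- Only the summand that leaves `D₁ f` outside the inner bracket survives. The signs come from the
lowered degree `a - 1`. -/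
theorem D₃_D₁ (hω : IsNPlectic n ω) {a b c : ℤ} {f g h : FormField E M}
    (hf : HomHam n ω a f) (hg : HomHam n ω b g) (hh : HomHam n ω c h) :
    D₃ n ω ![D₁ f, g, h] = (1 / 2 * (sgn (a * b) * sgn (a * c))) • triple n ω g h (extD f) := by
  rw [D₃_eq hω (a := ![a - 1, b, c]) (by
    intro i
    fin_cases i
    exacts [hf.D₁, hg, hh])]
  change tripleSum n ω (a - 1) b c (D₁ f) g h = _
  have h1 : triple n ω g h (D₁ f) = -triple n ω g h (extD f) := contract_neg _ _
  rw [tripleSum, triple_D₁_left hω hf hg hh, triple_D₁_left hω hf hh hg, h1]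
  simp only [sub_mul, one_mul, sgn_sub]
  rcases mul_self_eq_one_iff.1 (sgn_mul_self b) with h2 | h2 <;>
  rcases mul_self_eq_one_iff.1 (sgn_mul_self c) with h3 | h3 <;>
  rw [h2, h3] <;> module

theorem D₂_D₂ (hω : IsNPlectic n ω) {a b c : ℤ} {f g h : FormField E M} {X Y W : MVField E M}
    (hX : IsSemiHam ω X f) (hY : IsSemiHam ω Y g) (hW : IsSemiHam ω W h)
    (hf : HomHam n ω a f) (hg : HomHam n ω b g) (hh : HomHam n ω c h) :
    D₂ n ω (D₂ n ω f g) h = -(sgn a * sgn b) • extD (triple n ω f g h)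
      - (2 : ℝ) • triple n ω f g (extD h)
      + (sgn (a * c) * sgn (b * c)) • (sgn a • extD (contract W (extD (contract X g)))
        + (sgn (a * b) * sgn b) • extD (contract W (extD (contract Y f)))
        - (2 : ℝ) • extD (contract W (contract X (extD g)))) := by
  have hD := homHam_D₂ hω hf hg
  have hZ := isSemiHam_someSemiHam hD.mem
  have h1 := (hg.smooth.contract hX.1).extD.contract hW.1
  have h2 := (hf.smooth.contract hY.1).extD.contract hW.1
  have h3 := (hg.smooth.extD.contract hX.1).contract hW.1
  have h4 : extD (contract W (D₂ n ω f g)) = sgn a • extD (contract W (extD (contract X g)))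
        + (sgn (a * b) * sgn b) • extD (contract W (extD (contract Y f)))
        - (2 : ℝ) • extD (contract W (contract X (extD g))) := by
    rw [D₂_eq hω hX hY hf hg, D₂formula_eq hω hX hY hf hg, contract_sub, contract_add,
      contract_smul, contract_smul, contract_smul,
      extD_sub ((h1.smul _).add (h2.smul _)) (h3.smul _), extD_add (h1.smul _) (h2.smul _),
      extD_smul, extD_smul, extD_smul]
  rw [D₂_eq hω hZ hW hD hh, D₂formula_eq hω hZ hW hD hh, h4, sub_mul, add_mul, one_mul, sgn_sub,
    sgn_sub, sgn_add, sgn_add, sgn_one]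
  rw [triple, triple]
  rcases mul_self_eq_one_iff.1 (sgn_mul_self c) with h5 | h5 <;> rw [h5] <;> module

/-- Contraction along `X_{D₂}(f, g)` in terms of contractions along `X_f`, `X_g`. -/
theorem triple_eq_cartan (hω : IsNPlectic n ω) {a b c : ℤ} {f g h : FormField E M}
    {X Y : MVField E M} (hX : IsSemiHam ω X f) (hY : IsSemiHam ω Y g) (hXa : HasParity a X)
    (hYb : HasParity b Y) (hf : HomHam n ω a f) (hg : HomHam n ω b g) (hh : HomHam n ω c h) :
    triple n ω f g h = (-2 * sgn a) • (sgn ((b - 1) * a) •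
        (extD (contract Y (contract X h)) - sgn b • contract Y (extD (contract X h)))
      - contract X (extD (contract Y h)) + sgn b • contract X (contract Y (extD h))) := by
  rw [triple_eq hω hf hg hh (isSemiHam_D₂ hω hX hY hf hg), contract_smul_left,
    contract_schouten hY.1 hX.1 hh.smooth hYb hXa, hYb.lieD_eq, hYb.lieD_eq, contract_sub,
    contract_smul]
  module

theorem extD_triple (hω : IsNPlectic n ω) {a b c : ℤ} {f g h : FormField E M}
    {X Y : MVField E M} (hX : IsSemiHam ω X f) (hY : IsSemiHam ω Y g) (hXa : HasParity a X)
    (hYb : HasParity b Y) (hf : HomHam n ω a f) (hg : HomHam n ω b g) (hh : HomHam n ω c h) :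
    extD (triple n ω f g h) = (-2 * sgn a) •
      (-(sgn ((b - 1) * a) * sgn b) • extD (contract Y (extD (contract X h)))
      - extD (contract X (extD (contract Y h)))
      + sgn b • extD (contract X (contract Y (extD h)))) := by
  have h0 := (hh.smooth.contract hX.1).contract hY.1
  have h1 := (hh.smooth.contract hX.1).extD.contract hY.1
  have h2 := (hh.smooth.contract hY.1).extD.contract hX.1
  have h3 := (hh.smooth.extD.contract hY.1).contract hX.1
  rw [triple_eq_cartan hω hX hY hXa hYb hf hg hh, extD_smul,
    extD_add (((h0.extD.sub (h1.smul _)).smul _).sub h2) (h3.smul _),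
    extD_sub ((h0.extD.sub (h1.smul _)).smul _) h2, extD_smul, extD_sub h0.extD (h1.smul _),
    extD_extD h0, extD_smul, extD_smul]
  module

/-- First evaluation of `i_Z dh`, with `Z` a field of `D₂(f, g)`: symmetry turns it into `± i_W d
D₂(f, g)`, where only the `-2 i_X dg` part of `D₂` contributes. -/
theorem triple_extD (hω : IsNPlectic n ω) {a b c : ℤ} {f g h : FormField E M}
    {X W : MVField E M} (hX : IsSemiHam ω X f) (hW : IsSemiHam ω W h)
    (hf : HomHam n ω a f) (hg : HomHam n ω b g) (hh : HomHam n ω c h) :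
    triple n ω f g (extD h)
      = (-2 * sgn ((a + b - 1) * c)) • contract W (extD (contract X (extD g))) := by
  have hD := homHam_D₂ hω hf hg
  rw [triple, (isSemiHam_someSemiHam hD.mem).contract_extD_comm hω hW hD hh, extD_D₂ hω hX hf hg,
    contract_smul]
  module

/-- Second evaluation, with `Z` the bracket of `Y` and `X` up to a factor. Comparison with
`triple_extD` gives the relation that closes the Jacobi equation. -/
theorem triple_extD_eq_cartan (hω : IsNPlectic n ω) {a b c : ℤ} {f g h : FormField E M}
    {X Y : MVField E M} (hX : IsSemiHam ω X f) (hY : IsSemiHam ω Y g) (hXa : HasParity a X)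
    (hYb : HasParity b Y) (hf : HomHam n ω a f) (hg : HomHam n ω b g) (hh : HomHam n ω c h) :
    triple n ω f g (extD h) = (-2 * sgn a) • (sgn ((b - 1) * a) •
        (extD (contract Y (contract X (extD h))) - sgn b • contract Y (extD (contract X (extD h))))
      - contract X (extD (contract Y (extD h)))) := by
  rw [triple_eq_cartan hω hX hY hXa hYb hf hg hh.extD, extD_extD hh.smooth, contract_zero,
    contract_zero]
  module

/-- The linear algebra behind the strong homotopy Jacobi equation: `P`, `T`, `U` stand for
`d i_i d i_j f_k`, `d i_i i_j d f_k` and `i_i d i_j d f_k`. -/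
theorem jacobi_linear_algebra {A : Type*} [AddCommGroup A] [Module ℝ A] (a : Fin 3 → ℤ)
    (P T U R S B : Fin 3 → Fin 3 → Fin 3 → A)
    (hT : ∀ i j k, T i j k = sgn (a i * a j) • T j i k)
    (hT' : ∀ i j k, T i j k = sgn (a j * a k) • T i k j)
    (hR : ∀ i j k, R i j k = (-2 * sgn (a i)) • (-(sgn ((a j - 1) * a i) * sgn (a j)) • P j i k
      - P i j k + sgn (a j) • T i j k))
    (hS : ∀ i j k, S i j k = (-2 * sgn ((a i + a j - 1) * a k)) • U k i j)
    (hS' : ∀ i j k, S i j k = (-2 * sgn (a i)) • (sgn ((a j - 1) * a i) •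
      (T j i k - sgn (a j) • U j i k) - U i j k))
    (hB : ∀ i j k, B i j k = -(sgn (a i) * sgn (a j)) • R i j k - (2 : ℝ) • S i j k
      + (sgn (a i * a k) * sgn (a j * a k)) • (sgn (a i) • P k i j
        + (sgn (a i * a j) * sgn (a j)) • P k j i - (2 : ℝ) • T k i j)) :
    (1 / 2 : ℝ) • ((sgn (a 0) * sgn (a 1)) • R 0 1 2
        + (sgn (a 1 * a 2) * sgn (a 0) * sgn (a 2)) • R 0 2 1
        + (sgn (a 0 * a 1) * sgn (a 0 * a 2) * sgn (a 1) * sgn (a 2)) • R 1 2 0)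
      + ((1 / 2 * (sgn (a 0 * a 1) * sgn (a 0 * a 2))) • S 1 2 0
        + sgn (a 0 * a 1) • (1 / 2 * (sgn (a 1 * a 0) * sgn (a 1 * a 2))) • S 0 2 1
        + (sgn (a 0 * a 2) * sgn (a 1 * a 2)) •
          (1 / 2 * (sgn (a 2 * a 0) * sgn (a 2 * a 1))) • S 0 1 2)
      + (B 0 1 2 + sgn (a 1 * a 2) • B 0 2 1 + (sgn (a 0 * a 1) * sgn (a 0 * a 2)) • B 1 2 0)
      = 0 := by
  have c10 : a 1 * a 0 = a 0 * a 1 := mul_comm _ _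
  have c20 : a 2 * a 0 = a 0 * a 2 := mul_comm _ _
  have c21 : a 2 * a 1 = a 1 * a 2 := mul_comm _ _
  have t021 := hT' 0 2 1
  have t102 := hT 1 0 2
  have t120 := hT' 1 2 0
  have t201 := hT 2 0 1
  -- The two evaluations of `S 0 1 2` give the one nontrivial relation, between the three `U` terms
  -- and a `T` term.
  have rel := (hS 0 1 2).symm.trans (hS' 0 1 2)
  simp only [hB, hR, hS]
  clear hT hT' hR hS hS' hB
  simp only [sub_mul, add_mul, one_mul, sgn_sub, sgn_add, c10, c20, c21]
    at t021 t102 t120 t201 rel ⊢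
  -- All `T` terms become multiples of `T 0 1 2`.
  rw [t201, t120, t102, t021]
  rw [t102] at rel
  rcases Int.even_or_odd (a 0) with h0 | h0 <;> rcases Int.even_or_odd (a 1) with h1 | h1 <;>
  rcases Int.even_or_odd (a 2) with h2 | h2 <;>
  simp only [h0, h1, h2, sgn_of_even, sgn_of_odd, Even.mul_right, Even.mul_left, Odd.mul]
    at rel ⊢ <;>
  -- Each `S` occurs with weight `1/2` from `D₃(D₁ ·)` and `-2` from `D₂(D₂ ·)`, in total `-3/2`;
  -- the `P` terms cancel without any relation.
  linear_combination (norm := module) (-(3 / 2) : ℝ) • rel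

end Jacobi

/-! ### The Jacobi equation and the fields associated to `D₃`. -/

section AssociatedFields

variable {E : Type*} [NormedAddCommGroup E] [NormedSpace ℝ E] [FiniteDimensional ℝ E]
  {M : Type*} [TopologicalSpace M] [ChartedSpace E M] [IsManifold 𝓘(ℝ, E) (⊤ : ℕ∞) M]
  {n : ℕ} {ω : FormField E M}

theorem extD_D₃ (hω : IsNPlectic n ω) {a : Fin 3 → ℤ} {f : Fin 3 → FormField E M}
    (hf : ∀ i, HomHam n ω (a i) (f i)) :
    extD (D₃ n ω f) = (-(1 / 2) : ℝ) •
      ((sgn (a 0) * sgn (a 1)) • extD (triple n ω (f 0) (f 1) (f 2))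
        + (sgn (a 1 * a 2) * sgn (a 0) * sgn (a 2)) • extD (triple n ω (f 0) (f 2) (f 1))
        + (sgn (a 0 * a 1) * sgn (a 0 * a 2) * sgn (a 1) * sgn (a 2)) •
          extD (triple n ω (f 1) (f 2) (f 0))) := by
  have h1 := (homHam_triple hω (hf 0) (hf 1) (hf 2)).smooth
  have h2 := (homHam_triple hω (hf 0) (hf 2) (hf 1)).smooth
  have h3 := (homHam_triple hω (hf 1) (hf 2) (hf 0)).smooth
  rw [D₃_eq hω hf, tripleSum, extD_smul, extD_add ((h1.smul _).add (h2.smul _)) (h3.smul _),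
    extD_add (h1.smul _) (h2.smul _), extD_smul, extD_smul, extD_smul]

/-- The strong homotopy Jacobi equation in dimension three. -/
theorem strong_homotopy_jacobi (hω : IsNPlectic n ω) {a : Fin 3 → ℤ} {f : Fin 3 → FormField E M}
    (hf : ∀ i, HomHam n ω (a i) (f i)) :
    D₁ (D₃ n ω f)
      + ∑ s ∈ shuffles 1 2, koszul s a • D₃ n ω ![D₁ (f (s 0)), f (s 1), f (s 2)]
      + ∑ s ∈ shuffles 2 1, koszul s a • D₂ n ω (D₂ n ω (f (s 0)) (f (s 1))) (f (s 2)) = 0 := by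
  -- Homogeneous fields are chosen because the Cartan formula needs their parities.
  let X : Fin 3 → MVField E M := fun i => mvPart (a i) (someSemiHam ω (f i))
  have hX : ∀ i, IsSemiHam ω (X i) (f i) := fun i =>
    (isSemiHam_someSemiHam (hf i).mem).mvPart hω (hf i).deg
  have hXp : ∀ i, HasParity (a i) (X i) := fun i => hasParity_mvPart _ _
  have key := jacobi_linear_algebra a
    (fun i j k => extD (contract (X i) (extD (contract (X j) (f k)))))
    (fun i j k => extD (contract (X i) (contract (X j) (extD (f k)))))
    (fun i j k => contract (X i) (extD (contract (X j) (extD (f k)))))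
    (fun i j k => extD (triple n ω (f i) (f j) (f k)))
    (fun i j k => triple n ω (f i) (f j) (extD (f k)))
    (fun i j k => D₂ n ω (D₂ n ω (f i) (f j)) (f k))
    (fun i j k => by
      rw [(hX i).contract_contract_comm hω (hX j) (hf i).deg (hf j).deg (hf k).extD.isContraction,
        extD_smul])
    (fun i j k => by
      rw [(hX j).contract_extD_comm hω (hX k) (hf j) (hf k), contract_smul, extD_smul])
    (fun i j k => extD_triple hω (hX i) (hX j) (hXp i) (hXp j) (hf i) (hf j) (hf k))
    (fun i j k => triple_extD hω (hX i) (hX k) (hf i) (hf j) (hf k))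
    (fun i j k => triple_extD_eq_cartan hω (hX i) (hX j) (hXp i) (hXp j) (hf i) (hf j) (hf k))
    (fun i j k => D₂_D₂ hω (hX i) (hX j) (hX k) (hf i) (hf j) (hf k))
  have h1 : D₁ (D₃ n ω f) = (1 / 2 : ℝ) •
      ((sgn (a 0) * sgn (a 1)) • extD (triple n ω (f 0) (f 1) (f 2))
        + (sgn (a 1 * a 2) * sgn (a 0) * sgn (a 2)) • extD (triple n ω (f 0) (f 2) (f 1))
        + (sgn (a 0 * a 1) * sgn (a 0 * a 2) * sgn (a 1) * sgn (a 2)) •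
          extD (triple n ω (f 1) (f 2) (f 0))) := by
    rw [D₁, extD_D₃ hω hf]
    module
  rw [sum_shuffles_one_two, sum_shuffles_two_one, koszul_one, koszul_swap_zero_one,
    koszul_swap_one_two, koszul_finRotate, koszul_finRotate_symm, D₃_D₁ hω (hf _) (hf _) (hf _),
    D₃_D₁ hω (hf _) (hf _) (hf _), D₃_D₁ hω (hf _) (hf _) (hf _), h1, one_smul, one_smul]
  exact key

theorem isHam_D₃ (hω : IsNPlectic n ω) {a : Fin 3 → ℤ} {f : Fin 3 → FormField E M}
    (hf : ∀ i, HomHam n ω (a i) (f i)) {Y : Fin 3 → MVField E M} {Z : Fin 3 → Fin 3 → MVField E M}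
    (hY : ∀ i, IsHam ω (Y i) (f i))
    (hZ : ∀ i j, i < j → IsSemiHam ω (Z i j) (D₂ n ω (f i) (f j))) :
    IsHam ω
      ((-(1 / 2) : ℝ) • ∑ s ∈ shuffles 2 1,
        (koszul s a * sgn (a (s 0)) * sgn (a (s 1))) • (Y (s 2) * Z (s 0) (s 1)))
      (D₃ n ω f) := by
  have H : ∀ i j k, i < j → IsHam ω (Y k * Z i j) (triple n ω (f i) (f j) (f k)) := by
    intro i j k h
    refine ⟨(hY k).1.mul (hZ i j h).1, ?_⟩
    rw [contract_mul, (hY k).2, contract_neg, triple_eq hω (hf i) (hf j) (hf k) (hZ i j h)]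
  rw [sum_shuffles_two_one, koszul_one, koszul_swap_one_two, koszul_finRotate, one_mul,
    D₃_eq hω hf]
  exact ((((H 0 1 2 (by decide)).smul _).add ((H 0 2 1 (by decide)).smul _)).add
    ((H 1 2 0 (by decide)).smul _)).smul _

/-- `-2 e(f) [Y, X]` is a field of `D₂(f, g)`, so its bracket with `W` contracts `ω` to a multiple
of the Lie derivative of `h`. The degree `a + b - 1` of `D₂(f, g)` gives the plus sign before the
`dh` term. -/
theorem contract_schouten_schouten (hω : IsNPlectic n ω) {a b c : ℤ} {f g h : FormField E M}
    {X Y W : MVField E M} (hX : IsSemiHam ω X f) (hY : IsSemiHam ω Y g) (hW : IsHam ω W h)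
    (hf : HomHam n ω a f) (hg : HomHam n ω b g) (hh : HomHam n ω c h) :
    contract (schouten (schouten Y X) W) ω = (1 / 2 * (sgn (a * c) * sgn (b * c) * sgn b)) •
      (extD (triple n ω f g h) + (sgn a * sgn b) • triple n ω f g (extD h)) := by
  have hZ := isSemiHam_D₂ hω hX hY hf hg
  have hD := homHam_D₂ hω hf hg
  have h1 := contract_schouten_isHam hω hZ hD.smooth hD.deg hW hh
  rw [schouten_smul_left (hY.1.schouten hX.1), contract_smul_left, hZ.lieD_eq hω hD.deg hh,
    ← triple_eq hω hf hg hh hZ, ← triple_eq hω hf hg hh.extD hZ,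
    show (a + b - 1 - 1) * (c + 1) = a * c + b * c + a + b - (c + 1) - (c + 1) by ring] at h1
  simp only [sgn_sub, sgn_add, sgn_one] at h1
  have h2 : contract (schouten (schouten Y X) W) ω
      = (-(1 / 2) * sgn a) • (-2 * sgn a) • contract (schouten (schouten Y X) W) ω := by
    rw [smul_smul, show -(1 / 2) * sgn a * (-2 * sgn a) = sgn a * sgn a by ring, sgn_mul_self,
      one_smul]
  rw [h2, h1]
  rcases mul_self_eq_one_iff.1 (sgn_mul_self a) with h3 | h3 <;>
  rcases mul_self_eq_one_iff.1 (sgn_mul_self c) with h4 | h4 <;> rw [h3, h4] <;> module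

/-- The double brackets yield `-d D₃` together with unwanted terms `triple (f i) (f j) (d (f k))`,
which the wedge products cancel. -/
theorem isSemiHam_D₃ (hω : IsNPlectic n ω) {a : Fin 3 → ℤ} {f : Fin 3 → FormField E M}
    (hf : ∀ i, HomHam n ω (a i) (f i)) {X Y : Fin 3 → MVField E M}
    {Z : Fin 3 → Fin 3 → MVField E M}
    (hX : ∀ i, IsSemiHam ω (X i) (f i)) (hY : ∀ i, IsHam ω (Y i) (f i))
    (hZ : ∀ i j, i < j → IsSemiHam ω (Z i j) (D₂ n ω (f i) (f j))) :
    IsSemiHam ω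
      (∑ s ∈ shuffles 1 2, (koszul s a * sgn (a (s 1))) •
          schouten (schouten (X (s 2)) (X (s 1))) (Y (s 0))
        + (1 / 2 : ℝ) • ∑ s ∈ shuffles 2 1, koszul s a • (X (s 2) * Z (s 0) (s 1)))
      (D₃ n ω f) := by
  have H : ∀ i j k, i < j → contract (X k * Z i j) ω = -triple n ω (f i) (f j) (extD (f k)) :=
    fun i j k h => by
      rw [contract_mul, (hX k).2, contract_neg, triple_eq hω (hf i) (hf j) (hf k).extD (hZ i j h)]
  have K := fun i j k => contract_schouten_schouten hω (hX i) (hX j) (hY k) (hf i) (hf j) (hf k)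
  have HS := fun i j k (h : i < j) => (hX k).1.mul (hZ i j h).1
  have KS := fun i j k => ((hX j).1.schouten (hX i).1).schouten (hY k).1
  rw [sum_shuffles_one_two, sum_shuffles_two_one, koszul_one, koszul_swap_zero_one,
    koszul_swap_one_two, koszul_finRotate, koszul_finRotate_symm]
  change IsSemiHam ω ((1 * sgn (a 1)) • schouten (schouten (X 2) (X 1)) (Y 0)
      + (sgn (a 0 * a 1) * sgn (a 0)) • schouten (schouten (X 2) (X 0)) (Y 1)
      + (sgn (a 0 * a 2) * sgn (a 1 * a 2) * sgn (a 0)) • schouten (schouten (X 1) (X 0)) (Y 2)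
    + (1 / 2 : ℝ) • ((1 : ℝ) • (X 2 * Z 0 1) + sgn (a 1 * a 2) • (X 1 * Z 0 2)
      + (sgn (a 0 * a 1) * sgn (a 0 * a 2)) • (X 0 * Z 1 2))) (D₃ n ω f)
  refine ⟨((((KS 1 2 0).smul _).add ((KS 0 2 1).smul _)).add ((KS 0 1 2).smul _)).add
    (((((HS 0 1 2 (by decide)).smul _).add ((HS 0 2 1 (by decide)).smul _)).add
      ((HS 1 2 0 (by decide)).smul _)).smul _), ?_⟩
  simp only [contract_add_left, contract_smul_left, K, H 0 1 2 (by decide), H 0 2 1 (by decide),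
    H 1 2 0 (by decide), extD_D₃ hω hf, mul_comm (a 1) (a 0), mul_comm (a 2) (a 0),
    mul_comm (a 2) (a 1)]
  rcases mul_self_eq_one_iff.1 (sgn_mul_self (a 0)) with h0 | h0 <;>
  rcases mul_self_eq_one_iff.1 (sgn_mul_self (a 1)) with h1 | h1 <;>
  rcases mul_self_eq_one_iff.1 (sgn_mul_self (a 2)) with h2 | h2 <;>
  rcases mul_self_eq_one_iff.1 (sgn_mul_self (a 0 * a 1)) with h3 | h3 <;>
  rcases mul_self_eq_one_iff.1 (sgn_mul_self (a 0 * a 2)) with h4 | h4 <;>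
  rcases mul_self_eq_one_iff.1 (sgn_mul_self (a 1 * a 2)) with h5 | h5 <;>
  rw [h0, h1, h2, h3, h4, h5] <;> module

theorem coe_update_hamForms {ι : Type*} [DecidableEq ι] (f : ι → hamForms ω) (i : ι)
    (x : hamForms ω) : (fun j => (Function.update f i x j : FormField E M))
      = Function.update (fun j => (f j : FormField E M)) i x := by
  funext j
  exact Function.apply_update (fun _ (g : hamForms ω) => (g : FormField E M)) f i x j

/-- `D₃` as a trilinear operator on the space of Hamiltonian forms. -/
def D₃Multilinear (hω : IsNPlectic n ω) :
    MultilinearMap ℝ (fun _ : Fin 3 => hamForms ω) (hamForms ω) where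
  toFun f := ⟨D₃ n ω fun i => (f i : FormField E M), D₃_mem_hamForms hω fun i => (f i).2⟩
  map_update_add' f i x y := by
    have h := D₃_update hω (fun i => (f i).2) i 1 x.2 y.2
    rw [one_smul, one_smul] at h
    simp only [Subtype.ext_iff, coe_update_hamForms, Submodule.coe_add]
    convert h
  map_update_smul' f i c x := by
    have h := D₃_update hω (fun i => (f i).2) i c x.2 (zero_mem _)
    -- With zero in both places the additivity rule reads `x = x + x`, so the extra summand in `h`
    -- vanishes.
    have h0 := D₃_update hω (fun i => (f i).2) i 1 (zero_mem (hamForms ω)) (zero_mem (hamForms ω))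
    rw [one_smul, add_zero, one_smul] at h0
    rw [left_eq_add.1 h0, add_zero, add_zero] at h
    simp only [Subtype.ext_iff, coe_update_hamForms, Submodule.coe_smul]
    convert h

end AssociatedFields

end

end NPlectic

theorem mainTheorem2 {E : Type*} [NormedAddCommGroup E] [NormedSpace ℝ E] [FiniteDimensional ℝ E]
    {M : Type*} [TopologicalSpace M] [ChartedSpace E M] [IsManifold 𝓘(ℝ, E) (⊤ : ℕ∞) M]
    (n : ℕ) (ω : FormField E M) (hω : IsNPlectic n ω) :
    -- `D₃` is a trilinear operator `H(M) × H(M) × H(M) → H(M)`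
    (∃ D : MultilinearMap ℝ (fun _ : Fin 3 => hamForms ω) (hamForms ω),
      ∀ f : Fin 3 → hamForms ω, (D f : FormField E M) = D₃ n ω (fun i => (f i : FormField E M))) ∧
    -- for homogeneous Hamiltonian forms `f 0, f 1, f 2` of symmetric degrees `a 0, a 1, a 2`:
    ∀ (a : Fin 3 → ℤ) (f : Fin 3 → FormField E M),
      (∀ i, f i ∈ hamForms ω) → (∀ i, HasDeg n (a i) (f i)) →
      -- the forms `D₂(fᵢ, fⱼ)` that enter `D₃` are well defined Hamiltonian forms, with the
      -- associated semi-Hamiltonian multivector fields `-2 e(fᵢ) [Xⱼ, Xᵢ]`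
      (∀ X : Fin 3 → MVField E M, (∀ i, IsSemiHam ω (X i) (f i)) → ∀ i j,
        D₂ n ω (f i) (f j) = D₂formula (a i) (a j) (X i) (X j) (f i) (f j) ∧
        D₂ n ω (f i) (f j) ∈ hamForms ω ∧
        IsSemiHam ω ((-2 * sgn (a i)) • schouten (X j) (X i)) (D₂ n ω (f i) (f j))) ∧
      -- `D₃` does not depend on the choice of the fields `X_{D₂}(fᵢ, fⱼ)`
      (∀ Z : Fin 3 → Fin 3 → MVField E M,
        (∀ i j, i < j → IsSemiHam ω (Z i j) (D₂ n ω (f i) (f j))) →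
        D₃ n ω f = D₃formula a Z f) ∧
      -- graded symmetry
      (∀ s : Equiv.Perm (Fin 3), D₃ n ω f = koszul s a • D₃ n ω (fun i => f (s i))) ∧
      -- homogeneity of degree `-1`
      HasDeg n (a 0 + a 1 + a 2 - 1) (D₃ n ω f) ∧
      -- the strong homotopy Jacobi equation in dimension three
      D₁ (D₃ n ω f)
        + ∑ s ∈ shuffles 1 2, koszul s a • D₃ n ω ![D₁ (f (s 0)), f (s 1), f (s 2)]
        + ∑ s ∈ shuffles 2 1, koszul s a • D₂ n ω (D₂ n ω (f (s 0)) (f (s 1))) (f (s 2)) = 0 ∧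
      -- associated multivector fields, for all choices of the fields associated to `fᵢ` and to
      -- `D₂(fᵢ, fⱼ)`
      (∀ (Y : Fin 3 → MVField E M) (Z : Fin 3 → Fin 3 → MVField E M),
        (∀ i, IsHam ω (Y i) (f i)) →
        (∀ i j, i < j → IsSemiHam ω (Z i j) (D₂ n ω (f i) (f j))) →
        IsHam ω
          ((-(1 / 2) : ℝ) • ∑ s ∈ shuffles 2 1,
            (koszul s a * sgn (a (s 0)) * sgn (a (s 1))) • (Y (s 2) * Z (s 0) (s 1)))
          (D₃ n ω f) ∧
        ∀ X : Fin 3 → MVField E M, (∀ i, IsSemiHam ω (X i) (f i)) →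
          IsSemiHam ω
            (∑ s ∈ shuffles 1 2, (koszul s a * sgn (a (s 1))) •
                schouten (schouten (X (s 2)) (X (s 1))) (Y (s 0))
              + (1 / 2 : ℝ) • ∑ s ∈ shuffles 2 1, koszul s a • (X (s 2) * Z (s 0) (s 1)))
            (D₃ n ω f)) := by
  refine ⟨⟨D₃Multilinear hω, fun f => rfl⟩, fun a f hm hd => ?_⟩
  have hf : ∀ i, HomHam n ω (a i) (f i) := fun i => ⟨hm i, hd i⟩
  refine ⟨fun X hX i j => ⟨D₂_eq hω (hX i) (hX j) (hf i) (hf j), (homHam_D₂ hω (hf i) (hf j)).mem,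
    isSemiHam_D₂ hω (hX i) (hX j) (hf i) (hf j)⟩, fun Z hZ => ?_, fun s => ?_, ?_,
    strong_homotopy_jacobi hω hf, fun Y Z hY hZ => ⟨isHam_D₃ hω hf hY hZ,
      fun X hX => isSemiHam_D₃ hω hf hX hY hZ⟩⟩
  -- A `(2,1)`-shuffle lists its first two entries in increasing order, so only the fields `Z i j`
  -- with `i < j` enter.
  · rw [D₃formula_eq, D₃_eq hω hf, tripleSum,
      triple_eq hω (hf 0) (hf 1) (hf 2) (hZ 0 1 (by decide)),
      triple_eq hω (hf 0) (hf 2) (hf 1) (hZ 0 2 (by decide)),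
      triple_eq hω (hf 1) (hf 2) (hf 0) (hZ 1 2 (by decide))]
  · exact D₃_perm hω hf s
  · rw [D₃_eq hω hf]
    exact (homHam_tripleSum hω (hf 0) (hf 1) (hf 2)).deg
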